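/- Joint customization, pricing and assortment optimization under a mixture of multinomial logit (MNL) models. An instance consists of a finite set $N$ of $n$ products, $m$ customer types with probabilities $\alpha_1,\dots,\alpha_m\ge 0$, $\sum_j\alpha_j=1$, a finite price ladder $P=\{p_1,\dots,p_r\}$ of $r\ge 1$ distinct non-negative prices, a number $k\ge 0$, and MNL parameters $v_{j,0}\ge 0$ (outside option) and $v_{j,i,p}\ge 0$ for $j\in[m]$, $i\in N$, $p\in P$; all these data are rational numbers. If a customer of type $j$ is offered the assortment $X\subseteq N$ at prices $\mathbf r=(r_i)$ with $r_i\in P$, then the customer chooses product $i\in X$ with probability $$\phi_j(i,X,\mathbf r)=\frac{v_{j,i,r_i}}{v_{j,0}+\sum_{e\in X}v_{j,e,r_e}}$$ (read as $0$ if the denominator is $0$). The problem is to choose a selection $S\subseteq N$ of at most $k$ products and, for every type $j$, an assortment $X_j\subseteq S$ and prices from $P$ for its products, so as to attain $$\mathrm{OPT}=\max_{S\subseteq N,\ |S|\le k}\ \sum_{j\in[m]}\alpha_j\max_{X\subseteq S,\ \mathbf r}\ \sum_{i\in X}r_i\,\phi_j(i,X,\mathbf r).$$ Then there is a polynomial-time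 $0.25$-approximation algorithm: a single algorithm which, on every instance, in time polynomial in the binary length of the instance, outputs a feasible solution (a selection $S$ with $|S|\le k$, and for each type $j$ an assortment $X_j\subseteq S$ with prices from $P$) whose expected revenue $\sum_j\alpha_j\sum_{i\in X_j}r_{j,i}\,\phi_j(i,X_j,\mathbf r_j)$ is at least $\tfrac14\,\mathrm{OPT}$. -/

import Mathlib

/-! ## A random access machine with logarithmic (bit-length) cost

Programs are structured `while` programs over finitely many named arrays whose cells hold exact
rational numbers.  Every value that is computed, every constant and every array index is charged
its binary length, so that polynomial cost is polynomial time in the usual (bit) sense. -/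

namespace LogRAM

/-- The binary length of a rational number in lowest terms. -/
def bitLength (q : ℚ) : ℕ := Nat.size q.num.natAbs + Nat.size q.den

/-- A memory: `s a x` is the content of cell `x` of the array with name `a`. -/
abbrev Mem : Type := ℕ → ℕ → ℚ

/-- The memory `s` after `q` has been written into cell `x` of array `a`. -/
def Mem.write (s : Mem) (a x : ℕ) (q : ℚ) : Mem :=
  fun b y => if b = a ∧ y = x then q else s b y

/-- Expressions: constants, array cells (the index is rounded down to a natural number), and the
four arithmetic operations (with `x / 0 = 0`). -/
inductive Expr : Type
  | const (q : ℚ)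
  | cell (a : ℕ) (i : Expr)
  | add (e f : Expr)
  | sub (e f : Expr)
  | mul (e f : Expr)
  | div (e f : Expr)

/-- The value of an expression. -/
def Expr.eval (s : Mem) : Expr → ℚ
  | .const q => q
  | .cell a i => s a ⌊i.eval s⌋₊
  | .add e f => e.eval s + f.eval s
  | .sub e f => e.eval s - f.eval s
  | .mul e f => e.eval s * f.eval s
  | .div e f => e.eval s / f.eval s

/-- The cost of evaluating an expression: one step, plus the binary length of the value, for every
subexpression. -/
def Expr.cost (s : Mem) : Expr → ℕ
  | .const q => 1 + bitLength q
  | .cell a i => i.cost s + (1 + bitLength (s a ⌊i.eval s⌋₊))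
  | .add e f => e.cost s + f.cost s + (1 + bitLength (e.eval s + f.eval s))
  | .sub e f => e.cost s + f.cost s + (1 + bitLength (e.eval s - f.eval s))
  | .mul e f => e.cost s + f.cost s + (1 + bitLength (e.eval s * f.eval s))
  | .div e f => e.cost s + f.cost s + (1 + bitLength (e.eval s / f.eval s))

/-- Programs. `assign a i e` writes the value of `e` into the cell of array `a` with index `i`;
the tests of `ite` and `loop` are strict comparisons of two expressions. -/
inductive Prog : Type
  | skip
  | assign (a : ℕ) (i e : Expr)
  | seq (p q : Prog)
  | ite (e f : Expr) (p q : Prog)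
  | loop (e f : Expr) (p : Prog)

/-- `Run p s t c`: started in memory `s`, the program `p` halts in memory `t` at total cost `c`. -/
inductive Run : Prog → Mem → Mem → ℕ → Prop
  | skip (s : Mem) : Run .skip s s 1
  | assign (s : Mem) (a : ℕ) (i e : Expr) :
      Run (.assign a i e) s (s.write a ⌊i.eval s⌋₊ (e.eval s)) (i.cost s + e.cost s + 1)
  | seq {p q : Prog} {s t u : Mem} {c d : ℕ} (hp : Run p s t c) (hq : Run q t u d) :
      Run (.seq p q) s u (c + d + 1)
  | ite_true {e f : Expr} {p q : Prog} {s t : Mem} {c : ℕ} (h : e.eval s < f.eval s)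
      (hp : Run p s t c) : Run (.ite e f p q) s t (e.cost s + f.cost s + c + 1)
  | ite_false {e f : Expr} {p q : Prog} {s t : Mem} {c : ℕ} (h : ¬ e.eval s < f.eval s)
      (hq : Run q s t c) : Run (.ite e f p q) s t (e.cost s + f.cost s + c + 1)
  | loop_done {e f : Expr} {p : Prog} {s : Mem} (h : ¬ e.eval s < f.eval s) :
      Run (.loop e f p) s s (e.cost s + f.cost s + 1)
  | loop_next {e f : Expr} {p : Prog} {s t u : Mem} {c d : ℕ} (h : e.eval s < f.eval s)
      (hp : Run p s t c) (hl : Run (.loop e f p) t u d) :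
      Run (.loop e f p) s u (e.cost s + f.cost s + c + d + 1)

end LogRAM

/-! ## Joint customization, pricing and assortment optimization under an MNL mixture -/

namespace JointPricing

/-- An instance: `n` products, `m` customer types, a ladder of `r` distinct prices, and at most `k`
products in the selection.  A customer is of type `j` with probability `weight j`, and chooses
according to a multinomial logit model in which product `i` at the price with index `l` has
parameter `v j i l` and the outside option has parameter `v₀ j`. -/
structure Instance where
  n : ℕ
  m : ℕ
  r : ℕ
  k : ℕ
  price : Fin r → ℚ
  weight : Fin m → ℚ
  v₀ : Fin m → ℚ
  v : Fin m → Fin n → Fin r → ℚ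
  r_pos : 0 < r
  price_nonneg : ∀ l, 0 ≤ price l
  price_injective : Function.Injective price
  weight_nonneg : ∀ j, 0 ≤ weight j
  weight_sum : ∑ j, weight j = 1
  v₀_nonneg : ∀ j, 0 ≤ v₀ j
  v_nonneg : ∀ j i l, 0 ≤ v j i l

namespace Instance

variable (I : Instance)

/-- The multinomial logit probability that a customer of type `j` chooses product `i` from the
assortment `X`, where every product `e` of `X` is offered at the price with index `ρ e`.
(It is `0` if all parameters, including that of the outside option, vanish.) -/
def choiceProb (j : Fin I.m) (X : Finset (Fin I.n)) (ρ : Fin I.n → Fin I.r) (i : Fin I.n) : ℚ :=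
  I.v j i (ρ i) / (I.v₀ j + ∑ e ∈ X, I.v j e (ρ e))

/-- The expected revenue from a customer of type `j` who is offered `X` at the prices `ρ`. -/
def revenue (j : Fin I.m) (X : Finset (Fin I.n)) (ρ : Fin I.n → Fin I.r) : ℚ :=
  ∑ i ∈ X, I.price (ρ i) * I.choiceProb j X ρ i

/-- The best expected revenue from type `j` over all assortments `X ⊆ S` and all price vectors:
a maximum over a finite nonempty set. -/
noncomputable def bestRevenue (j : Fin I.m) (S : Finset (Fin I.n)) : ℝ :=
  ⨆ c : {X : Finset (Fin I.n) // X ⊆ S} × (Fin I.n → Fin I.r), (I.revenue j c.1 c.2 : ℝ)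

/-- The optimal value of the joint problem: a maximum over the finite nonempty set of all
selections of at most `k` products. -/
noncomputable def opt : ℝ :=
  ⨆ S : {S : Finset (Fin I.n) // S.card ≤ I.k}, ∑ j, (I.weight j : ℝ) * I.bestRevenue j S

/-- The length of the instance in binary. -/
def size : ℕ :=
  LogRAM.bitLength I.n + LogRAM.bitLength I.m + LogRAM.bitLength I.r + LogRAM.bitLength I.k
    + ∑ l, LogRAM.bitLength (I.price l)
    + ∑ j, LogRAM.bitLength (I.weight j)
    + ∑ j, LogRAM.bitLength (I.v₀ j)
    + ∑ j, ∑ i, ∑ l, LogRAM.bitLength (I.v j i l)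

/-- The initial memory: array `0` holds `n, m, r, k`, array `1` the prices, array `2` the type
probabilities, array `3` the parameters of the outside options, and cell `(j * n + i) * r + l` of
array `4` holds `v j i l`.  All other cells are `0`. -/
def input : LogRAM.Mem
  | 0, 0 => I.n
  | 0, 1 => I.m
  | 0, 2 => I.r
  | 0, 3 => I.k
  | 1, x => if h : x < I.r then I.price ⟨x, h⟩ else 0
  | 2, x => if h : x < I.m then I.weight ⟨x, h⟩ else 0
  | 3, x => if h : x < I.m then I.v₀ ⟨x, h⟩ else 0
  | 4, x =>
      if h : x / I.r / I.n < I.m ∧ x / I.r % I.n < I.n ∧ x % I.r < I.r then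
        I.v ⟨x / I.r / I.n, h.1⟩ ⟨x / I.r % I.n, h.2.1⟩ ⟨x % I.r, h.2.2⟩
      else 0
  | _, _ => 0

/-- The layout of array `4` is the announced one. -/
theorem input_v (j : Fin I.m) (i : Fin I.n) (l : Fin I.r) :
    I.input 4 ((j * I.n + i) * I.r + l) = I.v j i l := by
  have hl : ((j * I.n + i) * I.r + l : ℕ) % I.r = l := by
    rw [Nat.mul_add_mod_self_right, Nat.mod_eq_of_lt l.2]
  have hr : ((j * I.n + i) * I.r + l : ℕ) / I.r = j * I.n + i := by
    rw [mul_comm, Nat.mul_add_div I.r_pos, Nat.div_eq_of_lt l.2, add_zero]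
  have hn : 0 < I.n := lt_of_le_of_lt (Nat.zero_le _) i.2
  have hi : (j * I.n + i : ℕ) % I.n = i := by
    rw [Nat.mul_add_mod_self_right, Nat.mod_eq_of_lt i.2]
  have hj : (j * I.n + i : ℕ) / I.n = j := by
    rw [mul_comm, Nat.mul_add_div hn, Nat.div_eq_of_lt i.2, add_zero]
  simp [input, hl, hr, hi, hj]

end Instance

/-- A solution: a selection of products and, for every customer type, the assortment that is
offered to it and the (indices of the) prices; prices of products not offered are irrelevant. -/
structure Solution (I : Instance) where
  selection : Finset (Fin I.n)
  offered : Fin I.m → Finset (Fin I.n)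
  prices : Fin I.m → Fin I.n → Fin I.r

namespace Solution

variable {I : Instance} (P : Solution I)

/-- At most `k` products are selected, and only selected products are offered. -/
def Feasible : Prop :=
  P.selection.card ≤ I.k ∧ ∀ j, P.offered j ⊆ P.selection

/-- The expected revenue of a solution. -/
def value : ℚ := ∑ j, I.weight j * I.revenue j (P.offered j) (P.prices j)

/-- The memory `s` contains the solution as output: array `5` holds the indicator vector of the
selection, and cell `j * n + i` of array `6` holds `0` if product `i` is not offered to type `j`,
and `l + 1` if it is offered at the price with index `l`. -/
def IsOutput (s : LogRAM.Mem) : Prop :=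
  (∀ i : Fin I.n, s 5 i = if i ∈ P.selection then 1 else 0) ∧
  ∀ (j : Fin I.m) (i : Fin I.n),
    s 6 (j * I.n + i) = if i ∈ P.offered j then ((P.prices j i : ℕ) : ℚ) + 1 else 0

end Solution

end JointPricing

/-! Fix a customer type with outside parameter `v₀ > 0` and a selection `S`. Let `h i z` be the
positive part of the maximum over `l` of the lines `v i l * (price l - z)`. A revenue `W / (v₀ + V)`
with positive denominator is at most `z` exactly when `W - z * V ≤ z * v₀`. Hence the best revenue
`g` from `S` solves `∑ i ∈ S, h i g = g * v₀`. Put `φ z = z + (∑ i ∈ S, h i z) / v₀`. Each `h i` is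
antitone, so `φ z ≥ g` for all `z ≥ 0`: the first term suffices when `z ≥ g`, the second when `z ≤
g`. Moreover `φ g = 2 * g`. So the minimum of `φ`, the surrogate, lies between `g` and `2 * g`
(`Table.revenue_le_surrogate`, `Table.exists_surrogate_le_two_mul`). For fixed `z` the value is
modular in `S`, with coefficients that decrease in `z`; an exchange of minimizers shows that the
minimum over `z` is monotone and submodular (`Table.surrogate_submodular`), unlike the best revenue
in general. As `φ` is piecewise affine, it suffices to try the crossings and zeros of the lines of
single products, which are polynomially many and do not depend on `S`. If `v₀ = 0`, every product
with a positive line gets the share `priceSum`, which exceeds or equals any revenue, and the same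
inequalities hold. Greedy selection for the weighted sum of the surrogates loses a factor 2
(`GreedyInv.le_two_mul`), and the surrogate loses another 2. For each type the best lines at the
last threshold below `g` are an assortment of revenue `g`, so trying all rows recovers it.
Altogether this gives 1/4. On the machine side, `len` is subadditive under arithmetic, so explicit
length bounds for each array are propagated by a Hoare calculus (`Reaches`). For a fixed program,
bounds on cell lengths and loop rounds turn into a polynomial cost bound
(`Prog.exists_polynomial_costBound`). -/

namespace LogRAM

/-! ### Lengths of rational numbers -/

/-- A length of a rational number that is subadditive under all four arithmetic operations. -/
def len (q : ℚ) : ℕ := 1 + max q.num.natAbs.size q.den.size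

theorem bitLength_le_len (q : ℚ) : bitLength q ≤ 2 * len q := by
  unfold bitLength len
  have h1 := le_max_left q.num.natAbs.size q.den.size
  have h2 := le_max_right q.num.natAbs.size q.den.size
  omega

theorem len_le_bitLength (q : ℚ) : len q ≤ bitLength q + 1 := by
  unfold bitLength len
  have := max_le_add_of_nonneg (Nat.zero_le q.num.natAbs.size) (Nat.zero_le q.den.size)
  omega

/-- Reduction to lowest terms only shrinks numerator and denominator, so any representing fraction
bounds the length. -/
theorem len_le_of_eq_div {q : ℚ} {a : ℤ} {c k : ℕ} (hc : c ≠ 0) (h : q = (a : ℚ) / (c : ℚ))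
    (ha : a.natAbs < 2 ^ k) (hck : c < 2 ^ k) : len q ≤ k + 1 := by
  have hc' : (c : ℤ) ≠ 0 := by exact_mod_cast hc
  have e : q = (a : ℚ) / ((c : ℤ) : ℚ) := by rw [h]; push_cast; rfl
  have hn : q.num.natAbs ≤ a.natAbs := by
    by_cases h0 : a = 0
    · simp [h, h0]
    · refine Nat.le_of_dvd (Int.natAbs_pos.2 h0) (Int.natAbs_dvd_natAbs.2 ?_)
      rw [e, ← Rat.divInt_eq_div]
      exact Rat.num_dvd a hc'
  have hd : q.den ≤ c := by
    refine Nat.le_of_dvd (Nat.pos_of_ne_zero hc) ?_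
    have := Rat.den_dvd a c
    rw [Rat.divInt_eq_div, ← e] at this
    exact_mod_cast this
  have h1 : q.num.natAbs.size ≤ k := Nat.size_le.2 (hn.trans_lt ha)
  have h2 : q.den.size ≤ k := Nat.size_le.2 (hd.trans_lt hck)
  have := max_le h1 h2
  unfold len
  omega

theorem natAbs_num_lt (q : ℚ) : q.num.natAbs < 2 ^ (len q - 1) :=
  Nat.size_le.1 (by unfold len; have := le_max_left q.num.natAbs.size q.den.size; omega)

theorem den_lt (q : ℚ) : q.den < 2 ^ (len q - 1) :=
  Nat.size_le.1 (by unfold len; have := le_max_right q.num.natAbs.size q.den.size; omega)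

theorem one_le_len (q : ℚ) : 1 ≤ len q := by unfold len; omega

theorem len_neg (q : ℚ) : len (-q) = len q := by simp [len]

/-- The numerator of the cross-multiplied sum may need one bit more than a product; the summand 1 in
`len`, present in both `len a` and `len b`, pays for it. -/
theorem len_add (a b : ℚ) : len (a + b) ≤ len a + len b := by
  have ha := one_le_len a
  have hb := one_le_len b
  have key : len (a + b) ≤ (len a - 1 + (len b - 1) + 1) + 1 := by
    refine len_le_of_eq_div (a := a.num * b.den + b.num * a.den) (c := a.den * b.den)
      (mul_ne_zero a.den_nz b.den_nz) ?_ ?_ ?_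
    · have h1 := a.num_div_den
      have h2 := b.num_div_den
      have h3 : (a.den : ℚ) ≠ 0 := by exact_mod_cast a.den_nz
      have h4 : (b.den : ℚ) ≠ 0 := by exact_mod_cast b.den_nz
      nth_rewrite 1 [← h1, ← h2]
      push_cast
      field_simp
    · have h1 : a.num.natAbs * b.den < 2 ^ (len a - 1 + (len b - 1)) := by
        rw [pow_add]; exact Nat.mul_lt_mul'' (natAbs_num_lt a) (den_lt b)
      have h2 : b.num.natAbs * a.den < 2 ^ (len a - 1 + (len b - 1)) := by
        rw [add_comm, pow_add]; exact Nat.mul_lt_mul'' (natAbs_num_lt b) (den_lt a)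
      have h3 := Int.natAbs_add_le (a.num * b.den) (b.num * a.den)
      rw [Int.natAbs_mul, Int.natAbs_mul, Int.natAbs_natCast, Int.natAbs_natCast] at h3
      rw [pow_succ]
      omega
    · have h1 : a.den * b.den < 2 ^ (len a - 1 + (len b - 1)) := by
        rw [pow_add]; exact Nat.mul_lt_mul'' (den_lt a) (den_lt b)
      rw [pow_succ]
      omega
  omega

theorem len_sub (a b : ℚ) : len (a - b) ≤ len a + len b := by
  rw [sub_eq_add_neg, ← len_neg b]
  exact len_add a (-b)

theorem len_mul (a b : ℚ) : len (a * b) ≤ len a + len b := by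
  have ha := one_le_len a
  have hb := one_le_len b
  have key : len (a * b) ≤ (len a - 1 + (len b - 1)) + 1 := by
    refine len_le_of_eq_div (a := a.num * b.num) (c := a.den * b.den)
      (mul_ne_zero a.den_nz b.den_nz) ?_ ?_ ?_
    · nth_rewrite 1 [← a.num_div_den, ← b.num_div_den]
      push_cast
      rw [div_mul_div_comm]
    · rw [Int.natAbs_mul, pow_add]
      exact Nat.mul_lt_mul'' (natAbs_num_lt a) (natAbs_num_lt b)
    · rw [pow_add]; exact Nat.mul_lt_mul'' (den_lt a) (den_lt b)
  omega

theorem len_inv (a : ℚ) : len a⁻¹ ≤ len a := by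
  by_cases h0 : a = 0
  · simp [h0]
  have hn : a.num ≠ 0 := Rat.num_ne_zero.2 h0
  have key : len a⁻¹ ≤ (len a - 1) + 1 := by
    -- Denominators are natural numbers, so the sign moves to the new numerator.
    refine len_le_of_eq_div (a := a.num.sign * a.den) (c := a.num.natAbs)
      (Int.natAbs_ne_zero.2 hn) ?_ ?_ (natAbs_num_lt a)
    · have h3 : (a.den : ℚ) ≠ 0 := by exact_mod_cast a.den_nz
      have h4 : ((a.num.natAbs : ℕ) : ℚ) ≠ 0 := by exact_mod_cast Int.natAbs_ne_zero.2 hn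
      have h5 : (a.num : ℚ) = (a.num.sign : ℚ) * (a.num.natAbs : ℚ) := by
        rw [← Int.cast_natCast, ← Int.cast_mul, Int.sign_mul_natAbs]
      have h6 : (a.num.sign : ℚ) * (a.num.sign : ℚ) = 1 := by
        rcases lt_or_gt_of_ne hn with h | h
        · simp [Int.sign_eq_neg_one_of_neg h]
        · simp [Int.sign_eq_one_of_pos h]
      have h7 : (a.num.sign : ℚ) ≠ 0 := fun h => by simp [h] at h6
      nth_rewrite 1 [← a.num_div_den]
      rw [h5]
      push_cast
      rw [inv_div, div_eq_div_iff (mul_ne_zero h7 (by exact_mod_cast h4)) (by exact_mod_cast h4)]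
      linear_combination (-(a.den : ℚ) * (a.num.natAbs : ℚ)) * h6
    · rw [Int.natAbs_mul, Int.natAbs_sign_of_ne_zero hn, one_mul, Int.natAbs_natCast]
      exact den_lt a
  have := one_le_len a
  omega

theorem len_div (a b : ℚ) : len (a / b) ≤ len a + len b := by
  rw [div_eq_mul_inv]
  exact (len_mul _ _).trans (Nat.add_le_add_left (len_inv b) _)

theorem len_natCast_mono {a b : ℕ} (h : a ≤ b) : len a ≤ len b := by
  unfold len
  have := Nat.size_le_size h
  simp only [Rat.num_natCast, Int.natAbs_natCast, Rat.den_natCast]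
  omega

@[simp] theorem len_zero : len 0 = 2 := by simp [len]

@[simp] theorem len_one : len 1 = 2 := by simp [len]

@[simp] theorem len_neg_one : len (-1) = 2 := by rw [len_neg, len_one]

/-! ### Cost bounds derived from length bounds -/

instance : Add Expr := ⟨.add⟩
instance : Sub Expr := ⟨.sub⟩
instance : Mul Expr := ⟨.mul⟩
instance : Div Expr := ⟨.div⟩

/-- The scalar variable kept in cell `0` of array `a`. -/
def var (a : ℕ) : Expr := .cell a (.const 0)

@[simp] theorem eval_const (s : Mem) (q : ℚ) : (Expr.const q).eval s = q := rfl
@[simp] theorem eval_cell (s : Mem) (a : ℕ) (i : Expr) :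
    (Expr.cell a i).eval s = s a ⌊i.eval s⌋₊ := rfl
@[simp] theorem eval_var (s : Mem) (a : ℕ) : (var a).eval s = s a 0 := by simp [var]
@[simp] theorem eval_add (s : Mem) (e f : Expr) : (e + f).eval s = e.eval s + f.eval s := rfl
@[simp] theorem eval_sub (s : Mem) (e f : Expr) : (e - f).eval s = e.eval s - f.eval s := rfl
@[simp] theorem eval_mul (s : Mem) (e f : Expr) : (e * f).eval s = e.eval s * f.eval s := rfl
@[simp] theorem eval_div (s : Mem) (e f : Expr) : (e / f).eval s = e.eval s / f.eval s := rfl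

@[simp] theorem write_same (s : Mem) (a x : ℕ) (q : ℚ) : s.write a x q a x = q := by
  simp [Mem.write]

theorem write_ne (s : Mem) {a b : ℕ} (x : ℕ) (q : ℚ) (h : b ≠ a) : s.write a x q b = s b := by
  funext y; simp [Mem.write, h]

theorem write_ne_cell (s : Mem) (a : ℕ) {x y : ℕ} (q : ℚ) (h : y ≠ x) :
    s.write a x q a y = s a y := by
  simp [Mem.write, h]

/-- A bound for the length of the value of an expression when the array `a` only holds numbers of
length at most `β a`. -/
def Expr.weight (β : ℕ → ℕ) : Expr → ℕ
  | .const q => len q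
  | .cell a _ => β a
  | .add e f => e.weight β + f.weight β
  | .sub e f => e.weight β + f.weight β
  | .mul e f => e.weight β + f.weight β
  | .div e f => e.weight β + f.weight β

/-- A bound for the cost of an expression when all cells hold numbers of length at most `B`. -/
def Expr.costBound (B : ℕ) : Expr → ℕ
  | .const q => 1 + bitLength q
  | .cell _ i => i.costBound B + (1 + 2 * B)
  | .add e f => e.costBound B + f.costBound B
      + (1 + 2 * (e.weight (fun _ => B) + f.weight fun _ => B))
  | .sub e f => e.costBound B + f.costBound B
      + (1 + 2 * (e.weight (fun _ => B) + f.weight fun _ => B))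
  | .mul e f => e.costBound B + f.costBound B
      + (1 + 2 * (e.weight (fun _ => B) + f.weight fun _ => B))
  | .div e f => e.costBound B + f.costBound B
      + (1 + 2 * (e.weight (fun _ => B) + f.weight fun _ => B))

/-- Array `a` only holds numbers of length at most `β a`. -/
def Bounded (β : ℕ → ℕ) (s : Mem) : Prop := ∀ a x, len (s a x) ≤ β a

theorem Bounded.len_eval {β : ℕ → ℕ} {s : Mem} (h : Bounded β s) (e : Expr) :
    len (e.eval s) ≤ e.weight β := by
  induction e with
  | const q => exact le_rfl
  | cell a i _ => exact h _ _
  | add e f he hf => exact (len_add _ _).trans (add_le_add he hf)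
  | sub e f he hf => exact (len_sub _ _).trans (add_le_add he hf)
  | mul e f he hf => exact (len_mul _ _).trans (add_le_add he hf)
  | div e f he hf => exact (len_div _ _).trans (add_le_add he hf)

theorem Bounded.mono {β γ : ℕ → ℕ} {s : Mem} (h : Bounded β s) (hβ : ∀ a, β a ≤ γ a) :
    Bounded γ s := fun a x => (h a x).trans (hβ a)

theorem Bounded.write {β : ℕ → ℕ} {s : Mem} (h : Bounded β s) {a x : ℕ} {q : ℚ}
    (hq : len q ≤ β a) : Bounded β (s.write a x q) := by
  intro b y
  unfold Mem.write
  split_ifs with hb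
  · exact hb.1 ▸ hq
  · exact h b y

theorem Bounded.cost_le {B : ℕ} {s : Mem} (h : Bounded (fun _ => B) s) (e : Expr) :
    e.cost s ≤ e.costBound B := by
  induction e with
  | const q => exact le_rfl
  | cell a i hi =>
    have : bitLength (s a ⌊i.eval s⌋₊) ≤ 2 * B :=
      (bitLength_le_len _).trans (Nat.mul_le_mul_left 2 (h a _))
    simp only [Expr.cost, Expr.costBound]
    omega
  | add e f he hf =>
    have := (bitLength_le_len (e.eval s + f.eval s)).trans (Nat.mul_le_mul_left 2 (len_add _ _))
    have h1 := h.len_eval e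
    have h2 := h.len_eval f
    simp only [Expr.cost, Expr.costBound]
    omega
  | sub e f he hf =>
    have := (bitLength_le_len (e.eval s - f.eval s)).trans (Nat.mul_le_mul_left 2 (len_sub _ _))
    have h1 := h.len_eval e
    have h2 := h.len_eval f
    simp only [Expr.cost, Expr.costBound]
    omega
  | mul e f he hf =>
    have := (bitLength_le_len (e.eval s * f.eval s)).trans (Nat.mul_le_mul_left 2 (len_mul _ _))
    have h1 := h.len_eval e
    have h2 := h.len_eval f
    simp only [Expr.cost, Expr.costBound]
    omega
  | div e f he hf =>
    have := (bitLength_le_len (e.eval s / f.eval s)).trans (Nat.mul_le_mul_left 2 (len_div _ _))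
    have h1 := h.len_eval e
    have h2 := h.len_eval f
    simp only [Expr.cost, Expr.costBound]
    omega

/-- A bound for the cost of a program when all cells hold numbers of length at most `B` and every
loop makes at most `B` rounds each time it is entered. -/
def Prog.costBound (B : ℕ) : Prog → ℕ
  | .skip => 1
  | .assign _ i e => i.costBound B + e.costBound B + 1
  | .seq p q => p.costBound B + q.costBound B + 1
  | .ite e f p q => e.costBound B + f.costBound B + (p.costBound B + q.costBound B) + 1
  | .loop e f p => (B + 1) * (e.costBound B + f.costBound B + p.costBound B + 1)

theorem Expr.exists_polynomial_weight (e : Expr) :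
    ∃ P : Polynomial ℕ, ∀ B, e.weight (fun _ => B) = P.eval B := by
  induction e with
  | const q => exact ⟨.C (len q), fun B => by simp [weight]⟩
  | cell a i _ => exact ⟨.X, fun B => by simp [weight]⟩
  | add e f he hf | sub e f he hf | mul e f he hf | div e f he hf =>
    obtain ⟨P, hP⟩ := he
    obtain ⟨Q, hQ⟩ := hf
    exact ⟨P + Q, fun B => by simp [weight, hP, hQ]⟩

theorem Expr.exists_polynomial_costBound (e : Expr) :
    ∃ P : Polynomial ℕ, ∀ B, e.costBound B = P.eval B := by
  induction e with
  | const q => exact ⟨.C (1 + bitLength q), fun B => by simp [costBound]⟩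
  | cell a i hi =>
    obtain ⟨P, hP⟩ := hi
    exact ⟨P + (1 + 2 * .X), fun B => by simp [costBound, hP]⟩
  | add e f he hf | sub e f he hf | mul e f he hf | div e f he hf =>
    obtain ⟨P, hP⟩ := he
    obtain ⟨Q, hQ⟩ := hf
    obtain ⟨P', hP'⟩ := e.exists_polynomial_weight
    obtain ⟨Q', hQ'⟩ := f.exists_polynomial_weight
    exact ⟨P + Q + (1 + 2 * (P' + Q')), fun B => by simp [costBound, hP, hQ, hP', hQ']⟩

/-- The program is fixed while `B` varies: each level of loop nesting contributes one factor `B +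
1`. Polynomial time thus reduces to bounding the cell lengths and the numbers of rounds by a
polynomial. -/
theorem Prog.exists_polynomial_costBound (p : Prog) :
    ∃ P : Polynomial ℕ, ∀ B, p.costBound B = P.eval B := by
  induction p with
  | skip => exact ⟨1, fun B => by simp [costBound]⟩
  | assign a i e =>
    obtain ⟨P, hP⟩ := i.exists_polynomial_costBound
    obtain ⟨Q, hQ⟩ := e.exists_polynomial_costBound
    exact ⟨P + Q + 1, fun B => by simp [costBound, hP, hQ]⟩
  | seq p q hp hq =>
    obtain ⟨P, hP⟩ := hp
    obtain ⟨Q, hQ⟩ := hq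
    exact ⟨P + Q + 1, fun B => by simp [costBound, hP, hQ]⟩
  | ite e f p q hp hq =>
    obtain ⟨P, hP⟩ := hp
    obtain ⟨Q, hQ⟩ := hq
    obtain ⟨P', hP'⟩ := e.exists_polynomial_costBound
    obtain ⟨Q', hQ'⟩ := f.exists_polynomial_costBound
    exact ⟨P' + Q' + (P + Q) + 1, fun B => by simp [costBound, hP, hQ, hP', hQ']⟩
  | loop e f p hp =>
    obtain ⟨P, hP⟩ := hp
    obtain ⟨P', hP'⟩ := e.exists_polynomial_costBound
    obtain ⟨Q', hQ'⟩ := f.exists_polynomial_costBound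
    exact ⟨(.X + 1) * (P' + Q' + P + 1), fun B => by simp [costBound, hP, hP', hQ']⟩

/-! ### A Hoare calculus with costs -/

/-- Does the program contain an assignment to array `a`? -/
def Prog.writes : Prog → ℕ → Bool
  | .skip, _ => false
  | .assign b _ _, a => a == b
  | .seq p q, a => p.writes a || q.writes a
  | .ite _ _ p q, a => p.writes a || q.writes a
  | .loop _ _ p, a => p.writes a

/-- Since `writes` computes, `rfl` or `decide` settles which arrays survive a concrete subprogram.
-/
theorem Run.frame {p : Prog} {s t : Mem} {c : ℕ} (h : Run p s t c) {a : ℕ}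
    (ha : p.writes a = false) : t a = s a := by
  induction h with
  | skip => rfl
  | assign s b i e =>
    exact write_ne _ _ _ (by simpa [Prog.writes] using ha)
  | seq _ _ hp hq =>
    simp only [Prog.writes, Bool.or_eq_false_iff] at ha
    rw [hq ha.2, hp ha.1]
  | ite_true _ _ hp =>
    simp only [Prog.writes, Bool.or_eq_false_iff] at ha
    exact hp ha.1
  | ite_false _ _ hp =>
    simp only [Prog.writes, Bool.or_eq_false_iff] at ha
    exact hp ha.2
  | loop_done => rfl
  | loop_next _ _ _ hp hl => rw [hl ha, hp ha]

/-- Started in `s`, the program `p` halts within its cost bound in a memory that respects the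
bounds `β` and satisfies `Q`. -/
def Reaches (β : ℕ → ℕ) (B : ℕ) (p : Prog) (s : Mem) (Q : Mem → Prop) : Prop :=
  ∃ t c, Run p s t c ∧ c ≤ p.costBound B ∧ Bounded β t ∧ Q t

section Rules

variable {β : ℕ → ℕ} {B : ℕ} {s : Mem} {Q R : Mem → Prop}

theorem Reaches.mono {p : Prog} (h : Reaches β B p s R)
    (hRQ : ∀ t, Bounded β t → (∀ a, p.writes a = false → t a = s a) → R t → Q t) :
    Reaches β B p s Q := by
  obtain ⟨t, c, hr, hc, hb, hR⟩ := h
  exact ⟨t, c, hr, hc, hb, hRQ t hb (fun a ha => hr.frame ha) hR⟩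

theorem Reaches.skip (hs : Bounded β s) (h : Q s) : Reaches β B .skip s Q :=
  ⟨s, 1, .skip s, le_rfl, hs, h⟩

theorem Reaches.assign (hB : ∀ a, β a ≤ B) (hs : Bounded β s) {a : ℕ} {i e : Expr}
    (hl : len (e.eval s) ≤ β a) (h : Q (s.write a ⌊i.eval s⌋₊ (e.eval s))) :
    Reaches β B (.assign a i e) s Q :=
  ⟨_, _, .assign s a i e, Nat.succ_le_succ (add_le_add ((hs.mono hB).cost_le i)
    ((hs.mono hB).cost_le e)), hs.write hl, h⟩

theorem Reaches.seq {p q : Prog} (hp : Reaches β B p s R)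
    (hq : ∀ t, Bounded β t → (∀ a, p.writes a = false → t a = s a) → R t → Reaches β B q t Q) :
    Reaches β B (.seq p q) s Q := by
  obtain ⟨t, c, hr, hc, hb, hR⟩ := hp
  obtain ⟨u, d, hr', hd, hb', hQ⟩ := hq t hb (fun a ha => hr.frame ha) hR
  exact ⟨u, _, .seq hr hr', by simp only [Prog.costBound]; omega, hb', hQ⟩

theorem Reaches.assign_seq (hB : ∀ a, β a ≤ B) (hs : Bounded β s) {a : ℕ} {i e : Expr} {q : Prog}
    (hl : len (e.eval s) ≤ β a)
    (h : Bounded β (s.write a ⌊i.eval s⌋₊ (e.eval s)) →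
      Reaches β B q (s.write a ⌊i.eval s⌋₊ (e.eval s)) Q) :
    Reaches β B (.seq (.assign a i e) q) s Q :=
  Reaches.seq (R := fun t => t = s.write a ⌊i.eval s⌋₊ (e.eval s))
    (.assign hB hs hl rfl) fun t hb _ ht => by subst ht; exact h hb

theorem Reaches.ite (hB : ∀ a, β a ≤ B) (hs : Bounded β s) {e f : Expr} {p q : Prog}
    (hp : e.eval s < f.eval s → Reaches β B p s Q)
    (hq : ¬ e.eval s < f.eval s → Reaches β B q s Q) : Reaches β B (.ite e f p q) s Q := by
  have h1 := (hs.mono hB).cost_le e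
  have h2 := (hs.mono hB).cost_le f
  by_cases h : e.eval s < f.eval s
  · obtain ⟨t, c, hr, hc, hb, hQ⟩ := hp h
    exact ⟨t, _, .ite_true h hr, by simp only [Prog.costBound]; omega, hb, hQ⟩
  · obtain ⟨t, c, hr, hc, hb, hQ⟩ := hq h
    exact ⟨t, _, .ite_false h hr, by simp only [Prog.costBound]; omega, hb, hQ⟩

/-- `for x = 0, …, e - 1 do p`. -/
def forLoop (x : ℕ) (e : Expr) (p : Prog) : Prog :=
  .seq (.assign x (.const 0) (.const 0))
    (.loop (var x) e (.seq p (.assign x (.const 0) (var x + .const 1))))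

/-- `I i` is the invariant before round `i`. It must not depend on the array `x`, since the counter
changes after the body; and `e` must keep the value `N` as long as the arrays that the loop never
writes are unchanged. -/
theorem Reaches.forLoop (hB : ∀ a, β a ≤ B) (hs : Bounded β s) {x : ℕ} {e : Expr} {p : Prog}
    (I : ℕ → Mem → Prop) (N : ℕ) (hNB : N ≤ B) (hN : len N ≤ β x) (hx : p.writes x = false)
    (he : ∀ t : Mem, (∀ a, (LogRAM.forLoop x e p).writes a = false → t a = s a) → e.eval t = N)
    (hI : ∀ i t t', (∀ a, a ≠ x → t' a = t a) → I i t → I i t')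
    (h0 : I 0 s)
    (hp : ∀ i < N, ∀ t, Bounded β t →
      (∀ a, (LogRAM.forLoop x e p).writes a = false → t a = s a) → t x 0 = i → I i t →
        Reaches β B p t (I (i + 1))) :
    Reaches β B (LogRAM.forLoop x e p) s (I N) := by
  have hw : ∀ a, (LogRAM.forLoop x e p).writes a = false → a ≠ x ∧ p.writes a = false := by
    intro a ha
    simp only [LogRAM.forLoop, Prog.writes, Bool.or_eq_false_iff, beq_eq_false_iff_ne] at ha
    exact ⟨ha.1, ha.2.1⟩
  -- Induction on the number `k` of remaining rounds; the factor `k + 1` includes the final failing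
  -- test.
  have key : ∀ k i, i + k = N → ∀ t, Bounded β t →
      (∀ a, (LogRAM.forLoop x e p).writes a = false → t a = s a) → t x 0 = i → I i t →
      ∃ u c, Run (.loop (var x) e (.seq p (.assign x (.const 0) (var x + .const 1)))) t u c ∧
        c ≤ (k + 1) * ((var x).costBound B + e.costBound B
          + (Prog.seq p (.assign x (.const 0) (var x + .const 1))).costBound B + 1) ∧
        Bounded β u ∧ I N u := by
    intro k
    induction k with
    | zero =>
      intro i hi t hb hf hxi hIt
      have h1 := (hb.mono hB).cost_le (var x)
      have h2 := (hb.mono hB).cost_le e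
      obtain rfl : i = N := by omega
      exact ⟨t, _, .loop_done (by simp [he t hf, hxi]), by omega, hb, hIt⟩
    | succ k ih =>
      intro i hi t hb hf hxi hIt
      have h1 := (hb.mono hB).cost_le (var x)
      have h2 := (hb.mono hB).cost_le e
      have hlt : i < N := by omega
      have hlt' : (i : ℚ) < N := by exact_mod_cast hlt
      obtain ⟨u, c, hr, hc, hbu, hIu⟩ := hp i hlt t hb hf hxi hIt
      have hux : u x 0 = i := by rw [hr.frame hx, hxi]
      have hev : (var x + .const 1).eval u = ((i + 1 : ℕ) : ℚ) := by simp [hux]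
      obtain ⟨w, d, hr', hd, hbw, hIw⟩ := Reaches.assign (Q := fun w => w = u.write x 0 (i + 1 : ℕ))
        hB hbu (a := x) (i := .const 0) (e := var x + .const 1)
        (by rw [hev]; exact (len_natCast_mono (by omega)).trans hN) (by rw [hev]; simp)
      subst hIw
      have hfw : ∀ a, (LogRAM.forLoop x e p).writes a = false →
          u.write x 0 ((i + 1 : ℕ) : ℚ) a = s a := by
        intro a ha
        obtain ⟨hax, hap⟩ := hw a ha
        rw [write_ne _ _ _ hax, hr.frame hap, hf a ha]
      obtain ⟨y, c', hry, hcy, hby, hIy⟩ := ih (i + 1) (by omega) _ hbw hfw (by simp)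
        (hI _ u _ (fun a ha => write_ne _ _ _ ha) hIu)
      refine ⟨y, _, .loop_next (by simp [he t hf, hxi, hlt']) (.seq hr hr') hry, ?_, hby, hIy⟩
      rw [Nat.succ_mul (k + 1)]
      have : (Prog.seq p (.assign x (.const 0) (var x + .const 1))).costBound B
        = p.costBound B + (Prog.assign x (.const 0) (var x + .const 1)).costBound B + 1 := rfl
      omega
  obtain ⟨w, d, hr, hd, hbw, hIw⟩ := Reaches.assign (Q := fun w => w = s.write x 0 0)
    hB hs (a := x) (i := .const 0) (e := .const 0)
    (by simpa using (len_natCast_mono (Nat.zero_le N)).trans hN) (by simp)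
  subst hIw
  obtain ⟨u, c, hru, hcu, hbu, hIu⟩ := key N 0 (by omega) _ hbw
    (fun a ha => write_ne _ _ _ (hw a ha).1) (by simp)
    (hI _ s _ (fun a ha => write_ne _ _ _ ha) h0)
  refine ⟨u, _, .seq hr hru, ?_, hbu, hIu⟩
  have hmul := Nat.mul_le_mul_right ((var x).costBound B + e.costBound B
          + (Prog.seq p (.assign x (.const 0) (var x + .const 1))).costBound B + 1)
          (Nat.succ_le_succ hNB)
  simp only [LogRAM.forLoop, Prog.costBound] at hmul hd hcu ⊢
  simp only [Nat.succ_eq_add_one] at hmul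
  omega

end Rules

end LogRAM

namespace JointPricing

open Finset LogRAM

/-! ### The submodular surrogate of the best revenue -/

/-- The minimum of `P` and `f 0, …, f (Q - 1)`. -/
def minUpTo (P : ℚ) (f : ℕ → ℚ) : ℕ → ℚ
  | 0 => P
  | q + 1 => min (minUpTo P f q) (f q)

theorem minUpTo_le_top (P : ℚ) (f : ℕ → ℚ) (Q : ℕ) : minUpTo P f Q ≤ P := by
  induction Q with
  | zero => exact le_rfl
  | succ q ih => exact (min_le_left _ _).trans ih

theorem minUpTo_le (P : ℚ) (f : ℕ → ℚ) {q Q : ℕ} (h : q < Q) : minUpTo P f Q ≤ f q := by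
  induction Q with
  | zero => omega
  | succ Q ih =>
    rcases Nat.lt_succ_iff_lt_or_eq.1 h with h | rfl
    · exact (min_le_left _ _).trans (ih h)
    · exact min_le_right _ _

theorem minUpTo_eq (P : ℚ) (f : ℕ → ℚ) (Q : ℕ) :
    minUpTo P f Q = P ∨ ∃ q < Q, minUpTo P f Q = f q := by
  induction Q with
  | zero => exact .inl rfl
  | succ Q ih =>
    rcases min_choice (minUpTo P f Q) (f Q) with h | h
    · rcases ih with h' | ⟨q, hq, h'⟩
      · exact .inl (h.trans h')
      · exact .inr ⟨q, by omega, h.trans h'⟩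
    · exact .inr ⟨Q, by omega, h⟩

namespace Instance

variable (I : Instance)

/-- The sum of all prices. -/
def priceSum : ℚ := ∑ l, I.price l

theorem price_le_priceSum (l : Fin I.r) : I.price l ≤ I.priceSum :=
  single_le_sum (f := I.price) (fun l _ => I.price_nonneg l) (mem_univ l)

theorem priceSum_nonneg : 0 ≤ I.priceSum := sum_nonneg fun l _ => I.price_nonneg l

theorem revenue_eq (j : Fin I.m) (X : Finset (Fin I.n)) (ρ : Fin I.n → Fin I.r) :
    I.revenue j X ρ =
      (∑ i ∈ X, I.v j i (ρ i) * I.price (ρ i)) / (I.v₀ j + ∑ i ∈ X, I.v j i (ρ i)) := by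
  rw [revenue, sum_div]
  exact sum_congr rfl fun i _ => by rw [choiceProb]; ring

theorem sum_v_nonneg (j : Fin I.m) (X : Finset (Fin I.n)) (ρ : Fin I.n → Fin I.r) :
    0 ≤ ∑ i ∈ X, I.v j i (ρ i) := sum_nonneg fun _ _ => I.v_nonneg _ _ _

theorem revenue_nonneg (j : Fin I.m) (X : Finset (Fin I.n)) (ρ : Fin I.n → Fin I.r) :
    0 ≤ I.revenue j X ρ := by
  rw [revenue_eq]
  exact div_nonneg (sum_nonneg fun _ _ => mul_nonneg (I.v_nonneg _ _ _) (I.price_nonneg _))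
    (add_nonneg (I.v₀_nonneg j) (I.sum_v_nonneg j X ρ))

theorem sum_line (j : Fin I.m) (X : Finset (Fin I.n)) (ρ : Fin I.n → Fin I.r) (z : ℚ) :
    ∑ i ∈ X, I.v j i (ρ i) * (I.price (ρ i) - z) =
      ∑ i ∈ X, I.v j i (ρ i) * I.price (ρ i) - z * ∑ i ∈ X, I.v j i (ρ i) := by
  rw [mul_sum, ← sum_sub_distrib]
  exact sum_congr rfl fun i _ => by ring

theorem revenue_le_priceSum (j : Fin I.m) (X : Finset (Fin I.n)) (ρ : Fin I.n → Fin I.r) :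
    I.revenue j X ρ ≤ I.priceSum := by
  rw [revenue_eq]
  have hV := I.sum_v_nonneg j X ρ
  have h0 := I.v₀_nonneg j
  refine div_le_of_le_mul₀ (add_nonneg h0 hV) I.priceSum_nonneg ?_
  calc _ ≤ ∑ i ∈ X, I.v j i (ρ i) * I.priceSum :=
        sum_le_sum fun i _ => mul_le_mul_of_nonneg_left (I.price_le_priceSum _) (I.v_nonneg _ _ _)
    _ = I.priceSum * ∑ i ∈ X, I.v j i (ρ i) := by rw [← sum_mul, mul_comm]
    _ ≤ _ := mul_le_mul_of_nonneg_left (by linarith) I.priceSum_nonneg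

/-- The share of a product in the surrogate when its best line has height `x > 0`. -/
def share (j : Fin I.m) (x : ℚ) : ℚ := if 0 < I.v₀ j then x / I.v₀ j else I.priceSum

theorem share_mono (j : Fin I.m) {x y : ℚ} (h : x ≤ y) : I.share j x ≤ I.share j y := by
  unfold share
  split_ifs with h0
  · exact div_le_div_of_nonneg_right h h0.le
  · exact le_rfl

theorem share_nonneg (j : Fin I.m) {x : ℚ} (h : 0 ≤ x) : 0 ≤ I.share j x := by
  unfold share
  split_ifs with h0
  · exact div_nonneg h h0.le
  · exact I.priceSum_nonneg

/-- For type `j`: thresholds `z q`, the best line `σ q i` of every product at every threshold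
(`none` if no line is positive there; ties are broken in favour of high prices), and the shares
`c q i`.  The thresholds contain all nonnegative crossings and zeros of lines
`v j i l * (price l - z)` of a product. -/
structure Table (j : Fin I.m) (Q : ℕ) (z : ℕ → ℚ) (c : ℕ → Fin I.n → ℚ)
    (σ : ℕ → Fin I.n → Option (Fin I.r)) : Prop where
  z_nonneg : ∀ q < Q, 0 ≤ z q
  crossing : ∀ i l l', ∃ q < Q, z q =
    max 0 ((I.v j i l * I.price l - I.v j i l' * I.price l') / (I.v j i l - I.v j i l'))
  root : ∀ i l, ∃ q < Q, z q = max 0 (I.v j i l * I.price l / I.v j i l)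
  none : ∀ q < Q, ∀ i, σ q i = none → c q i = 0 ∧ ∀ l, I.v j i l * (I.price l - z q) ≤ 0
  some : ∀ q < Q, ∀ i k, σ q i = some k → 0 < I.v j i k * (I.price k - z q) ∧
    c q i = I.share j (I.v j i k * (I.price k - z q)) ∧
    ∀ l, I.v j i l * (I.price l - z q) < I.v j i k * (I.price k - z q) ∨
      I.v j i l * (I.price l - z q) = I.v j i k * (I.price k - z q) ∧ I.price l ≤ I.price k

/-- The surrogate of the best revenue of a type. -/
def surrogate (Q : ℕ) (z : ℕ → ℚ) (c : ℕ → Fin I.n → ℚ) (S : Finset (Fin I.n)) : ℚ :=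
  minUpTo I.priceSum (fun q => z q + ∑ i ∈ S, c q i) Q

namespace Table

variable {I} {j : Fin I.m} {Q : ℕ} {z : ℕ → ℚ} {c : ℕ → Fin I.n → ℚ}
  {σ : ℕ → Fin I.n → Option (Fin I.r)}

/-- A threshold `ζ` with shares `γ`: a row of the table, or the sum of all prices. -/
def IsPoint (I : Instance) (Q : ℕ) (z : ℕ → ℚ) (c : ℕ → Fin I.n → ℚ) (ζ : ℚ)
    (γ : Fin I.n → ℚ) : Prop :=
  (∃ q < Q, ζ = z q ∧ γ = c q) ∨ (ζ = I.priceSum ∧ γ = 0)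

theorem surrogate_le {ζ : ℚ} {γ : Fin I.n → ℚ} (h : IsPoint I Q z c ζ γ)
    (S : Finset (Fin I.n)) : I.surrogate Q z c S ≤ ζ + ∑ i ∈ S, γ i := by
  rcases h with ⟨q, hq, rfl, rfl⟩ | ⟨rfl, rfl⟩
  · exact minUpTo_le _ _ hq
  · simpa [surrogate] using minUpTo_le_top I.priceSum (fun q => z q + ∑ i ∈ S, c q i) Q

theorem exists_surrogate_eq (I : Instance) (Q : ℕ) (z : ℕ → ℚ) (c : ℕ → Fin I.n → ℚ)
    (S : Finset (Fin I.n)) :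
    ∃ ζ γ, IsPoint I Q z c ζ γ ∧ I.surrogate Q z c S = ζ + ∑ i ∈ S, γ i := by
  rcases minUpTo_eq I.priceSum (fun q => z q + ∑ i ∈ S, c q i) Q with h | ⟨q, hq, h⟩
  · exact ⟨_, 0, .inr ⟨rfl, rfl⟩, by simpa [surrogate] using h⟩
  · exact ⟨_, _, .inl ⟨q, hq, rfl, rfl⟩, h⟩

variable (T : I.Table j Q z c σ)
include T

/-- At the threshold `priceSum` no line is positive, so the cap in the surrogate behaves like one
more row with zero shares. -/
theorem point_cases {ζ : ℚ} {γ : Fin I.n → ℚ} (h : IsPoint I Q z c ζ γ) (i : Fin I.n) :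
    (γ i = 0 ∧ ∀ l, I.v j i l * (I.price l - ζ) ≤ 0) ∨
      ∃ k, 0 < I.v j i k * (I.price k - ζ) ∧ γ i = I.share j (I.v j i k * (I.price k - ζ)) ∧
        ∀ l, I.v j i l * (I.price l - ζ) ≤ I.v j i k * (I.price k - ζ) := by
  rcases h with ⟨q, hq, rfl, rfl⟩ | ⟨rfl, rfl⟩
  · cases hσ : σ q i with
    | none => exact .inl (T.none q hq i hσ)
    | some k =>
      obtain ⟨h1, h2, h3⟩ := T.some q hq i k hσ
      exact .inr ⟨k, h1, h2, fun l => (h3 l).elim le_of_lt fun h => h.1.le⟩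
  · exact .inl ⟨rfl, fun l => mul_nonpos_of_nonneg_of_nonpos (I.v_nonneg _ _ _)
      (sub_nonpos.2 (I.price_le_priceSum l))⟩

theorem point_nonneg {ζ : ℚ} {γ : Fin I.n → ℚ} (h : IsPoint I Q z c ζ γ) : 0 ≤ ζ := by
  rcases h with ⟨q, hq, rfl, rfl⟩ | ⟨rfl, rfl⟩
  · exact T.z_nonneg q hq
  · exact I.priceSum_nonneg

theorem share_point_nonneg {ζ : ℚ} {γ : Fin I.n → ℚ} (h : IsPoint I Q z c ζ γ) (i : Fin I.n) :
    0 ≤ γ i := by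
  rcases T.point_cases h i with ⟨h0, -⟩ | ⟨k, hk, hγ, -⟩
  · exact h0.ge
  · exact hγ ▸ I.share_nonneg j hk.le

/-- All lines have slope `-v ≤ 0`, so raising the threshold lowers every best line. This
monotonicity drives submodularity. -/
theorem share_point_anti {ζ ζ' : ℚ} {γ γ' : Fin I.n → ℚ} (h : IsPoint I Q z c ζ γ)
    (h' : IsPoint I Q z c ζ' γ') (hζ : ζ ≤ ζ') (i : Fin I.n) : γ' i ≤ γ i := by
  rcases T.point_cases h' i with ⟨h0, -⟩ | ⟨k, hk, hγ', -⟩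
  · exact h0.trans_le (T.share_point_nonneg h i)
  · have h1 : I.v j i k * (I.price k - ζ') ≤ I.v j i k * (I.price k - ζ) :=
      mul_le_mul_of_nonneg_left (by linarith) (I.v_nonneg _ _ _)
    rcases T.point_cases h i with ⟨-, h0⟩ | ⟨l, -, hγ, hl⟩
    · linarith [h0 k]
    · rw [hγ, hγ']
      exact I.share_mono j (h1.trans (hl k))

theorem surrogate_nonneg (S : Finset (Fin I.n)) : 0 ≤ I.surrogate Q z c S := by
  obtain ⟨ζ, γ, h, e⟩ := exists_surrogate_eq I Q z c S
  rw [e]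
  exact add_nonneg (T.point_nonneg h) (sum_nonneg fun i _ => T.share_point_nonneg h i)

theorem surrogate_mono {A B : Finset (Fin I.n)} (hAB : A ⊆ B) :
    I.surrogate Q z c A ≤ I.surrogate Q z c B := by
  obtain ⟨ζ, γ, h, e⟩ := exists_surrogate_eq I Q z c B
  rw [e]
  exact (surrogate_le h A).trans (add_le_add le_rfl
    (sum_le_sum_of_subset_of_nonneg hAB fun i _ _ => T.share_point_nonneg h i))

/-- Take points attaining the surrogate at `insert e A` and at `B`, and use the same two points,
suitably assigned, as upper bounds at `A` and `insert e B`. The order of the two thresholds decides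
the assignment. -/
theorem surrogate_submodular {A B : Finset (Fin I.n)} (hAB : A ⊆ B) (e : Fin I.n) :
    I.surrogate Q z c (insert e B) - I.surrogate Q z c B ≤
      I.surrogate Q z c (insert e A) - I.surrogate Q z c A := by
  by_cases heB : e ∈ B
  · rw [insert_eq_of_mem heB, sub_self]
    exact sub_nonneg.2 (T.surrogate_mono (subset_insert _ _))
  have heA : e ∉ A := fun h => heB (hAB h)
  obtain ⟨ζ, γ, h, h1⟩ := exists_surrogate_eq I Q z c (insert e A)
  obtain ⟨ζ', γ', h', h2⟩ := exists_surrogate_eq I Q z c B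
  rw [sum_insert heA] at h1
  rcases le_total ζ ζ' with hζ | hζ
  -- Each point is kept: the gain over `B` is at most the share of `e` at `ζ'`, the gain over `A` at
  -- least its larger share at `ζ`.
  · have h3 := surrogate_le h A
    have h4 := surrogate_le h' (insert e B)
    rw [sum_insert heB] at h4
    linarith [T.share_point_anti h h' hζ e]
  -- The points are swapped: `B \ A` is then charged at the larger threshold `ζ`, where its shares
  -- are smaller.
  · have h3 := surrogate_le h' A
    have h4 := surrogate_le h (insert e B)
    rw [sum_insert heB] at h4
    have h5 := sum_sdiff (f := γ) hAB
    have h6 := sum_sdiff (f := γ') hAB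
    have h7 : ∑ i ∈ B \ A, γ i ≤ ∑ i ∈ B \ A, γ' i :=
      sum_le_sum fun i _ => T.share_point_anti h' h hζ i
    linarith

/-- If the revenue `R` exceeds the threshold `ζ`, the lines offered have total height `R * v₀ + (R -
ζ) * V ≥ R * v₀` at `ζ`, so for `v₀ > 0` the shares alone sum to at least `R`. -/
theorem revenue_le_surrogate {S X : Finset (Fin I.n)} (hX : X ⊆ S) (ρ : Fin I.n → Fin I.r) :
    I.revenue j X ρ ≤ I.surrogate Q z c S := by
  obtain ⟨ζ, γ, h, e⟩ := exists_surrogate_eq I Q z c S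
  rw [e]
  have hγ := T.share_point_nonneg h
  have hγS : ∑ i ∈ X, γ i ≤ ∑ i ∈ S, γ i := sum_le_sum_of_subset_of_nonneg hX fun i _ _ => hγ i
  have hV := I.sum_v_nonneg j X ρ
  have h0 := I.v₀_nonneg j
  rcases le_or_gt (I.revenue j X ρ) ζ with hR | hR
  · linarith [sum_nonneg fun i (_ : i ∈ X) => hγ i]
  have hR0 : 0 < I.revenue j X ρ := (T.point_nonneg h).trans_lt hR
  have hD : I.v₀ j + ∑ i ∈ X, I.v j i (ρ i) ≠ 0 := by
    intro hD
    rw [revenue_eq, hD, div_zero] at hR0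
    exact lt_irrefl _ hR0
  have hW : ∑ i ∈ X, I.v j i (ρ i) * I.price (ρ i) =
      I.revenue j X ρ * (I.v₀ j + ∑ i ∈ X, I.v j i (ρ i)) := by
    rw [revenue_eq, div_mul_cancel₀ _ hD]
  have hL := I.sum_line j X ρ ζ
  rcases h0.lt_or_eq with h0' | h0'
  · have h1 : ∑ i ∈ X, I.v j i (ρ i) * (I.price (ρ i) - ζ) ≤ (∑ i ∈ X, γ i) * I.v₀ j := by
      rw [sum_mul]
      refine sum_le_sum fun i _ => ?_
      rcases T.point_cases h i with ⟨hz, hl⟩ | ⟨k, -, hk, hl⟩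
      · rw [hz, zero_mul]; exact hl _
      · rw [hk, share, if_pos h0', div_mul_cancel₀ _ h0'.ne']
        exact hl _
    have h2 : I.revenue j X ρ * I.v₀ j ≤ (∑ i ∈ X, γ i) * I.v₀ j := by nlinarith
    have h3 := le_of_mul_le_mul_right h2 h0'
    linarith [T.point_nonneg h]
  -- Without an outside option the total height is only known to be positive; some line is then
  -- positive and its share `priceSum` already bounds any revenue.
  · have h1 : 0 < ∑ i ∈ X, I.v j i (ρ i) * (I.price (ρ i) - ζ) := by
      rw [hL, hW, ← h0', zero_add, ← sub_mul]
      rw [← h0', zero_add] at hD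
      exact mul_pos (sub_pos.2 hR) (lt_of_le_of_ne hV (Ne.symm hD))
    obtain ⟨i, hi, hpos⟩ : ∃ i ∈ X, 0 < I.v j i (ρ i) * (I.price (ρ i) - ζ) := by
      by_contra! hcon
      exact absurd h1 (sum_nonpos hcon).not_gt
    have h2 : γ i = I.priceSum := by
      rcases T.point_cases h i with ⟨-, hl⟩ | ⟨k, -, hk, -⟩
      · linarith [hl (ρ i)]
      · rw [hk, share, if_neg (by rw [← h0']; exact lt_irrefl _)]
    have h3 := single_le_sum (f := γ) (fun i _ => hγ i) (hX hi)
    linarith [I.revenue_le_priceSum j X ρ, T.point_nonneg h]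

end Table

/-! ### The surrogate is at most twice the best revenue -/

/-- The assortment that a row of best lines induces inside a selection. -/
def lineAssortment (S : Finset (Fin I.n)) (τ : Fin I.n → Option (Fin I.r)) : Finset (Fin I.n) :=
  S.filter fun i => (τ i).isSome

/-- The prices that a row of best lines induces. -/
def linePrices (τ : Fin I.n → Option (Fin I.r)) (i : Fin I.n) : Fin I.r :=
  (τ i).getD ⟨0, I.r_pos⟩

/-- The height at `t` of the best line. -/
def lineHeight (j : Fin I.m) (τ : Fin I.n → Option (Fin I.r)) (t : ℚ) (i : Fin I.n) : ℚ :=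
  (τ i).elim 0 fun k => I.v j i k * (I.price k - t)

theorem sum_lineHeight (j : Fin I.m) (S : Finset (Fin I.n)) (τ : Fin I.n → Option (Fin I.r))
    (t : ℚ) : ∑ i ∈ S, I.lineHeight j τ t i = ∑ i ∈ I.lineAssortment S τ,
      I.v j i (I.linePrices τ i) * (I.price (I.linePrices τ i) - t) := by
  rw [lineAssortment, sum_filter]
  refine sum_congr rfl fun i _ => ?_
  unfold lineHeight linePrices
  cases τ i <;> simp

namespace Table

variable {I} {j : Fin I.m} {Q : ℕ} {z : ℕ → ℚ} {c : ℕ → Fin I.n → ℚ}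
  {σ : ℕ → Fin I.n → Option (Fin I.r)}

/-- Between a threshold and the next one the best lines do not change. -/
theorem line_le_lineHeight (T : I.Table j Q z c σ) {q : ℕ} (hq : q < Q) {b t : ℚ}
    (hgap : ∀ q' < Q, z q' ≤ z q ∨ b ≤ z q') (hat : z q ≤ t) (htb : t ≤ b) (i : Fin I.n) :
    0 ≤ I.lineHeight j (σ q) t i ∧
      ∀ l, I.v j i l * (I.price l - t) ≤ I.lineHeight j (σ q) t i := by
  unfold lineHeight
  cases hσ : σ q i with
  | none =>
    refine ⟨le_rfl, fun l => ?_⟩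
    have := (T.none q hq i hσ).2 l
    have hv := I.v_nonneg j i l
    show _ ≤ (0 : ℚ)
    nlinarith
  | some k =>
    obtain ⟨hpos, -, hbest⟩ := T.some q hq i k hσ
    have hz := T.z_nonneg q hq
    have hv : 0 < I.v j i k := by
      refine lt_of_le_of_ne (I.v_nonneg j i k) fun h => ?_
      rw [← h, zero_mul] at hpos
      exact lt_irrefl _ hpos
    have hp : z q < I.price k := by
      by_contra hcon
      nlinarith
    -- The zero of the best line is a threshold lying beyond `z q`, so the line stays nonnegative up
    -- to `b`.
    have hb : b ≤ I.price k := by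
      obtain ⟨q', hq', e⟩ := T.root i k
      rw [mul_div_cancel_left₀ _ hv.ne', max_eq_right (I.price_nonneg k)] at e
      rcases hgap q' hq' with h | h <;> linarith
    show 0 ≤ I.v j i k * (I.price k - t) ∧ ∀ l, _ ≤ I.v j i k * (I.price k - t)
    refine ⟨mul_nonneg hv.le (by linarith), fun l => ?_⟩
    by_contra! hcon
    -- Only a flatter line can overtake to the right of `z q`.
    have hvl : I.v j i l < I.v j i k := by
      by_contra! hle
      have h1 : I.v j i l * (I.price l - z q) ≤ I.v j i k * (I.price k - z q) :=
        (hbest l).elim le_of_lt fun h => h.1.le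
      nlinarith [mul_nonneg (sub_nonneg.2 hle) (sub_nonneg.2 hat)]
    have hd : 0 < I.v j i k - I.v j i l := sub_pos.2 hvl
    obtain ⟨q', hq', e⟩ := T.crossing i k l
    set x := (I.v j i k * I.price k - I.v j i l * I.price l) / (I.v j i k - I.v j i l) with hx
    have hx' : x * (I.v j i k - I.v j i l) = I.v j i k * I.price k - I.v j i l * I.price l :=
      div_mul_cancel₀ _ hd.ne'
    have hxt : x < t := by
      refine lt_of_mul_lt_mul_right ?_ hd.le
      nlinarith
    have hax : z q ≤ x := by
      have h1 : I.v j i l * (I.price l - z q) ≤ I.v j i k * (I.price k - z q) :=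
        (hbest l).elim le_of_lt fun h => h.1.le
      refine le_of_mul_le_mul_right ?_ hd
      nlinarith
    rw [max_eq_right (hz.trans hax)] at e
    -- The crossing is a threshold in `[z q, t)`, and the gap leaves only `z q` itself.
    have hxa : x = z q := by
      rcases hgap q' hq' with h | h
      · exact le_antisymm (e ▸ h) hax
      · linarith
    have heq : I.v j i l * (I.price l - z q) = I.v j i k * (I.price k - z q) := by
      rw [← hxa]; linarith
    -- The tie rule enters here: at a tie of positive height the flatter line has the higher price
    -- and would have been chosen.
    have hpl : I.price l ≤ I.price k := by
      rcases hbest l with h | h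
      · exact absurd heq h.ne
      · exact h.2
    have h2 : 0 ≤ I.v j i l := I.v_nonneg j i l
    nlinarith [mul_pos hd (sub_pos.2 hp), mul_nonneg h2 (sub_nonneg.2 hpl)]

/-- Some row of the table yields an assortment of at least half the surrogate value. -/
theorem exists_surrogate_le_two_mul (T : I.Table j Q z c σ) (hn : 0 < I.n)
    (S : Finset (Fin I.n)) : ∃ q < Q, I.surrogate Q z c S ≤
      2 * I.revenue j (I.lineAssortment S (σ q)) (I.linePrices (σ q)) := by
  classical
  obtain ⟨⟨X, ρ⟩, hXρ, hmax⟩ := exists_max_image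
    ((univ : Finset (Finset (Fin I.n) × (Fin I.n → Fin I.r))).filter fun x => x.1 ⊆ S)
    (fun x => I.revenue j x.1 x.2) ⟨(∅, fun _ => ⟨0, I.r_pos⟩), by simp⟩
  have hXS : X ⊆ S := by simpa using hXρ
  have hmax' : ∀ Y ⊆ S, ∀ τ, I.revenue j Y τ ≤ I.revenue j X ρ := fun Y hY τ =>
    hmax (Y, τ) (by simpa using hY)
  set g := I.revenue j X ρ with hg
  have h0 := I.v₀_nonneg j
  have hg0 : 0 ≤ g := I.revenue_nonneg j X ρ
  -- Optimality of `g` with the denominator cleared; if the denominator vanishes, so do all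
  -- parameters involved.
  have hupper : ∀ Y ⊆ S, ∀ τ : Fin I.n → Fin I.r, ∑ i ∈ Y, I.v j i (τ i) * (I.price (τ i) - g) ≤ g * I.v₀ j := by
    intro Y hY τ
    rw [I.sum_line]
    have hV := I.sum_v_nonneg j Y τ
    have h1 := hmax' Y hY τ
    rw [I.revenue_eq] at h1
    rcases (add_nonneg h0 hV).lt_or_eq with hD | hD
    · rw [div_le_iff₀ hD] at h1
      linarith
    · have hv : ∀ i ∈ Y, I.v j i (τ i) = 0 :=
        (sum_eq_zero_iff_of_nonneg fun i _ => I.v_nonneg _ _ _).1 (by linarith)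
      have hW : ∑ i ∈ Y, I.v j i (τ i) * I.price (τ i) = 0 :=
        sum_eq_zero fun i hi => by rw [hv i hi, zero_mul]
      rw [hW]
      nlinarith [mul_nonneg hg0 h0, mul_nonneg hg0 hV]
  rcases hg0.lt_or_eq with hgpos | hgz
  swap
  -- The crossing of a line with itself is `0 / 0 = 0`, so `0` is always a threshold. With `g = 0`
  -- all best lines in `S` vanish there.
  · obtain ⟨q, hq, e⟩ := T.crossing ⟨0, hn⟩ ⟨0, I.r_pos⟩ ⟨0, I.r_pos⟩
    rw [sub_self, sub_self, div_zero, max_self] at e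
    refine ⟨q, hq, ?_⟩
    have hsum : ∑ i ∈ S, c q i = 0 := by
      have h1 := hupper _ (filter_subset _ _) (I.linePrices (σ q)) |>.trans_eq'
        (I.sum_lineHeight j S (σ q) g).symm
      rw [← hgz, zero_mul] at h1
      have hpos : ∀ i, 0 ≤ I.lineHeight j (σ q) 0 i := by
        intro i
        unfold lineHeight
        cases σ q i with
        | none => exact le_rfl
        | some k => exact mul_nonneg (I.v_nonneg _ _ _) (by simpa using I.price_nonneg k)
      have h2 := (sum_eq_zero_iff_of_nonneg fun i _ => hpos i).1
        (le_antisymm h1 (sum_nonneg fun i _ => hpos i))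
      refine sum_eq_zero fun i hi => ?_
      cases hσ : σ q i with
      | none => exact (T.none q hq i hσ).1
      | some k =>
        have h3 := h2 i hi
        have h4 := (T.some q hq i k hσ).1
        simp only [lineHeight, hσ, Option.elim_some] at h3
        rw [e] at h4
        exact absurd h3 h4.ne'
    have h1 := surrogate_le (I := I) (z := z) (c := c) (.inl ⟨q, hq, rfl, rfl⟩) S
    rw [hsum, e] at h1
    linarith [I.revenue_nonneg j (I.lineAssortment S (σ q)) (I.linePrices (σ q))]
  -- the largest threshold below `g`
  obtain ⟨qa, hqa, hqamax⟩ := exists_max_image ((range Q).filter fun q => z q < g) z (by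
    obtain ⟨q, hq, e⟩ := T.crossing ⟨0, hn⟩ ⟨0, I.r_pos⟩ ⟨0, I.r_pos⟩
    rw [sub_self, sub_self, div_zero, max_self] at e
    exact ⟨q, by simp [hq, e, hgpos]⟩)
  simp only [mem_filter, mem_range, and_imp] at hqa hqamax
  -- the smallest threshold that is at least `g`
  obtain ⟨b, γ, hb, hgb, hbmin⟩ : ∃ b γ, IsPoint I Q z c b γ ∧ g ≤ b ∧
      ∀ q < Q, g ≤ z q → b ≤ z q := by
    by_cases hne : ((range Q).filter fun q => g ≤ z q).Nonempty
    · obtain ⟨q, hq, hqmin⟩ := exists_min_image _ z hne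
      simp only [mem_filter, mem_range, and_imp] at hq hqmin
      exact ⟨_, _, .inl ⟨q, hq.1, rfl, rfl⟩, hq.2, hqmin⟩
    -- With no threshold at or above `g`, the cap `priceSum` serves as the right end point.
    · refine ⟨_, _, .inr ⟨rfl, rfl⟩, I.revenue_le_priceSum j X ρ, fun q hq hgq => ?_⟩
      exact absurd ⟨q, by simp [hq, hgq]⟩ hne
  have hgap : ∀ q' < Q, z q' ≤ z qa ∨ b ≤ z q' := fun q' hq' =>
    (lt_or_ge (z q') g).imp (hqamax q' hq') (hbmin q' hq')
  have hline := fun t hat htb i => T.line_le_lineHeight hqa.1 (t := t) hgap hat htb i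
  have hDX : 0 < I.v₀ j + ∑ i ∈ X, I.v j i (ρ i) := by
    refine lt_of_le_of_ne (add_nonneg h0 (I.sum_v_nonneg j X ρ)) fun h => ?_
    rw [I.revenue_eq, ← h, div_zero] at hg
    exact hgpos.ne' hg
  have hWX : ∑ i ∈ X, I.v j i (ρ i) * (I.price (ρ i) - g) = g * I.v₀ j := by
    have : g * (I.v₀ j + ∑ i ∈ X, I.v j i (ρ i)) = ∑ i ∈ X, I.v j i (ρ i) * I.price (ρ i) := by
      rw [hg, I.revenue_eq, div_mul_cancel₀ _ hDX.ne']
    rw [I.sum_line]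
    linarith
  -- The fixed-point equation for `g`: the best lines of row `qa` are still best at `g`, hence at
  -- least as high as those of the optimal assortment.
  have hsumg : ∑ i ∈ S, I.lineHeight j (σ qa) g i = g * I.v₀ j := by
    refine le_antisymm ?_ ?_
    · rw [I.sum_lineHeight]
      exact hupper _ (filter_subset _ _) _
    · rw [← hWX]
      exact (sum_le_sum fun i _ => (hline g hqa.2.le hgb i).2 _).trans
        (sum_le_sum_of_subset_of_nonneg hXS fun i _ _ => (hline g hqa.2.le hgb i).1)
  have hpts : ∀ i, ∀ k, σ qa i = Option.some k → 0 < I.v j i k := by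
    intro i k hk
    refine lt_of_le_of_ne (I.v_nonneg j i k) fun h => ?_
    have := (T.some qa hqa.1 i k hk).1
    rw [← h, zero_mul] at this
    exact lt_irrefl _ this
  -- if nobody leaves, some product is offered
  have hne : I.v₀ j = 0 → ∃ i ∈ S, ∃ k, σ qa i = Option.some k := by
    intro hz
    by_contra! hcon
    have h1 : ∑ i ∈ X, I.v j i (ρ i) * (I.price (ρ i) - z qa) ≤ 0 := by
      refine sum_nonpos fun i hi => ?_
      have hno : σ qa i = Option.none := by
        cases hσ : σ qa i with
        | none => rfl
        | some k => exact absurd hσ (hcon i (hXS hi) k)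
      exact (T.none qa hqa.1 i hno).2 _
    rw [I.sum_line] at h1 hWX
    rw [hz] at hWX hDX
    nlinarith [hqa.2]
  -- Solving the fixed-point equation backwards: this row attains the optimum `g` itself.
  have hrev : I.revenue j (I.lineAssortment S (σ qa)) (I.linePrices (σ qa)) = g := by
    have hVa := I.sum_v_nonneg j (I.lineAssortment S (σ qa)) (I.linePrices (σ qa))
    have hDa : I.v₀ j + ∑ i ∈ I.lineAssortment S (σ qa), I.v j i (I.linePrices (σ qa) i) ≠ 0 := by
      intro hD
      have hz : I.v₀ j = 0 := by linarith
      obtain ⟨i, hi, k, hk⟩ := hne hz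
      have h1 := (sum_eq_zero_iff_of_nonneg fun i _ => I.v_nonneg _ _ _).1
        (by linarith : ∑ i ∈ I.lineAssortment S (σ qa), I.v j i (I.linePrices (σ qa) i) = 0) i
        (by simp [lineAssortment, hi, hk])
      simp only [linePrices, hk, Option.getD_some] at h1
      exact (hpts i k hk).ne' h1
    rw [I.sum_lineHeight, I.sum_line] at hsumg
    rw [I.revenue_eq, div_eq_iff hDa]
    linarith
  refine ⟨qa, hqa.1, ?_⟩
  rw [hrev]
  have hsb := surrogate_le hb S
  rcases h0.lt_or_eq with h0' | h0'
  · -- the surrogate objective is affine between the two thresholds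
    have hsa := surrogate_le (I := I) (z := z) (c := c) (.inl ⟨qa, hqa.1, rfl, rfl⟩) S
    have hca : ∑ i ∈ S, c qa i = (∑ i ∈ S, I.lineHeight j (σ qa) (z qa) i) / I.v₀ j := by
      rw [sum_div]
      refine sum_congr rfl fun i _ => ?_
      unfold lineHeight
      cases hσ : σ qa i with
      | none => simpa using (T.none qa hqa.1 i hσ).1
      | some k =>
        have := (T.some qa hqa.1 i k hσ).2.1
        rw [share, if_pos h0'] at this
        simpa using this
    -- Other lines may be best at `b`, but none is higher there than those of row `qa`.
    have hcb : ∑ i ∈ S, γ i ≤ (∑ i ∈ S, I.lineHeight j (σ qa) b i) / I.v₀ j := by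
      rw [sum_div]
      refine sum_le_sum fun i _ => ?_
      obtain ⟨h1, h2⟩ := hline b (hqa.2.le.trans hgb) le_rfl i
      rcases T.point_cases hb i with ⟨h3, -⟩ | ⟨k, -, h3, -⟩
      · rw [h3]; exact div_nonneg h1 h0
      · rw [h3, share, if_pos h0']
        exact div_le_div_of_nonneg_right (h2 k) h0
    have haff : ∀ t, ∑ i ∈ S, I.lineHeight j (σ qa) t i = g * I.v₀ j + (g - t) *
        ∑ i ∈ I.lineAssortment S (σ qa), I.v j i (I.linePrices (σ qa) i) := by
      intro t
      rw [← hsumg, I.sum_lineHeight, I.sum_lineHeight, I.sum_line, I.sum_line]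
      ring
    set V := ∑ i ∈ I.lineAssortment S (σ qa), I.v j i (I.linePrices (σ qa) i) with hV
    rw [hca, haff] at hsa
    rw [haff] at hcb
    have e : ∀ t, (g * I.v₀ j + (g - t) * V) / I.v₀ j = g + (g - t) * (V / I.v₀ j) := by
      intro t
      field_simp
    rw [e] at hsa hcb
    -- At `t` the affine objective is `2 * g + (g - t) * (V / v₀ - 1)`; the left end point works if
    -- the ratio is at most 1, the right one otherwise.
    rcases le_total (V / I.v₀ j) 1 with h1 | h1
    · nlinarith [hqa.2]
    · nlinarith
  -- With `v₀ = 0` the best lines all vanish at `g`. One of them is positive at `z qa` and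
  -- nonnegative up to `b`, which forces `b = g`; all shares at `b` are then zero.
  · have hz := h0'.symm
    rw [hz, mul_zero] at hsumg
    have h1 := (sum_eq_zero_iff_of_nonneg fun i _ => (hline g hqa.2.le hgb i).1).1 hsumg
    obtain ⟨i, hi, k, hk⟩ := hne hz
    have hbg : b ≤ g := by
      have h2 := h1 i hi
      have h3 := (hline b (hqa.2.le.trans hgb) le_rfl i).1
      simp only [lineHeight, hk, Option.elim_some] at h2 h3
      have h4 := hpts i k hk
      nlinarith
    have hγ : ∑ i ∈ S, γ i = 0 := by
      refine sum_eq_zero fun i hi => ?_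
      rcases T.point_cases hb i with ⟨h3, -⟩ | ⟨k, h3, -, -⟩
      · exact h3
      · have h4 := (hline b (hqa.2.le.trans hgb) le_rfl i).2 k
        rw [le_antisymm hbg hgb] at h3 h4
        linarith [h1 i hi]
    rw [hγ] at hsb
    linarith

end Table
end Instance
-- Greedy maximization of a monotone submodular function
section Greedy

variable {n : ℕ} (F : Finset (Fin n) → ℚ)

/-- What is known of a set that `t` greedy steps for `F` have built: all marginal values are at
most `δ`, and `t * δ` does not exceed the value of the set. -/
def GreedyInv (t : ℕ) (S : Finset (Fin n)) : Prop :=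
  S.card ≤ t ∧ ∃ δ, 0 ≤ δ ∧ t * δ ≤ F S ∧ ∀ e, F (insert e S) - F S ≤ δ

variable {F} (hnonneg : ∀ S, 0 ≤ F S) (hmono : ∀ A B, A ⊆ B → F A ≤ F B)
  (hsub : ∀ A B e, A ⊆ B → F (insert e B) - F B ≤ F (insert e A) - F A)

include hnonneg hmono in
theorem GreedyInv.empty : GreedyInv F 0 ∅ :=
  ⟨by simp, F univ, hnonneg _, by simpa using hnonneg ∅, fun e => by
    linarith [hmono (insert e ∅) univ (subset_univ _), hnonneg ∅]⟩

include hmono hsub in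
-- The new `δ` is the gain just made. It is at most the old `δ`, so `t` times it is still covered by
-- `F S`, and submodularity keeps later marginals below it.
theorem GreedyInv.step {t : ℕ} {S : Finset (Fin n)} (h : GreedyInv F t S) {x : Fin n}
    (hx : ∀ e, F (insert e S) ≤ F (insert x S)) : GreedyInv F (t + 1) (insert x S) := by
  obtain ⟨hc, δ, -, h1, h2⟩ := h
  refine ⟨(card_insert_le _ _).trans (by omega), F (insert x S) - F S,
    sub_nonneg.2 (hmono _ _ (subset_insert _ _)), ?_, fun e => ?_⟩
  · have := mul_le_mul_of_nonneg_left (h2 x) (Nat.cast_nonneg (α := ℚ) t)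
    push_cast
    linarith
  · linarith [hsub S _ e (subset_insert x S), hx e]

include hmono hsub in
-- Adding the elements of `O` to `S` gains at most `δ` each, hence at most `t * δ ≤ F S` in total.
-- The sharper factor `1 - 1 / e` is not needed.
theorem GreedyInv.le_two_mul {t : ℕ} {S : Finset (Fin n)} (h : GreedyInv F t S)
    {O : Finset (Fin n)} (hO : O.card ≤ t) : F O ≤ 2 * F S := by
  obtain ⟨-, δ, h0, h1, h2⟩ := h
  have key : ∀ O : Finset (Fin n), F (O ∪ S) ≤ F S + O.card * δ := by
    intro O
    induction O using Finset.induction_on with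
    | empty => simp
    | insert e O he ih =>
      rw [insert_union, card_insert_of_notMem he]
      have := hsub S (O ∪ S) e subset_union_right
      push_cast
      linarith [h2 e]
  have h3 := key O
  have h4 : (O.card : ℚ) * δ ≤ t * δ := mul_le_mul_of_nonneg_right (by exact_mod_cast hO) h0
  linarith [hmono O (O ∪ S) subset_union_left]

end Greedy

/-! ### Scanning the lines of one product -/

/-- Among the lines `v l * (p l - z)` with `l < r`, the best one is that with index `t - 1`; it has
parameter `u = v (t - 1)` and price `b = p (t - 1)`.  Ties are broken in favour of high prices.
If no line is positive, `t = u = 0` and `b = P`. -/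
def BestLine (r : ℕ) (p v : ℕ → ℚ) (z P t u b : ℚ) : Prop :=
  (t = 0 ∧ u = 0 ∧ b = P ∧ ∀ l < r, v l * (p l - z) ≤ 0) ∨
    ∃ k < r, t = k + 1 ∧ u = v k ∧ b = p k ∧ 0 < u * (b - z) ∧
      ∀ l < r, v l * (p l - z) < u * (b - z) ∨ v l * (p l - z) = u * (b - z) ∧ p l ≤ b

namespace BestLine

variable {r : ℕ} {p v : ℕ → ℚ} {z P t u b : ℚ} (h : BestLine r p v z P t u b)
include h

theorem nonneg : 0 ≤ u * (b - z) := by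
  rcases h with ⟨-, rfl, -, -⟩ | ⟨k, -, -, -, -, h, -⟩
  · simp
  · exact h.le

theorem line_le {l : ℕ} (hl : l < r) : v l * (p l - z) ≤ u * (b - z) := by
  rcases h with ⟨-, rfl, -, h⟩ | ⟨k, -, -, -, -, -, h⟩
  · simpa using h l hl
  · exact (h l hl).elim le_of_lt fun h => h.1.le

theorem keep (hl : v r * (p r - z) < u * (b - z) ∨ v r * (p r - z) = u * (b - z) ∧ p r ≤ b) :
    BestLine (r + 1) p v z P t u b := by
  rcases h with ⟨h1, h2, h3, h⟩ | ⟨k, hk, h1, h2, h3, h4, h⟩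
  · refine .inl ⟨h1, h2, h3, fun l hl' => ?_⟩
    rcases Nat.lt_succ_iff_lt_or_eq.1 hl' with h' | rfl
    · exact h l h'
    · rw [h2, zero_mul] at hl
      exact hl.elim le_of_lt fun h => h.1.le
  · refine .inr ⟨k, by omega, h1, h2, h3, h4, fun l hl' => ?_⟩
    rcases Nat.lt_succ_iff_lt_or_eq.1 hl' with h' | rfl
    · exact h l h'
    · exact hl

theorem update (hl : u * (b - z) < v r * (p r - z)) :
    BestLine (r + 1) p v z P ((r : ℚ) + 1) (v r) (p r) := by
  refine .inr ⟨r, by omega, rfl, rfl, rfl, h.nonneg.trans_lt hl, fun l hl' => ?_⟩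
  rcases Nat.lt_succ_iff_lt_or_eq.1 hl' with h' | rfl
  · exact .inl ((h.line_le h').trans_lt hl)
  · exact .inr ⟨rfl, le_rfl⟩

theorem update_tie (hl : v r * (p r - z) = u * (b - z)) (hb : b < p r) (hP : p r ≤ P) :
    BestLine (r + 1) p v z P ((r : ℚ) + 1) (v r) (p r) := by
  rcases h with ⟨h1, h2, h3, h⟩ | ⟨k, hk, h1, h2, h3, h4, h⟩
  -- The initial value `b = P` is at least every price, so a line of height zero never replaces the
  -- empty choice.
  · linarith
  · refine .inr ⟨r, by omega, rfl, rfl, rfl, hl ▸ h4, fun l hl' => ?_⟩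
    rcases Nat.lt_succ_iff_lt_or_eq.1 hl' with h' | rfl
    · rw [hl]
      exact (h l h').imp_right fun h => ⟨h.1, h.2.trans hb.le⟩
    · exact .inr ⟨rfl, le_rfl⟩

end BestLine

/-! ### Length bounds for the algorithm and its input -/

/-- Bounds for the lengths of the numbers in the arrays that the algorithm uses. -/
def arrayBound (b a : ℕ) : ℕ :=
  -- A threshold is an expression in six data, whence `6 * b`. Every accumulation over at most `b`
  -- terms raises the power of `b` by one: price sum, value of a row, weighted objective.
  if a ∈ [9, 23, 35] then 2 * b
  else if a ∈ [7, 32, 48, 53] then 6 * b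
  else if a ∈ [6, 31, 37] then 9 * b
  else if a ∈ [30, 34, 50] then 10 * b ^ 2
  else if a ∈ [8, 11] then 20 * b ^ 2
  else if a ∈ [46, 47, 51] then 20 * b ^ 3
  else if a ∈ [43, 45, 52, 54] then 30 * b ^ 4
  else b

theorem arrayBound_le {b : ℕ} (hb : 1 ≤ b) (a : ℕ) : arrayBound b a ≤ 30 * b ^ 4 := by
  have h1 : b ^ 1 ≤ b ^ 4 := Nat.pow_le_pow_right hb (by norm_num)
  have h2 : b ^ 2 ≤ b ^ 4 := Nat.pow_le_pow_right hb (by norm_num)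
  have h3 : b ^ 3 ≤ b ^ 4 := Nat.pow_le_pow_right hb (by norm_num)
  rw [pow_one] at h1
  unfold arrayBound
  split_ifs <;> omega

namespace Instance

variable (I : Instance)

/-- A number that exceeds the lengths of all data and the numbers of products, types and prices. -/
def width : ℕ := I.size + 5

theorem one_le_bitLength (q : ℚ) : 1 ≤ bitLength q := by
  unfold bitLength
  have := Nat.size_pos.2 q.den_pos
  omega

theorem m_pos : 0 < I.m := by
  by_contra h
  have hm : I.m = 0 := by omega
  have hs := I.weight_sum
  have : IsEmpty (Fin I.m) := by rw [hm]; infer_instance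
  simp at hs

/-- Each parameter occupies at least one bit, so loops over types, products and prices are short. -/
theorem mul_le_size : I.m * I.n * I.r ≤ I.size := by
  have : I.m * I.n * I.r ≤ ∑ j, ∑ i, ∑ l, bitLength (I.v j i l) := by
    calc I.m * I.n * I.r = ∑ j : Fin I.m, ∑ i : Fin I.n, ∑ l : Fin I.r, 1 := by
          simp [mul_assoc]
      _ ≤ _ := sum_le_sum fun j _ => sum_le_sum fun i _ => sum_le_sum fun l _ =>
          one_le_bitLength _
  unfold size
  omega

theorem r_le_size : I.r ≤ I.size := by
  have : I.r ≤ ∑ l, bitLength (I.price l) := by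
    calc I.r = ∑ l : Fin I.r, 1 := by simp
      _ ≤ _ := sum_le_sum fun l _ => one_le_bitLength _
  unfold size
  omega

theorem m_le_size : I.m ≤ I.size := by
  have : I.m ≤ ∑ j, bitLength (I.weight j) := by
    calc I.m = ∑ j : Fin I.m, 1 := by simp
      _ ≤ _ := sum_le_sum fun l _ => one_le_bitLength _
  unfold size
  omega

theorem n_mul_r_le_size : I.n * I.r ≤ I.size := by
  refine le_trans ?_ I.mul_le_size
  rw [mul_assoc]
  exact Nat.le_mul_of_pos_left _ I.m_pos

theorem n_le_size : I.n ≤ I.size :=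
  (Nat.le_mul_of_pos_right _ I.r_pos).trans I.n_mul_r_le_size

theorem bounded_input (a x : ℕ) : len (I.input a x) ≤ I.size + 2 := by
  have hn : len (I.n : ℚ) ≤ I.size + 2 :=
    (len_le_bitLength _).trans (by unfold size; omega)
  have hm : len (I.m : ℚ) ≤ I.size + 2 :=
    (len_le_bitLength _).trans (by unfold size; omega)
  have hr : len (I.r : ℚ) ≤ I.size + 2 :=
    (len_le_bitLength _).trans (by unfold size; omega)
  have hk : len (I.k : ℚ) ≤ I.size + 2 :=
    (len_le_bitLength _).trans (by unfold size; omega)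
  have h0 : len 0 ≤ I.size + 2 := by simp
  have hp : ∀ l, len (I.price l) ≤ I.size + 2 := fun l => (len_le_bitLength _).trans (by
    have := single_le_sum (f := fun l => bitLength (I.price l)) (fun _ _ => Nat.zero_le _)
      (mem_univ l)
    unfold size
    omega)
  have hw : ∀ j, len (I.weight j) ≤ I.size + 2 := fun l => (len_le_bitLength _).trans (by
    have := single_le_sum (f := fun l => bitLength (I.weight l)) (fun _ _ => Nat.zero_le _)
      (mem_univ l)
    unfold size
    omega)
  have hv₀ : ∀ j, len (I.v₀ j) ≤ I.size + 2 := fun l => (len_le_bitLength _).trans (by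
    have := single_le_sum (f := fun l => bitLength (I.v₀ l)) (fun _ _ => Nat.zero_le _)
      (mem_univ l)
    unfold size
    omega)
  have hv : ∀ j i l, len (I.v j i l) ≤ I.size + 2 := fun j i l => (len_le_bitLength _).trans (by
    have h1 := single_le_sum (f := fun j => ∑ i, ∑ l, bitLength (I.v j i l))
      (fun _ _ => Nat.zero_le _) (mem_univ j)
    have h2 := single_le_sum (f := fun i => ∑ l, bitLength (I.v j i l))
      (fun _ _ => Nat.zero_le _) (mem_univ i)
    have h3 := single_le_sum (f := fun l => bitLength (I.v j i l))
      (fun _ _ => Nat.zero_le _) (mem_univ l)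
    unfold size
    omega)
  unfold input
  split
  · exact hn
  · exact hm
  · exact hr
  · exact hk
  · split_ifs
    exacts [hp _, h0]
  · split_ifs
    exacts [hw _, h0]
  · split_ifs
    exacts [hv₀ _, h0]
  · split_ifs
    exacts [hv _ _ _, h0]
  · exact h0

theorem bounded_arrayBound_input : Bounded (arrayBound I.width) I.input := by
  intro a x
  have h := I.bounded_input a x
  have h2 : I.width ≤ I.width ^ 2 := Nat.le_self_pow (by norm_num) _
  have h3 : I.width ≤ I.width ^ 3 := Nat.le_self_pow (by norm_num) _
  have h4 : I.width ≤ I.width ^ 4 := Nat.le_self_pow (by norm_num) _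
  have hw : I.width = I.size + 5 := rfl
  unfold arrayBound
  split_ifs <;> omega

/-- `Reaches` with the bounds of the algorithm. -/
abbrev Hoare (p : Prog) (s : Mem) (Q : Mem → Prop) : Prop :=
  Reaches (arrayBound I.width) (30 * I.width ^ 4) p s Q

/-- The memory respects the bounds of the algorithm. -/
abbrev Fits (s : Mem) : Prop := Bounded (arrayBound I.width) s

theorem hB (a : ℕ) : arrayBound I.width a ≤ 30 * I.width ^ 4 :=
  arrayBound_le (by unfold width; omega) a

/-- The input arrays are intact. -/
def HasInput (s : Mem) : Prop := ∀ a < 5, s a = I.input a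

variable {I}

theorem HasInput.frame {s t : Mem} (h : I.HasInput s) {p : Prog}
    (ht : ∀ a, p.writes a = false → t a = s a) (hp : ∀ a < 5, p.writes a = false) :
    I.HasInput t := fun a ha => by rw [ht a (hp a ha), h a ha]

theorem HasInput.write {s : Mem} (h : I.HasInput s) {a : ℕ} (ha : 5 ≤ a) (x : ℕ) (q : ℚ) :
    I.HasInput (s.write a x q) := fun c hc => by rw [write_ne _ _ _ (by omega), h c hc]

section

variable {s : Mem} (h : I.HasInput s)
include h

theorem HasInput.n : s 0 0 = I.n := by rw [h 0 (by norm_num)]; rfl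
theorem HasInput.m : s 0 1 = I.m := by rw [h 0 (by norm_num)]; rfl
theorem HasInput.r : s 0 2 = I.r := by rw [h 0 (by norm_num)]; rfl
theorem HasInput.k : s 0 3 = I.k := by rw [h 0 (by norm_num)]; rfl
theorem HasInput.price (l : Fin I.r) : s 1 l = I.price l := by
  rw [h 1 (by norm_num)]; simp [input]
theorem HasInput.weight (j : Fin I.m) : s 2 j = I.weight j := by
  rw [h 2 (by norm_num)]; simp [input]
theorem HasInput.v₀ (j : Fin I.m) : s 3 j = I.v₀ j := by
  rw [h 3 (by norm_num)]; simp [input]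
theorem HasInput.v (j : Fin I.m) (i : Fin I.n) (l : Fin I.r) :
    s 4 ((j * I.n + i) * I.r + l) = I.v j i l := by
  rw [h 4 (by norm_num), input_v]

end

end Instance
end JointPricing

namespace LogRAM

theorem weight_const (β : ℕ → ℕ) (q : ℚ) : (Expr.const q).weight β = len q := rfl
theorem weight_cell (β : ℕ → ℕ) (a : ℕ) (i : Expr) : (Expr.cell a i).weight β = β a := rfl
theorem weight_var (β : ℕ → ℕ) (a : ℕ) : (var a).weight β = β a := rfl
theorem weight_add (β : ℕ → ℕ) (e f : Expr) : (e + f).weight β = e.weight β + f.weight β := rfl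
theorem weight_sub (β : ℕ → ℕ) (e f : Expr) : (e - f).weight β = e.weight β + f.weight β := rfl
theorem weight_mul (β : ℕ → ℕ) (e f : Expr) : (e * f).weight β = e.weight β + f.weight β := rfl
theorem weight_div (β : ℕ → ℕ) (e f : Expr) : (e / f).weight β = e.weight β + f.weight β := rfl

/-- Assignment to a scalar variable. -/
def setVar (a : ℕ) (e : Expr) : Prog := .assign a (.const 0) e

infixr:60 " ;; " => Prog.seq

section

variable {β : ℕ → ℕ} {B : ℕ} {s : Mem} {Q : Mem → Prop}

theorem Reaches.setVar (hB : ∀ a, β a ≤ B) (hs : Bounded β s) {a : ℕ} {e : Expr} {q : ℚ}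
    (hq : e.eval s = q) (hl : len q ≤ β a) (h : Q (s.write a 0 q)) :
    Reaches β B (setVar a e) s Q :=
  .assign hB hs (hq ▸ hl) (by simpa [hq] using h)

theorem Reaches.setVar_seq (hB : ∀ a, β a ≤ B) (hs : Bounded β s) {a : ℕ} {e : Expr} {q : ℚ}
    {p : Prog} (hq : e.eval s = q) (hl : len q ≤ β a)
    (h : Bounded β (s.write a 0 q) → Reaches β B p (s.write a 0 q) Q) :
    Reaches β B (LogRAM.setVar a e ;; p) s Q :=
  .assign_seq hB hs (hq ▸ hl) (by simpa [hq] using h)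

theorem Reaches.set (hB : ∀ a, β a ≤ B) (hs : Bounded β s) {a x : ℕ} {i e : Expr} {q : ℚ}
    (hx : i.eval s = x) (hq : e.eval s = q) (hl : len q ≤ β a) (h : Q (s.write a x q)) :
    Reaches β B (.assign a i e) s Q :=
  .assign hB hs (hq ▸ hl) (by simpa [hq, hx] using h)

theorem Reaches.set_seq (hB : ∀ a, β a ≤ B) (hs : Bounded β s) {a x : ℕ} {i e : Expr} {q : ℚ}
    {p : Prog} (hx : i.eval s = x) (hq : e.eval s = q) (hl : len q ≤ β a)
    (h : Bounded β (s.write a x q) → Reaches β B p (s.write a x q) Q) :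
    Reaches β B (.assign a i e ;; p) s Q :=
  .assign_seq hB hs (hq ▸ hl) (by simpa [hq, hx] using h)

end

end LogRAM

namespace JointPricing

open Finset LogRAM

/-! ### Computing price sum and best lines -/

/-- The expressions `n`, `m`, `r` and `k`. -/
def eN : Expr := .cell 0 (.const 0)
def eM : Expr := .cell 0 (.const 1)
def eR : Expr := .cell 0 (.const 2)
def eK : Expr := .cell 0 (.const 3)

def priceSumProg : Prog :=
  setVar 30 (.const 0) ;; forLoop 22 eR (setVar 30 (var 30 + .cell 1 (var 22)))

/-- The cell of array `4` with the parameter of the type in variable `20`, the product in variable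
`a` and the price in variable `b`. -/
def eV (a b : ℕ) : Expr := .cell 4 ((var 20 * eN + var a) * eR + var b)

/-- Variables `33`, `34`, `35` hold parameter, price and index plus one of the best line so far;
`36` and `37` hold parameter and height of the line under test. -/
def updateLine : Prog :=
  setVar 33 (var 36) ;; setVar 34 (.cell 1 (var 25)) ;; setVar 35 (var 25 + .const 1)

/-- The height of the best line. -/
def eHeight : Expr := var 33 * (var 34 - var 32)

def compareLine : Prog :=
  setVar 36 (eV 24 25) ;; setVar 37 (var 36 * (.cell 1 (var 25) - var 32)) ;;
  .ite (var 37) eHeight .skip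
    (.ite eHeight (var 37) updateLine (.ite (var 34) (.cell 1 (var 25)) updateLine .skip))

def bestLineProg : Prog :=
  setVar 33 (.const 0) ;; setVar 34 (var 30) ;; setVar 35 (.const 0) ;; forLoop 25 eR compareLine

namespace Instance

variable {I : Instance} {s : Mem}

theorem five_le_width (I : Instance) : 5 ≤ I.width := by unfold width; omega
theorem n_add_le_width (I : Instance) : I.n + 5 ≤ I.width := by
  have := I.n_le_size; unfold width; omega
theorem m_add_le_width (I : Instance) : I.m + 5 ≤ I.width := by
  have := I.m_le_size; unfold width; omega
theorem r_add_le_width (I : Instance) : I.r + 5 ≤ I.width := by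
  have := I.r_le_size; unfold width; omega

theorem width_le (I : Instance) : I.width ≤ 30 * I.width ^ 4 := by
  have : I.width ≤ I.width ^ 4 := Nat.le_self_pow (by norm_num) _
  omega

theorem len_n_le (I : Instance) : len (I.n : ℚ) ≤ I.width - 3 :=
  (I.bounded_input 0 0).trans (by unfold width; omega)
theorem len_m_le (I : Instance) : len (I.m : ℚ) ≤ I.width - 3 :=
  (I.bounded_input 0 1).trans (by unfold width; omega)
theorem len_r_le (I : Instance) : len (I.r : ℚ) ≤ I.width - 3 :=
  (I.bounded_input 0 2).trans (by unfold width; omega)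

theorem HasInput.eval_eN (h : I.HasInput s) : eN.eval s = I.n := by simp [eN, h.n]
theorem HasInput.eval_eM (h : I.HasInput s) : eM.eval s = I.m := by simp [eM, h.m]
theorem HasInput.eval_eR (h : I.HasInput s) : eR.eval s = I.r := by simp [eR, h.r]
theorem HasInput.eval_eK (h : I.HasInput s) : eK.eval s = I.k := by simp [eK, h.k]

theorem HasInput.eval_eV (h : I.HasInput s) {a b j i l : ℕ} (hj : s 20 0 = j) (hi : s a 0 = i)
    (hl : s b 0 = l) : (eV a b).eval s = s 4 ((j * I.n + i) * I.r + l) := by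
  have : ((var 20 * eN + var a) * eR + var b).eval s =
      (((j * I.n + i) * I.r + l : ℕ) : ℚ) := by
    simp [h.eval_eN, h.eval_eR, hj, hi, hl]
  rw [eV, eval_cell, this, Nat.floor_natCast]

theorem priceSumProg_spec (hs : I.Fits s) (hin : I.HasInput s) :
    I.Hoare priceSumProg s fun t => t 30 0 = I.priceSum := by
  have hw := I.r_add_le_width
  refine Reaches.setVar_seq I.hB hs (eval_const _ _) (by simp [arrayBound]; nlinarith)
    fun hs' => ?_
  -- The invariant carries a length that grows with `L`: the fixed bound of array `30` alone would
  -- not survive an addition.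
  refine (Reaches.forLoop I.hB hs' (fun L t => t 30 0 = ∑ l ∈ range L, s 1 l ∧
    len (t 30 0) ≤ 2 + L * I.width) I.r ((by omega : I.r ≤ I.width).trans I.width_le)
    (I.len_r_le.trans (by simp [arrayBound])) rfl ?_ ?_ ?_ ?_).mono ?_
  · intro t ht
    exact ((hin.write (by norm_num) 0 _).frame ht (by decide)).eval_eR
  · intro i t t' ht h
    simpa only [ht 30 (by decide)] using h
  · simp
  · rintro L hL t hb hf hL0 ⟨h1, h2⟩
    have e1 : t 1 = s 1 := by rw [hf 1 rfl, write_ne _ _ _ (by decide)]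
    have e2 : len (t 1 L) ≤ I.width := by simpa [arrayBound] using hb 1 L
    have e3 := len_add (t 30 0) (t 1 L)
    have e4 : len (t 30 0 + t 1 L) ≤ 2 + (L + 1) * I.width := by linarith
    refine Reaches.setVar I.hB hb (q := t 30 0 + t 1 L) (by simp [hL0]) ?_ ?_
    · refine e4.trans ?_
      simp only [arrayBound, List.mem_cons, List.not_mem_nil]
      norm_num
      nlinarith
    · rw [write_same]
      exact ⟨by rw [sum_range_succ, h1, e1], e4⟩
  · rintro t hb hf ⟨h1, h2⟩
    rw [h1, sum_range, priceSum]
    exact sum_congr rfl fun l _ => hin.price l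

theorem updateLine_spec (hs : I.Fits s) {l : ℕ} (hl : s 25 0 = l) (hlr : l < I.r) :
    I.Hoare updateLine s fun t => t 33 0 = s 36 0 ∧ t 34 0 = s 1 l ∧ t 35 0 = l + 1 := by
  have hw := I.five_le_width
  refine Reaches.setVar_seq I.hB hs (eval_var _ _) (by simpa [arrayBound] using hs 36 0)
    fun hs1 => ?_
  refine Reaches.setVar_seq I.hB hs1 (q := s 1 l) (by simp [Mem.write, hl]) ?_ fun hs2 => ?_
  · have := hs 1 l
    simp [arrayBound] at this ⊢
    nlinarith
  refine Reaches.setVar I.hB hs2 (q := l + 1) (by simp [Mem.write, hl]) ?_ ?_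
  · refine (len_add _ _).trans ?_
    have h1 := len_natCast_mono hlr.le
    have h2 := I.len_r_le
    simp [arrayBound]
    omega
  · simp [Mem.write]

theorem compareLine_spec (hs : I.Fits s) (hin : I.HasInput s) (hP : s 30 0 = I.priceSum)
    {j i l : ℕ} (hj : s 20 0 = j) (hi : s 24 0 = i) (hl : s 25 0 = l) (hlr : l < I.r)
    (h : BestLine l (s 1) (fun l => s 4 ((j * I.n + i) * I.r + l)) (s 32 0) (s 30 0)
      (s 35 0) (s 33 0) (s 34 0)) :
    I.Hoare compareLine s fun t => BestLine (l + 1) (s 1)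
      (fun l => s 4 ((j * I.n + i) * I.r + l)) (s 32 0) (s 30 0) (t 35 0) (t 33 0) (t 34 0) := by
  have hw := I.five_le_width
  have hl1 := hs 1 l
  have hl4 := hs 4 ((j * I.n + i) * I.r + l)
  have hl32 := hs 32 0
  refine Reaches.setVar_seq I.hB hs (hin.eval_eV hj hi hl) (by simpa [arrayBound] using hl4)
    fun hs1 => ?_
  refine Reaches.setVar_seq I.hB hs1 (q := s 4 ((j * I.n + i) * I.r + l) * (s 1 l - s 32 0))
    (by simp [Mem.write, hl]) ?_ fun hs2 => ?_
  · have h1 := len_mul (s 4 ((j * I.n + i) * I.r + l)) (s 1 l - s 32 0)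
    have h2 := len_sub (s 1 l) (s 32 0)
    simp [arrayBound] at hl1 hl4 hl32 ⊢
    omega
  refine Reaches.ite I.hB hs2 (fun hlt => ?_) fun hge => ?_
  · refine Reaches.skip hs2 ?_
    simp [Mem.write, eHeight] at hlt ⊢
    exact h.keep (.inl hlt)
  refine Reaches.ite I.hB hs2 (fun hlt => ?_) fun hge' => ?_
  · refine (updateLine_spec hs2 (by simp [Mem.write, hl]) hlr).mono ?_
    rintro t - - ⟨h1, h2, h3⟩
    simp [Mem.write, eHeight] at hlt h1 h2
    rw [h1, h2, h3]
    exact h.update hlt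
  have heq : s 4 ((j * I.n + i) * I.r + l) * (s 1 l - s 32 0) = s 33 0 * (s 34 0 - s 32 0) := by
    simp [Mem.write, eHeight] at hge hge'
    exact le_antisymm hge' hge
  refine Reaches.ite I.hB hs2 (fun hlt => ?_) fun hge'' => ?_
  · refine (updateLine_spec hs2 (by simp [Mem.write, hl]) hlr).mono ?_
    rintro t - - ⟨h1, h2, h3⟩
    simp [Mem.write, hl] at hlt h1 h2
    rw [h1, h2, h3]
    refine h.update_tie heq hlt ?_
    rw [hP]
    exact (hin.price ⟨l, hlr⟩).trans_le (I.price_le_priceSum _)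
  · refine Reaches.skip hs2 ?_
    simp [Mem.write, hl] at hge'' ⊢
    exact h.keep (.inr ⟨heq, hge''⟩)

theorem bestLineProg_spec (hs : I.Fits s) (hin : I.HasInput s) (hP : s 30 0 = I.priceSum)
    {j i : ℕ} (hj : s 20 0 = j) (hi : s 24 0 = i) :
    I.Hoare bestLineProg s fun t => BestLine I.r (s 1)
      (fun l => s 4 ((j * I.n + i) * I.r + l)) (s 32 0) (s 30 0) (t 35 0) (t 33 0) (t 34 0) := by
  have hw := I.r_add_le_width
  refine Reaches.setVar_seq I.hB hs (eval_const _ _) (by simp [arrayBound]; omega) fun hs1 => ?_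
  refine Reaches.setVar_seq I.hB hs1 (q := s 30 0) (by simp [Mem.write])
    (by simpa [arrayBound] using hs 30 0) fun hs2 => ?_
  refine Reaches.setVar_seq I.hB hs2 (eval_const _ _) (by simp [arrayBound]; omega) fun hs3 => ?_
  refine (Reaches.forLoop I.hB hs3 (fun L t => BestLine L (s 1)
      (fun l => s 4 ((j * I.n + i) * I.r + l)) (s 32 0) (s 30 0) (t 35 0) (t 33 0) (t 34 0)) I.r
      ((by omega : I.r ≤ I.width).trans I.width_le)
      (I.len_r_le.trans (by simp [arrayBound])) rfl ?_ ?_ ?_ ?_)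
  · intro t ht
    exact ((((hin.write (by norm_num) 0 _).write (by norm_num) 0 _).write (by norm_num) 0 _).frame
      ht (by decide)).eval_eR
  · intro i t t' ht h
    simpa only [ht 33 (by decide), ht 34 (by decide), ht 35 (by decide)] using h
  · exact .inl (by simp [Mem.write])
  · intro L hL t hb hf hL0 h
    have hin' : I.HasInput t :=
      (((hin.write (by norm_num) 0 _).write (by norm_num) 0 _).write (by norm_num) 0 _).frame hf
        (by decide)
    have e : ∀ a, a ≠ 33 → a ≠ 34 → a ≠ 35 → (forLoop 25 eR compareLine).writes a = false →
        t a = s a := by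
      intro a h1 h2 h3 h4
      rw [hf a h4, write_ne _ _ _ h3, write_ne _ _ _ h2, write_ne _ _ _ h1]
    have e1 := e 1 (by decide) (by decide) (by decide) rfl
    have e4 := e 4 (by decide) (by decide) (by decide) rfl
    have e20 := e 20 (by decide) (by decide) (by decide) rfl
    have e24 := e 24 (by decide) (by decide) (by decide) rfl
    have e30 := e 30 (by decide) (by decide) (by decide) rfl
    have e32 := e 32 (by decide) (by decide) (by decide) rfl
    have := compareLine_spec hb hin' (by rw [e30, hP]) (j := j) (i := i) (by rw [e20, hj])
      (by rw [e24, hi]) hL0 hL (by rw [e1, e4, e32, e30]; exact h)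
    rwa [e1, e4, e32, e30] at this

end Instance
-- Computing the tables
/-- The entry of the current row that belongs to the current product. -/
def eEntry : Expr := var 31 * eN + var 24

def entryProg : Prog :=
  bestLineProg ;; .assign 9 eEntry (var 35) ;; .assign 10 eEntry (var 33) ;;
  .assign 11 eEntry (var 33 * var 34) ;;
  .ite (.const 0) (.cell 3 (var 20)) (.assign 8 eEntry (eHeight / .cell 3 (var 20)))
    (.ite (.const 0) eHeight (.assign 8 eEntry (var 30)) (.assign 8 eEntry (.const 0)))

/-- Setting variable `36` to zero when `l' = r` turns a crossing into a zero of the line `l`; the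
last test clips negative thresholds to `0`. -/
def thresholdProg : Prog :=
  setVar 31 (((var 20 * eN + var 21) * eR + var 22) * (eR + .const 1) + var 23) ;;
  .ite (var 23) eR (setVar 36 (eV 21 23)) (setVar 36 (.const 0)) ;;
  setVar 32 ((eV 21 22 * .cell 1 (var 22) - var 36 * .cell 1 (var 23)) / (eV 21 22 - var 36)) ;;
  .ite (var 32) (.const 0) (setVar 32 (.const 0)) .skip ;;
  .assign 7 (var 31) (var 32)

def rowProg : Prog := thresholdProg ;; forLoop 24 eN entryProg

def tableProg : Prog :=
  forLoop 20 eM (forLoop 21 eN (forLoop 22 eR (forLoop 23 (eR + .const 1) rowProg)))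

namespace Instance

variable (I : Instance)

/-- What the table says of type `j` and product `i` at threshold `z`: share `c`, index `t` of the
best line plus one (or zero), its parameter `u` and the product `w` of its parameter and price. -/
def Entry (j : Fin I.m) (i : Fin I.n) (z c t u w : ℚ) : Prop :=
  (t = 0 ∧ u = 0 ∧ w = 0 ∧ c = 0 ∧ ∀ l, I.v j i l * (I.price l - z) ≤ 0) ∨
    ∃ k : Fin I.r, t = k + 1 ∧ u = I.v j i k ∧ w = I.v j i k * I.price k ∧
      0 < I.v j i k * (I.price k - z) ∧ c = I.share j (I.v j i k * (I.price k - z)) ∧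
      ∀ l, I.v j i l * (I.price l - z) < I.v j i k * (I.price k - z) ∨
        I.v j i l * (I.price l - z) = I.v j i k * (I.price k - z) ∧ I.price l ≤ I.price k

/-- Entry `y` of the tables in arrays `8` to `11` is correct. -/
def EntryAt (j : Fin I.m) (i : Fin I.n) (z : ℚ) (s : Mem) (y : ℕ) : Prop :=
  I.Entry j i z (s 8 y) (s 9 y) (s 10 y) (s 11 y)

/-- The number of the row for type `j` and the threshold at which the lines `l` and `l'` of
product `i` cross; `l' = r` stands for the line zero. -/
def rowIndex (j i l l' : ℕ) : ℕ := ((j * I.n + i) * I.r + l) * (I.r + 1) + l'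

/-- The row is correct. -/
def RowAt (j : Fin I.m) (i : Fin I.n) (l : Fin I.r) (l' : ℕ) (s : Mem) : Prop :=
  0 ≤ s 7 (I.rowIndex j i l l') ∧
  (∀ h : l' < I.r, s 7 (I.rowIndex j i l l') =
    max 0 ((I.v j i l * I.price l - I.v j i ⟨l', h⟩ * I.price ⟨l', h⟩) /
      (I.v j i l - I.v j i ⟨l', h⟩))) ∧
  (l' = I.r → s 7 (I.rowIndex j i l l') = max 0 (I.v j i l * I.price l / I.v j i l)) ∧
  ∀ e : Fin I.n, I.EntryAt j e (s 7 (I.rowIndex j i l l')) s (I.rowIndex j i l l' * I.n + e)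

/-- All rows with numbers less than `X` are correct. -/
def RowsBelow (X : ℕ) (s : Mem) : Prop :=
  ∀ (j : Fin I.m) (i : Fin I.n) (l : Fin I.r), ∀ l' < I.r + 1, I.rowIndex j i l l' < X →
    I.RowAt j i l l' s

variable {I} {s : Mem}

theorem entry_of_bestLine (hin : I.HasInput s) {j : Fin I.m} {i : Fin I.n} {z P t u b c : ℚ}
    (h : BestLine I.r (s 1) (fun l => s 4 ((j * I.n + i) * I.r + l)) z P t u b)
    (hc : c = if 0 < I.v₀ j then u * (b - z) / I.v₀ j else
      if 0 < u * (b - z) then I.priceSum else 0) : I.Entry j i z c t u (u * b) := by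
  rcases h with ⟨h1, h2, h3, h⟩ | ⟨k, hk, h1, h2, h3, h4, h⟩
  · refine .inl ⟨h1, h2, by rw [h2, zero_mul], by rw [hc, h2]; simp, fun l => ?_⟩
    have := h l l.2
    beta_reduce at this
    rwa [hin.price l, hin.v] at this
  · have e1 : u = I.v j i ⟨k, hk⟩ := h2.trans (hin.v j i ⟨k, hk⟩)
    have e2 : b = I.price ⟨k, hk⟩ := h3.trans (hin.price ⟨k, hk⟩)
    rw [e1, e2] at h4 h hc ⊢
    refine .inr ⟨⟨k, hk⟩, h1, rfl, rfl, h4, ?_, fun l => ?_⟩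
    · rw [hc, if_pos h4, share]
    · have := h l l.2
      beta_reduce at this
      rwa [hin.price l, hin.v] at this

theorem entryProg_spec (hs : I.Fits s) (hin : I.HasInput s) (hP : s 30 0 = I.priceSum)
    (j : Fin I.m) (i : Fin I.n) {x : ℕ} (hj : s 20 0 = (j : ℕ)) (hi : s 24 0 = (i : ℕ))
    (hx : s 31 0 = x) :
    I.Hoare entryProg s fun t => I.EntryAt j i (s 32 0) t (x * I.n + i) ∧
      ∀ a ∈ [8, 9, 10, 11], ∀ y, y ≠ x * I.n + i → t a y = s a y := by
  have hw := I.five_le_width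
  have hw2 : I.width ≤ I.width ^ 2 := Nat.le_self_pow (by norm_num) _
  refine (bestLineProg_spec hs hin hP hj hi).seq fun t ht hf h => ?_
  have hin' := hin.frame hf (by decide)
  have e20 := hf 20 rfl
  have e24 := hf 24 rfl
  have e30 := hf 30 rfl
  have e31 := hf 31 rfl
  have e32 := hf 32 rfl
  have key : ∀ u : Mem, u 0 = t 0 → u 31 = t 31 → u 24 = t 24 →
      eEntry.eval u = ((x * I.n + i : ℕ) : ℚ) := by
    intro u h0 h31 h24
    simp [eEntry, eN, h0, h31, h24, e31, e24, hx, hi, hin'.n]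
  have l33 := ht 33 0
  have l34 := ht 34 0
  have l35 := ht 35 0
  have l32 := ht 32 0
  have l3 := ht 3 j
  have hh := len_mul (t 33 0) (t 34 0 - t 32 0)
  have hh' := len_sub (t 34 0) (t 32 0)
  refine Reaches.set_seq I.hB ht (key _ rfl rfl rfl) (eval_var _ _)
    (by simpa [arrayBound] using l35) fun ht1 => ?_
  refine Reaches.set_seq I.hB ht1 (q := t 33 0) (key _ (write_ne _ _ _ (by decide))
    (write_ne _ _ _ (by decide)) (write_ne _ _ _ (by decide))) (by simp [Mem.write])
    (by simpa [arrayBound] using l33) fun ht2 => ?_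
  refine Reaches.set_seq I.hB ht2 (q := t 33 0 * t 34 0) (key _ (by simp [write_ne])
    (by simp [write_ne]) (by simp [write_ne])) (by simp [Mem.write]) ?_ fun ht3 => ?_
  · have := len_mul (t 33 0) (t 34 0)
    simp [arrayBound] at l33 l34 ⊢
    omega
  set u := ((t.write 9 (x * I.n + i) (t 35 0)).write 10 (x * I.n + i) (t 33 0)).write 11
    (x * I.n + i) (t 33 0 * t 34 0) with hu
  have hkey : eEntry.eval u = ((x * I.n + i : ℕ) : ℚ) :=
    key _ (by simp [hu, write_ne]) (by simp [hu, write_ne]) (by simp [hu, write_ne])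
  have hv₀ : (Expr.cell 3 (var 20)).eval u = I.v₀ j := by
    have : u 20 0 = (j : ℕ) := by rw [hu, write_ne _ _ _ (by decide), write_ne _ _ _ (by decide),
      write_ne _ _ _ (by decide), e20, hj]
    rw [eval_cell, eval_var, this, Nat.floor_natCast, ← hin'.v₀ j]
    simp [hu, write_ne]
  have hheight : eHeight.eval u = t 33 0 * (t 34 0 - t 32 0) := by
    simp [eHeight, hu, Mem.write]
  have post : ∀ c, c = (if 0 < I.v₀ j then t 33 0 * (t 34 0 - t 32 0) / I.v₀ j else
      if 0 < t 33 0 * (t 34 0 - t 32 0) then I.priceSum else 0) →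
      I.EntryAt j i (s 32 0) (u.write 8 (x * I.n + i) c) (x * I.n + i) ∧
      ∀ a ∈ [8, 9, 10, 11], ∀ y, y ≠ x * I.n + i → u.write 8 (x * I.n + i) c a y = s a y := by
    intro c hc
    constructor
    · have := entry_of_bestLine hin h (c := c) (by rw [hc, e32])
      simpa [EntryAt, hu, Mem.write] using this
    · intro a ha y hy
      simp only [List.mem_cons, List.not_mem_nil, or_false] at ha
      rcases ha with rfl | rfl | rfl | rfl <;> simp [hu, Mem.write, hy] <;> rw [hf _ rfl]
  refine Reaches.ite I.hB ht3 (fun h0 => ?_) fun h0 => ?_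
  · rw [hv₀, eval_const] at h0
    refine Reaches.set I.hB ht3 hkey (q := t 33 0 * (t 34 0 - t 32 0) / I.v₀ j)
      (by rw [eval_div, hheight, hv₀]) ?_ (post _ (by rw [if_pos h0]))
    have h1 := len_div (t 33 0 * (t 34 0 - t 32 0)) (I.v₀ j)
    rw [hin'.v₀] at l3
    simp [arrayBound] at l33 l34 l32 l3 ⊢
    omega
  rw [hv₀, eval_const] at h0
  refine Reaches.ite I.hB ht3 (fun h1 => ?_) fun h1 => ?_
  · rw [hheight, eval_const] at h1
    refine Reaches.set I.hB ht3 hkey (q := I.priceSum) (by simp [hu, Mem.write, e30, hP]) ?_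
      (post _ (by rw [if_neg h0, if_pos h1]))
    have := hs 30 0
    rw [hP] at this
    simp [arrayBound] at this ⊢
    omega
  · rw [hheight, eval_const] at h1
    refine Reaches.set I.hB ht3 hkey (eval_const _ _) (by simp [arrayBound]; omega)
      (post _ (by rw [if_neg h0, if_neg h1]))

theorem HasInput.eval_row (h : I.HasInput s) {j i l l' : ℕ} (hj : s 20 0 = j) (hi : s 21 0 = i)
    (hl : s 22 0 = l) (hl' : s 23 0 = l') :
    (((var 20 * eN + var 21) * eR + var 22) * (eR + .const 1) + var 23).eval s =
      (I.rowIndex j i l l' : ℕ) := by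
  simp [h.eval_eN, h.eval_eR, hj, hi, hl, hl', rowIndex]

theorem thresholdProg_spec (hs : I.Fits s) (hin : I.HasInput s)
    (j : Fin I.m) (i : Fin I.n) (l : Fin I.r) {l' : ℕ}
    (h20 : s 20 0 = (j : ℕ)) (h21 : s 21 0 = (i : ℕ)) (h22 : s 22 0 = (l : ℕ))
    (h23 : s 23 0 = l') :
    I.Hoare thresholdProg s fun t => t 31 0 = (I.rowIndex j i l l' : ℕ) ∧
      t 7 (I.rowIndex j i l l') = t 32 0 ∧ 0 ≤ t 32 0 ∧
      (∀ h : l' < I.r, t 32 0 = max 0 ((I.v j i l * I.price l - I.v j i ⟨l', h⟩ *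
        I.price ⟨l', h⟩) / (I.v j i l - I.v j i ⟨l', h⟩))) ∧
      (l' = I.r → t 32 0 = max 0 (I.v j i l * I.price l / I.v j i l)) ∧
      ∀ y < I.rowIndex j i l l', t 7 y = s 7 y := by
  have hw := I.five_le_width
  refine Reaches.setVar_seq I.hB hs (hin.eval_row h20 h21 h22 h23) ?_ fun hs1 => ?_
  · rw [← hin.eval_row h20 h21 h22 h23]
    refine (hs.len_eval _).trans ?_
    simp [weight_add, weight_mul, weight_var, weight_const, eN, eR, weight_cell, arrayBound]
    omega
  set s1 := s.write 31 0 (I.rowIndex j i l l' : ℕ) with hs1'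
  have hin1 : I.HasInput s1 := hin.write (by norm_num) _ _
  have f1 : ∀ a, a ≠ 31 → s1 a = s a := fun a ha => write_ne _ _ _ ha
  have g31 : s1 31 0 = (I.rowIndex j i l l' : ℕ) := write_same _ _ _ _
  refine Reaches.seq (R := fun t => t 36 0 = if h : l' < I.r then I.v j i ⟨l', h⟩ else 0)
    (Reaches.ite I.hB hs1 (fun h => ?_) fun h => ?_) fun t ht hf h36 => ?_
  · rw [eval_var, hin1.eval_eR, f1 23 (by decide), h23, Nat.cast_lt] at h
    have e := hin1.eval_eV (a := 21) (b := 23) (by rw [f1 20 (by decide), h20])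
      (by rw [f1 21 (by decide), h21]) (by rw [f1 23 (by decide), h23])
    rw [hin1.v j i ⟨l', h⟩] at e
    refine Reaches.setVar I.hB hs1 e ?_ (by simp [h])
    simpa [arrayBound, hin1.v j i ⟨l', h⟩] using hs1 4 ((j * I.n + i) * I.r + l')
  · rw [eval_var, hin1.eval_eR, f1 23 (by decide), h23, Nat.cast_lt] at h
    exact Reaches.setVar I.hB hs1 (eval_const _ _) (by simp [arrayBound]; omega) (by simp [h])
  have hin2 : I.HasInput t := hin1.frame hf (by decide)
  have f2 : ∀ a, a ≠ 31 → a ≠ 36 → t a = s a := by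
    intro a h1 h2
    rw [hf a (by simpa [Prog.writes, setVar] using h2), f1 a h1]
  have e := hin2.eval_eV (a := 21) (b := 22) (by rw [f2 20 (by decide) (by decide), h20])
      (by rw [f2 21 (by decide) (by decide), h21]) (by rw [f2 22 (by decide) (by decide), h22])
  rw [hin2.v] at e
  have ep : (Expr.cell 1 (var 22)).eval t = I.price l := by
    rw [eval_cell, eval_var, f2 22 (by decide) (by decide), h22, Nat.floor_natCast, hin2.price]
  have ep' : (Expr.cell 1 (var 23)).eval t = t 1 l' := by
    rw [eval_cell, eval_var, f2 23 (by decide) (by decide), h23, Nat.floor_natCast]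
  set q := (I.v j i l * I.price l - t 36 0 * t 1 l') / (I.v j i l - t 36 0) with hq
  have hqe : ((eV 21 22 * .cell 1 (var 22) - var 36 * .cell 1 (var 23)) /
      (eV 21 22 - var 36)).eval t = q := by
    rw [eval_div, eval_sub, eval_sub, eval_mul, eval_mul, e, ep, ep', eval_var]
  refine Reaches.setVar_seq I.hB ht hqe ?_ fun ht3 => ?_
  · rw [← hqe]
    refine (ht.len_eval _).trans ?_
    simp [weight_div, weight_sub, weight_mul, weight_var, eV, weight_cell, arrayBound]
    omega
  have h31 : t 31 = s1 31 := hf 31 rfl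
  refine Reaches.seq (R := fun u => u 32 0 = max 0 q) (Reaches.ite I.hB ht3 (fun h => ?_)
    fun h => ?_) fun u hu hfu hu32 => ?_
  · simp only [eval_var, write_same, eval_const] at h
    exact Reaches.setVar I.hB ht3 (eval_const _ _) (by simp [arrayBound]; omega)
      (by rw [write_same, max_eq_left h.le])
  · simp only [eval_var, write_same, eval_const, not_lt] at h
    exact Reaches.skip ht3 (by rw [write_same, max_eq_right h])
  have hu31 : u 31 0 = (I.rowIndex j i l l' : ℕ) := by
    rw [hfu 31 rfl, write_ne _ _ _ (by decide), h31, g31]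
  have hu7 : u 7 = s 7 := by
    rw [hfu 7 rfl, write_ne _ _ _ (by decide), f2 7 (by decide) (by decide)]
  refine Reaches.set I.hB hu (x := I.rowIndex j i l l') (q := max 0 q) (by simp [hu31])
    (by simp [hu32]) ?_ ⟨?_, ?_, ?_, ?_, ?_, ?_⟩
  · have := hu 32 0
    rw [hu32] at this
    simpa [arrayBound] using this
  · rw [write_ne _ _ _ (by decide), hu31]
  · rw [write_same, write_ne _ _ _ (by decide), hu32]
  · rw [write_ne _ _ _ (by decide), hu32]
    exact le_max_left _ _
  · intro h
    rw [write_ne _ _ _ (by decide), hu32, hq, h36, dif_pos h, hin2.price ⟨l', h⟩]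
  · intro h
    -- Here the price cell read lies past the ladder, but it is multiplied by zero.
    rw [write_ne _ _ _ (by decide), hu32, hq, h36, dif_neg (by omega), zero_mul, sub_zero, sub_zero]
  · intro y hy
    rw [write_ne_cell _ _ _ hy.ne, hu7]

theorem mul_add_inj {n a b i k : ℕ} (hi : i < n) (hk : k < n) (h : a * n + i = b * n + k) :
    a = b ∧ i = k := by
  have h1 := congrArg (· / n) h
  have hn : 0 < n := by omega
  simp only [Nat.add_comm _ i, Nat.add_comm _ k, Nat.add_mul_div_right _ _ hn,
    Nat.div_eq_of_lt hi, Nat.div_eq_of_lt hk, zero_add] at h1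
  subst h1
  exact ⟨rfl, by omega⟩

theorem rowProg_spec (hs : I.Fits s) (hin : I.HasInput s) (hP : s 30 0 = I.priceSum)
    (j : Fin I.m) (i : Fin I.n) (l : Fin I.r) {l' : ℕ} (hl' : l' < I.r + 1)
    (h20 : s 20 0 = (j : ℕ)) (h21 : s 21 0 = (i : ℕ)) (h22 : s 22 0 = (l : ℕ))
    (h23 : s 23 0 = l') (hrows : I.RowsBelow (I.rowIndex j i l l') s) :
    I.Hoare rowProg s (I.RowsBelow (I.rowIndex j i l l' + 1)) := by
  have hw := I.n_add_le_width
  set x := I.rowIndex j i l l' with hx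
  refine (thresholdProg_spec hs hin j i l h20 h21 h22 h23).seq ?_
  rintro t ht hf ⟨h31, h7, hz0, hz1, hz2, hz3⟩
  have hin1 : I.HasInput t := hin.frame hf (by decide)
  refine (Reaches.forLoop I.hB ht (fun L u =>
    (∀ e : Fin I.n, (e : ℕ) < L → I.EntryAt j e (t 32 0) u (x * I.n + e)) ∧
    ∀ a ∈ [8, 9, 10, 11], ∀ y < x * I.n, u a y = t a y) I.n
    ((by omega : I.n ≤ I.width).trans I.width_le)
    (I.len_n_le.trans (by simp [arrayBound])) rfl ?_ ?_ ?_ ?_).mono ?_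
  · intro u hu
    exact (hin1.frame hu (by decide)).eval_eN
  · intro L u u' hu h
    unfold EntryAt
    rw [hu 8 (by decide), hu 9 (by decide), hu 10 (by decide), hu 11 (by decide)]
    refine ⟨h.1, fun a ha => ?_⟩
    rw [hu a (by rintro rfl; revert ha; decide)]
    exact h.2 a ha
  · exact ⟨fun e he => absurd he (Nat.not_lt_zero _), fun _ _ _ _ => rfl⟩
  · rintro L hL u hu hfu hL24 ⟨hE, hpres⟩
    refine (entryProg_spec hu (hin1.frame hfu (by decide)) (x := x)
      (by rw [hfu 30 rfl, hf 30 rfl, hP]) j ⟨L, hL⟩ (by rw [hfu 20 rfl, hf 20 rfl, h20]) hL24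
      (by rw [hfu 31 rfl, h31])).mono ?_
    rintro w - - ⟨h1, h2⟩
    rw [hfu 32 rfl] at h1
    constructor
    · intro e he
      rcases Nat.lt_succ_iff_lt_or_eq.1 he with he | he
      · have hne : x * I.n + e ≠ x * I.n + L := by omega
        unfold EntryAt
        rw [h2 8 (by simp) _ hne, h2 9 (by simp) _ hne, h2 10 (by simp) _ hne,
          h2 11 (by simp) _ hne]
        exact hE e he
      · obtain rfl : e = ⟨L, hL⟩ := Fin.ext he
        exact h1
    · intro a ha y hy
      rw [h2 a ha y (by simp only; omega), hpres a ha y hy]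
  · rintro u - hfu ⟨hE, hpres⟩ j1 i1 l1 k1 hk1 hlt
    have hu7 : u 7 = t 7 := hfu 7 rfl
    rcases Nat.lt_succ_iff_lt_or_eq.1 hlt with hlt | heq
    · have hold := hrows j1 i1 l1 k1 hk1 hlt
      have e7 : u 7 (I.rowIndex j1 i1 l1 k1) = s 7 (I.rowIndex j1 i1 l1 k1) := by
        rw [hu7, hz3 _ hlt]
      unfold RowAt at hold ⊢
      rw [e7]
      refine ⟨hold.1, hold.2.1, hold.2.2.1, fun e => ?_⟩
      have hlt' : I.rowIndex j1 i1 l1 k1 * I.n + e < x * I.n := by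
        have : (I.rowIndex j1 i1 l1 k1 + 1) * I.n ≤ x * I.n := Nat.mul_le_mul_right _ hlt
        have he := e.2
        rw [Nat.succ_mul] at this
        omega
      have := hold.2.2.2 e
      unfold EntryAt at this ⊢
      rwa [hpres 8 (by simp) _ hlt', hpres 9 (by simp) _ hlt', hpres 10 (by simp) _ hlt',
        hpres 11 (by simp) _ hlt', hf 8 rfl, hf 9 rfl, hf 10 rfl, hf 11 rfl]
    -- Row numbers are mixed-radix numerals, so equal numbers have equal digits.
    · obtain ⟨h1, rfl⟩ := mul_add_inj hk1 hl' heq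
      obtain ⟨h2, hl⟩ := mul_add_inj l1.2 l.2 h1
      obtain ⟨hj, hi⟩ := mul_add_inj i1.2 i.2 h2
      obtain rfl := Fin.ext hl
      obtain rfl := Fin.ext hi
      obtain rfl := Fin.ext hj
      unfold RowAt
      rw [← hx, hu7, h7]
      exact ⟨hz0, hz1, hz2, fun e => hE e e.2⟩

theorem RowsBelow.congr {X : ℕ} {t : Mem} (h : I.RowsBelow X s)
    (ht : ∀ a ∈ [7, 8, 9, 10, 11], t a = s a) : I.RowsBelow X t := by
  intro j i l l' hl' hX
  have := h j i l l' hl' hX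
  unfold RowAt EntryAt at *
  rwa [ht 7 (by simp), ht 8 (by simp), ht 9 (by simp), ht 10 (by simp), ht 11 (by simp)]

/-- All four loops share one invariant on the mixed-radix row number; leaving an inner loop is a
carry into the next digit. -/
theorem tableProg_spec (hs : I.Fits s) (hin : I.HasInput s) (hP : s 30 0 = I.priceSum) :
    I.Hoare tableProg s (I.RowsBelow (I.rowIndex I.m 0 0 0)) := by
  have hwm := I.m_add_le_width
  have hwn := I.n_add_le_width
  have hwr := I.r_add_le_width
  have stable : ∀ {x : ℕ} (hx : x ∉ [7, 8, 9, 10, 11]) {X : ℕ} {t t' : Mem},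
      (∀ a, a ≠ x → t' a = t a) → I.RowsBelow X t → I.RowsBelow X t' :=
    by
    intro x hx X t t' h h'
    exact h'.congr fun a ha => h a (by rintro rfl; exact hx ha)
  refine Reaches.forLoop I.hB hs (fun j t => I.RowsBelow (I.rowIndex j 0 0 0) t) I.m
    ((by omega : I.m ≤ I.width).trans I.width_le)
    (I.len_m_le.trans (by simp [arrayBound])) rfl
    (fun t ht => (hin.frame ht (by decide)).eval_eM)
    (fun i t t' ht h => stable (by decide) ht h)
    (fun j i l l' _ hlt => absurd hlt (by simp [rowIndex])) fun j hj t ht hf h20 h => ?_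
  have hin1 : I.HasInput t := hin.frame hf (by decide)
  refine (Reaches.forLoop I.hB ht (fun i t => I.RowsBelow (I.rowIndex j i 0 0) t) I.n
    ((by omega : I.n ≤ I.width).trans I.width_le)
    (I.len_n_le.trans (by simp [arrayBound])) rfl
    (fun t ht => (hin1.frame ht (by decide)).eval_eN)
    (fun i t t' ht h => stable (by decide) ht h) h fun i hi t1 ht1 hf1 h21 h1 => ?_).mono
    (fun t1 _ _ h1 => ?_)
  swap
  · rwa [show I.rowIndex (j + 1) 0 0 0 = I.rowIndex j I.n 0 0 by simp only [rowIndex]; ring]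
  have hin2 : I.HasInput t1 := hin1.frame hf1 (by decide)
  refine (Reaches.forLoop I.hB ht1 (fun l t => I.RowsBelow (I.rowIndex j i l 0) t) I.r
    ((by omega : I.r ≤ I.width).trans I.width_le)
    (I.len_r_le.trans (by simp [arrayBound])) rfl
    (fun t ht => (hin2.frame ht (by decide)).eval_eR)
    (fun i t t' ht h => stable (by decide) ht h) h1 fun l hl t2 ht2 hf2 h22 h2 => ?_).mono
    (fun t1 _ _ h1 => ?_)
  swap
  · rwa [show I.rowIndex j (i + 1) 0 0 = I.rowIndex j i I.r 0 by simp only [rowIndex]; ring]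
  have hin3 : I.HasInput t2 := hin2.frame hf2 (by decide)
  refine (Reaches.forLoop I.hB ht2 (fun l' t => I.RowsBelow (I.rowIndex j i l l') t) (I.r + 1)
    ((by omega : I.r + 1 ≤ I.width).trans I.width_le) ?_ rfl
    (fun t ht => by simp [(hin3.frame ht (by decide)).eval_eR])
    (fun i t t' ht h => stable (by decide) ht h) h2 fun l' hl' t3 ht3 hf3 h23 h3 => ?_).mono
    (fun t1 _ _ h1 => ?_)
  · have h1 := I.len_r_le
    have h2 := len_add (I.r : ℚ) 1
    rw [len_one] at h2
    push_cast
    simp [arrayBound]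
    omega
  swap
  · rwa [show I.rowIndex j i (l + 1) 0 = I.rowIndex j i l (I.r + 1) by simp only [rowIndex]; ring]
  exact rowProg_spec ht3 (hin3.frame hf3 (by decide))
    (by rw [hf3 30 rfl, hf2 30 rfl, hf1 30 rfl, hf 30 rfl, hP]) ⟨j, hj⟩ ⟨i, hi⟩ ⟨l, hl⟩ hl'
    (by rw [hf3 20 rfl, hf2 20 rfl, hf1 20 rfl, h20]) (by rw [hf3 21 rfl, hf2 21 rfl, h21])
    (by rw [hf3 22 rfl, h22]) h23 h3

end Instance
-- Greedy selection on the machine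
def eQ : Expr := eN * eR * (eR + .const 1)

/-- The row of the type in variable `20` and the threshold with the number in variable `q`. -/
def eRow (q : ℕ) : Expr := var 20 * eQ + var q

/-- The entry of that row for the product in variable `24`. -/
def eCell (q : ℕ) : Expr := eRow q * eN + var 24

def rowValueProg : Prog :=
  setVar 47 (.cell 7 (eRow 48)) ;;
  forLoop 24 eN (setVar 47 (var 47 + .cell 5 (var 24) * .cell 8 (eCell 48)))

def surrogateProg : Prog :=
  setVar 46 (var 30) ;;
  forLoop 48 eQ (rowValueProg ;; .ite (var 47) (var 46) (setVar 46 (var 47)) .skip)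

def objectiveProg : Prog :=
  setVar 45 (.const 0) ;;
  forLoop 20 eM (surrogateProg ;; setVar 45 (var 45 + .cell 2 (var 20) * var 46))

/-- The candidate is inserted into array `5` only for the evaluation. Its old indicator is kept in
variable `42`, so products already selected are restored correctly. -/
def candidateProg : Prog :=
  setVar 42 (.cell 5 (var 41)) ;; .assign 5 (var 41) (.const 1) ;; objectiveProg ;;
  .assign 5 (var 41) (var 42) ;;
  .ite (var 43) (var 45) (setVar 43 (var 45) ;; setVar 44 (var 41)) .skip

def roundProg : Prog :=
  setVar 43 (.const (-1)) ;; setVar 44 (.const 0) ;; forLoop 41 eN candidateProg ;;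
  .assign 5 (var 44) (.const 1)

/-- The loop is over `n` with a test against `k`, because `k` is given in binary and may be
exponential in the size of the instance. -/
def greedyProg : Prog := forLoop 40 eN (.ite (var 40) eK roundProg .skip)

namespace Instance

variable (I : Instance)

/-- The number of thresholds per type. -/
def rowCount : ℕ := I.n * I.r * (I.r + 1)

/-- The surrogate objective of a selection, according to the tables in memory. -/
def objective (s : Mem) (S : Finset (Fin I.n)) : ℚ :=
  ∑ j : Fin I.m, I.weight j * I.surrogate I.rowCount (fun q => s 7 (j * I.rowCount + q))
    (fun q i => s 8 ((j * I.rowCount + q) * I.n + i)) S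

/-- Array `5` holds the indicator vector of `S`. -/
def HasSet (S : Finset (Fin I.n)) (s : Mem) : Prop :=
  ∀ i : Fin I.n, s 5 i = if i ∈ S then 1 else 0

variable {I} {s : Mem} {S : Finset (Fin I.n)}

theorem objective_congr {t : Mem} (h7 : t 7 = s 7) (h8 : t 8 = s 8) :
    I.objective t = I.objective s := by
  funext S
  unfold objective
  rw [h7, h8]

theorem HasSet.sum_mul (h : I.HasSet S s) (f : ℕ → ℚ) :
    ∑ i ∈ range I.n, s 5 i * f i = ∑ i ∈ S, f i := by
  rw [sum_range]
  simp only [h _, ite_mul, one_mul, zero_mul]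
  rw [← sum_filter, filter_mem_eq_inter, univ_inter]

theorem HasInput.eval_eQ (h : I.HasInput s) : eQ.eval s = (I.rowCount : ℕ) := by
  simp [eQ, h.eval_eN, h.eval_eR, rowCount]

theorem HasInput.eval_eRow (h : I.HasInput s) {j q a : ℕ} (hj : s 20 0 = j) (hq : s a 0 = q) :
    (eRow a).eval s = (j * I.rowCount + q : ℕ) := by
  simp [eRow, h.eval_eQ, hj, hq]

theorem HasInput.eval_eCell (h : I.HasInput s) {j q i a : ℕ} (hj : s 20 0 = j)
    (hq : s a 0 = q) (hi : s 24 0 = i) :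
    (eCell a).eval s = ((j * I.rowCount + q) * I.n + i : ℕ) := by
  simp [eCell, h.eval_eRow hj hq, hi, h.eval_eN]

theorem rowCount_le (I : Instance) : I.rowCount ≤ 30 * I.width ^ 4 := by
  have h1 : I.n * I.r ≤ I.width := I.n_mul_r_le_size.trans (by unfold width; omega)
  have h2 : I.r + 1 ≤ I.width := by have := I.r_add_le_width; omega
  have h3 : I.width ^ 2 ≤ I.width ^ 4 :=
    Nat.pow_le_pow_right (by have := I.five_le_width; omega) (by norm_num)
  calc I.rowCount ≤ I.width * I.width := Nat.mul_le_mul h1 h2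
    _ ≤ 30 * I.width ^ 4 := by nlinarith

theorem len_rowCount_le (I : Instance) : len (I.rowCount : ℚ) ≤ 6 * I.width := by
  have h1 := len_mul ((I.n : ℚ) * I.r) (I.r + 1)
  have h2 := len_mul (I.n : ℚ) I.r
  have h3 := len_add (I.r : ℚ) 1
  have h4 := I.len_n_le
  have h5 := I.len_r_le
  have h6 := I.five_le_width
  rw [len_one] at h3
  have : (I.rowCount : ℚ) = I.n * I.r * (I.r + 1) := by simp [rowCount]
  rw [this]
  omega

theorem rowValueProg_spec (hs : I.Fits s) (hin : I.HasInput s) (hS : I.HasSet S s) {j q : ℕ}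
    (hj : s 20 0 = j) (hq : s 48 0 = q) :
    I.Hoare rowValueProg s fun t => t 47 0 = s 7 (j * I.rowCount + q) +
      ∑ i ∈ S, s 8 ((j * I.rowCount + q) * I.n + i) := by
  have hw := I.n_add_le_width
  set y := j * I.rowCount + q with hy
  have h7 : len (s 7 y) ≤ 6 * I.width := by simpa [arrayBound] using hs 7 y
  have hbig : ∀ L ≤ I.n, 6 * I.width + L * (I.width + 20 * I.width ^ 2) ≤ 20 * I.width ^ 3 := by
    intro L hL
    obtain ⟨k, hk⟩ : ∃ k, I.width = k + 5 := ⟨I.width - 5, by omega⟩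
    have h1 : L * (I.width + 20 * I.width ^ 2) ≤ k * (I.width + 20 * I.width ^ 2) :=
      Nat.mul_le_mul_right _ (by omega)
    have h2 : 6 * I.width + k * (I.width + 20 * I.width ^ 2) ≤ 20 * I.width ^ 3 := by
      rw [hk]
      nlinarith
    omega
  refine Reaches.setVar_seq I.hB hs (q := s 7 y)
    (by rw [eval_cell, hin.eval_eRow hj hq, Nat.floor_natCast]) ?_ fun hs1 => ?_
  · have := hbig 0 (Nat.zero_le _)
    simp [arrayBound]
    omega
  have hin1 := hin.write (a := 47) (by norm_num) 0 (s 7 y)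
  refine (Reaches.forLoop I.hB hs1 (fun L t => t 47 0 = s 7 y + ∑ i ∈ range L,
      s 5 i * s 8 (y * I.n + i) ∧ len (t 47 0) ≤ 6 * I.width +
      L * (I.width + 20 * I.width ^ 2)) I.n ((by omega : I.n ≤ I.width).trans I.width_le)
    (I.len_n_le.trans (by simp [arrayBound])) rfl
    (fun t ht => (hin1.frame ht (by decide)).eval_eN)
    (fun i t t' ht h => by simpa only [ht 47 (by decide)] using h)
    (by simpa using h7) ?_).mono ?_
  · rintro L hL t ht hf hi ⟨h1, h2⟩
    have e : ∀ a, a ≠ 24 → a ≠ 47 → t a = s a := by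
      intro a h1 h2
      rw [hf a (by simp [forLoop, Prog.writes, setVar, h1, h2]), write_ne _ _ _ h2]
    have hc := (hin1.frame hf (by decide)).eval_eCell (a := 48) (j := j) (q := q)
      (by rw [e 20 (by decide) (by decide), hj]) (by rw [e 48 (by decide) (by decide), hq]) hi
    have h5 := ht 5 L
    have h8 := ht 8 (y * I.n + L)
    rw [e 5 (by decide) (by decide)] at h5
    rw [e 8 (by decide) (by decide)] at h8
    have hlen := len_add (t 47 0) (s 5 L * s 8 (y * I.n + L))
    have hlen' := len_mul (s 5 L) (s 8 (y * I.n + L))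
    have hfin : len (t 47 0 + s 5 L * s 8 (y * I.n + L)) ≤
        6 * I.width + (L + 1) * (I.width + 20 * I.width ^ 2) := by
      simp [arrayBound] at h5 h8
      linarith
    refine Reaches.setVar I.hB ht (q := t 47 0 + s 5 L * s 8 (y * I.n + L)) ?_ ?_ ?_
    · rw [eval_add, eval_mul, eval_cell, eval_cell, hc, Nat.floor_natCast, eval_var, eval_var, hi,
        Nat.floor_natCast, e 5 (by decide) (by decide), e 8 (by decide) (by decide)]
    · refine hfin.trans ((hbig (L + 1) hL).trans (by simp [arrayBound]))
    · rw [write_same]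
      exact ⟨by rw [sum_range_succ, h1, add_assoc], by exact_mod_cast hfin⟩
  · rintro t - - ⟨h, -⟩
    rw [h, hS.sum_mul fun i => s 8 (y * I.n + i)]

theorem surrogateProg_spec (hs : I.Fits s) (hin : I.HasInput s) (hS : I.HasSet S s)
    (hP : s 30 0 = I.priceSum) {j : ℕ} (hj : s 20 0 = j) :
    I.Hoare surrogateProg s fun t => t 46 0 = I.surrogate I.rowCount
      (fun q => s 7 (j * I.rowCount + q)) (fun q i => s 8 ((j * I.rowCount + q) * I.n + i)) S := by
  have hw := I.five_le_width
  have h30 := hs 30 0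
  rw [hP] at h30
  refine Reaches.setVar_seq I.hB hs (q := I.priceSum) (by simp [hP]) ?_ fun hs1 => ?_
  · simp [arrayBound] at h30 ⊢
    nlinarith [pow_pos (by omega : 0 < I.width) 2]
  have hin1 := hin.write (a := 46) (by norm_num) 0 I.priceSum
  refine Reaches.forLoop I.hB hs1 (fun L t => t 46 0 = minUpTo I.priceSum
      (fun q => s 7 (j * I.rowCount + q) + ∑ i ∈ S, s 8 ((j * I.rowCount + q) * I.n + i)) L)
    I.rowCount I.rowCount_le (I.len_rowCount_le.trans (by simp [arrayBound])) rfl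
    (fun t ht => (hin1.frame ht (by decide)).eval_eQ)
    (fun i t t' ht h => by simpa only [ht 46 (by decide)] using h) (by simp [minUpTo]) ?_
  intro L hL t ht hf hq h
  have e : ∀ a, a ≠ 24 → a ≠ 46 → a ≠ 47 → a ≠ 48 → t a = s a := by
    intro a h1 h2 h3 h4
    rw [hf a (by simp [forLoop, Prog.writes, setVar, rowValueProg, h1, h2, h3, h4]), write_ne _ _ _ h2]
  have hS' : I.HasSet S t := by
    intro i; rw [e 5 (by decide) (by decide) (by decide) (by decide)]; exact hS i
  refine (rowValueProg_spec ht (hin1.frame hf (by decide)) hS' (j := j)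
    (by rw [e 20 (by decide) (by decide) (by decide) (by decide), hj]) hq).seq
    fun u hu hfu h47 => ?_
  rw [e 7 (by decide) (by decide) (by decide) (by decide),
    e 8 (by decide) (by decide) (by decide) (by decide)] at h47
  have h46 : u 46 0 = t 46 0 := by rw [hfu 46 rfl]
  refine Reaches.ite I.hB hu (fun hlt => ?_) fun hge => ?_
  · refine Reaches.setVar I.hB hu (eval_var _ _) (by simpa [arrayBound] using hu 47 0) ?_
    simp only [eval_var, h47, h46, h] at hlt
    rw [write_same, h47, minUpTo, min_eq_right hlt.le]
  · simp only [eval_var, h47, h46, h, not_lt] at hge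
    exact Reaches.skip hu (by rw [h46, h, minUpTo, min_eq_left hge])

theorem objectiveProg_spec (hs : I.Fits s) (hin : I.HasInput s) (hS : I.HasSet S s)
    (hP : s 30 0 = I.priceSum) :
    I.Hoare objectiveProg s fun t => t 45 0 = I.objective s S := by
  have hw := I.m_add_le_width
  have hbig : ∀ L ≤ I.m, 2 + L * (I.width + 20 * I.width ^ 3) ≤ 30 * I.width ^ 4 := by
    intro L hL
    have h2 : I.width ^ 2 ≤ I.width ^ 4 := Nat.pow_le_pow_right (by omega) (by norm_num)
    have h3 := Nat.mul_le_mul_right (I.width + 20 * I.width ^ 3) (show L + 5 ≤ I.width by omega)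
    have h4 : I.width * (I.width + 20 * I.width ^ 3) = I.width ^ 2 + 20 * I.width ^ 4 := by ring
    rw [Nat.add_mul] at h3
    omega
  set f : ℕ → ℚ := fun j => I.surrogate I.rowCount (fun q => s 7 (j * I.rowCount + q))
    (fun q i => s 8 ((j * I.rowCount + q) * I.n + i)) S with hf
  refine Reaches.setVar_seq I.hB hs (eval_const _ _) ?_ fun hs1 => ?_
  · have := hbig 0 (Nat.zero_le _)
    simp [arrayBound] at this ⊢
    omega
  have hin1 := hin.write (a := 45) (by norm_num) 0 0
  refine (Reaches.forLoop I.hB hs1 (fun L t => t 45 0 = ∑ j ∈ range L, s 2 j * f j ∧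
      len (t 45 0) ≤ 2 + L * (I.width + 20 * I.width ^ 3)) I.m
    ((by omega : I.m ≤ I.width).trans I.width_le)
    (I.len_m_le.trans (by simp [arrayBound])) rfl
    (fun t ht => (hin1.frame ht (by decide)).eval_eM)
    (fun i t t' ht h => by simpa only [ht 45 (by decide)] using h) (by simp) ?_).mono ?_
  · rintro L hL t ht hft hj ⟨h1, h2⟩
    have e : ∀ a, a ≠ 45 → (forLoop 20 eM (surrogateProg ;;
        setVar 45 (var 45 + .cell 2 (var 20) * var 46))).writes a = false → t a = s a := by
      intro a h1 h2
      rw [hft a h2, write_ne _ _ _ h1]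
    have hS' : I.HasSet S t := by
      intro i; rw [e 5 (by decide) rfl]; exact hS i
    refine (surrogateProg_spec ht (hin1.frame hft (by decide)) hS'
      (by rw [e 30 (by decide) rfl, hP]) hj).seq fun u hu hfu h46 => ?_
    rw [e 7 (by decide) rfl, e 8 (by decide) rfl] at h46
    have h46' : u 46 0 = f L := h46
    have h45 : u 45 = t 45 := hfu 45 rfl
    have h2' : u 2 = s 2 := by rw [hfu 2 rfl, e 2 (by decide) rfl]
    have hu20 : u 20 0 = L := by rw [hfu 20 rfl, hj]
    have l2 := hu 2 L
    have l46 := hu 46 0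
    rw [h2'] at l2
    rw [h46'] at l46
    have hlen := len_add (t 45 0) (s 2 L * f L)
    have hlen' := len_mul (s 2 L) (f L)
    have hfin : len (t 45 0 + s 2 L * f L) ≤ 2 + (L + 1) * (I.width + 20 * I.width ^ 3) := by
      simp [arrayBound] at l2 l46
      linarith
    refine Reaches.setVar I.hB hu (q := t 45 0 + s 2 L * f L) ?_ ?_ ?_
    · rw [eval_add, eval_mul, eval_cell, eval_var, eval_var, eval_var, hu20, Nat.floor_natCast,
        h46', h2', h45]
    · exact hfin.trans ((hbig (L + 1) hL).trans (by simp [arrayBound]))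
    · rw [write_same]
      exact ⟨by rw [sum_range_succ, h1], by exact_mod_cast hfin⟩
  · rintro t - - ⟨h, -⟩
    rw [h, sum_range, objective]
    exact sum_congr rfl fun j _ => by rw [hin.weight]

theorem HasSet.insert {t : Mem} (h : I.HasSet S t) (e : Fin I.n) :
    I.HasSet (insert e S) (t.write 5 e 1) := by
  intro i
  by_cases hi : i = e
  · subst hi; simp
  · have : (i : ℕ) ≠ e := fun h => hi (Fin.ext h)
    rw [write_ne_cell _ _ _ this, h i]
    simp [hi]

theorem candidateProg_spec (hs : I.Fits s) (hin : I.HasInput s) (hS : I.HasSet S s)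
    (hP : s 30 0 = I.priceSum) (e : Fin I.n) (he : s 41 0 = (e : ℕ)) :
    I.Hoare candidateProg s fun t => I.HasSet S t ∧
      ((s 43 0 < I.objective s (insert e S) ∧ t 43 0 = I.objective s (insert e S) ∧
        t 44 0 = (e : ℕ)) ∨
      (I.objective s (insert e S) ≤ s 43 0 ∧ t 43 0 = s 43 0 ∧ t 44 0 = s 44 0)) := by
  have hw := I.five_le_width
  refine Reaches.setVar_seq I.hB hs (q := s 5 e) (by simp [he])
    (by simpa [arrayBound] using hs 5 e) fun hs1 => ?_
  refine Reaches.set_seq I.hB hs1 (x := e) (by simp [Mem.write, he]) (eval_const _ _)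
    (by simp [arrayBound]; omega) fun hs2 => ?_
  have hin2 := (hin.write (a := 42) (by norm_num) 0 (s 5 e)).write (a := 5) (by norm_num) e 1
  have hS2 : I.HasSet (insert e S) ((s.write 42 0 (s 5 e)).write 5 e 1) :=
    HasSet.insert (fun i => by rw [write_ne _ _ _ (by decide)]; exact hS i) e
  refine (objectiveProg_spec hs2 hin2 hS2 (by simp [Mem.write, hP])).seq fun t ht hf h45 => ?_
  rw [objective_congr (s := s) (by simp [write_ne]) (by simp [write_ne])] at h45
  have h42 : t 42 0 = s 5 e := by rw [hf 42 rfl]; simp [Mem.write]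
  have h41 : t 41 0 = (e : ℕ) := by rw [hf 41 rfl]; simp [Mem.write, he]
  have h43 : t 43 0 = s 43 0 := by rw [hf 43 rfl]; simp [Mem.write]
  have h44 : t 44 0 = s 44 0 := by rw [hf 44 rfl]; simp [Mem.write]
  refine Reaches.set_seq I.hB ht (x := e) (q := s 5 e) (by simp [h41]) (by simp [h42])
    (by simpa [arrayBound] using hs 5 e) fun ht1 => ?_
  have hS3 : I.HasSet S (t.write 5 e (s 5 e)) := by
    intro i
    by_cases hi : i = e
    · subst hi; rw [write_same]; exact hS i
    · have : (i : ℕ) ≠ e := fun h => hi (Fin.ext h)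
      rw [write_ne_cell _ _ _ this, hf 5 rfl, write_ne_cell _ _ _ this, write_ne _ _ _ (by decide)]
      exact hS i
  refine Reaches.ite I.hB ht1 (fun hlt => ?_) fun hge => ?_
  · simp only [eval_var, write_ne _ _ _ (show 43 ≠ 5 by decide),
      write_ne _ _ _ (show 45 ≠ 5 by decide), h43, h45] at hlt
    refine Reaches.setVar_seq I.hB ht1 (q := t 45 0) (by simp [Mem.write])
      (by simpa [arrayBound] using ht 45 0) fun ht2 => ?_
    refine Reaches.setVar I.hB ht2 (q := t 41 0) (by simp [Mem.write])
      (by simpa [arrayBound] using ht 41 0) ⟨fun i => ?_, .inl ⟨hlt, ?_, ?_⟩⟩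
    · rw [write_ne _ _ _ (by decide), write_ne _ _ _ (by decide)]
      exact hS3 i
    · simp [Mem.write, h45]
    · simp [h41]
  · simp only [eval_var, write_ne _ _ _ (show 43 ≠ 5 by decide),
      write_ne _ _ _ (show 45 ≠ 5 by decide), h43, h45, not_lt] at hge
    exact Reaches.skip ht1 ⟨hS3, .inr ⟨hge, by rw [write_ne _ _ _ (by decide), h43],
      by rw [write_ne _ _ _ (by decide), h44]⟩⟩

theorem roundProg_spec (hs : I.Fits s) (hin : I.HasInput s) (hS : I.HasSet S s)
    (hP : s 30 0 = I.priceSum) (hn : 0 < I.n) (hpos : ∀ S, 0 ≤ I.objective s S) :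
    I.Hoare roundProg s fun t => ∃ b : Fin I.n, I.HasSet (insert b S) t ∧
      ∀ e, I.objective s (insert e S) ≤ I.objective s (insert b S) := by
  have hw := I.n_add_le_width
  have h4 : I.width ≤ I.width ^ 4 := Nat.le_self_pow (by norm_num) _
  refine Reaches.setVar_seq I.hB hs (eval_const _ _) (by simp [arrayBound]; omega) fun hs1 => ?_
  refine Reaches.setVar_seq I.hB hs1 (eval_const _ _) (by simp [arrayBound]; omega) fun hs2 => ?_
  have hin2 := (hin.write (a := 43) (by norm_num) 0 (-1)).write (a := 44) (by norm_num) 0 0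
  refine (Reaches.forLoop I.hB hs2 (fun L t => I.HasSet S t ∧
      (∀ e : Fin I.n, (e : ℕ) < L → I.objective s (insert e S) ≤ t 43 0) ∧
      ((L = 0 ∧ t 43 0 = -1) ∨
        ∃ b : Fin I.n, t 44 0 = (b : ℕ) ∧ t 43 0 = I.objective s (insert b S))) I.n
    ((by omega : I.n ≤ I.width).trans I.width_le)
    (I.len_n_le.trans (by simp [arrayBound])) rfl
    (fun t ht => (hin2.frame ht (by decide)).eval_eN)
    (fun i t t' ht h => by
      simpa only [HasSet, ht 43 (by decide), ht 44 (by decide), ht 5 (by decide)] using h)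
    ⟨fun i => ?_, fun e he => absurd he (Nat.not_lt_zero _), .inl ⟨rfl, by simp [Mem.write]⟩⟩
    ?_).seq ?_
  · rw [write_ne _ _ _ (by decide), write_ne _ _ _ (by decide)]
    exact hS i
  · rintro L hL t ht hf hL41 ⟨h1, h2, h3⟩
    have e : ∀ a, a ≠ 43 → a ≠ 44 → (forLoop 41 eN candidateProg).writes a = false →
        t a = s a := by
      intro a ha hb hc
      rw [hf a hc, write_ne _ _ _ hb, write_ne _ _ _ ha]
    refine (candidateProg_spec ht (hin2.frame hf (by decide)) h1
      (by rw [e 30 (by decide) (by decide) rfl, hP]) ⟨L, hL⟩ hL41).mono ?_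
    rintro u - - ⟨hu, hcase⟩
    rw [objective_congr (s := s) (e 7 (by decide) (by decide) rfl)
      (e 8 (by decide) (by decide) rfl)] at hcase
    refine ⟨hu, fun e he => ?_, ?_⟩
    · rcases Nat.lt_succ_iff_lt_or_eq.1 he with he | he
      · have := h2 e he
        rcases hcase with ⟨h4, h5, -⟩ | ⟨-, h5, -⟩ <;> rw [h5] <;> linarith
      · obtain rfl : e = ⟨L, hL⟩ := Fin.ext he
        rcases hcase with ⟨h4, h5, -⟩ | ⟨h4, h5, -⟩ <;> rw [h5]
        exact h4
    · rcases hcase with ⟨h4, h5, h6⟩ | ⟨h4, h5, h6⟩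
      · exact .inr ⟨⟨L, hL⟩, h6, h5⟩
      · rcases h3 with ⟨-, h3⟩ | ⟨b, h3, h3'⟩
        -- The sentinel `-1` lies below every objective value, so the first candidate is always
        -- accepted.
        · linarith [hpos (insert ⟨L, hL⟩ S)]
        · exact .inr ⟨b, h6.trans h3, h5.trans h3'⟩
  · rintro t ht - ⟨h1, h2, h3⟩
    rcases h3 with ⟨h3, -⟩ | ⟨b, h3, h3'⟩
    · omega
    · exact Reaches.set I.hB ht (x := b) (by simp [h3]) (eval_const _ _)
        (by simp [arrayBound]; omega) ⟨b, h1.insert b, fun e => h3' ▸ h2 e e.2⟩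

theorem greedyProg_spec (hs : I.Fits s) (hin : I.HasInput s) (hS : I.HasSet ∅ s)
    (hP : s 30 0 = I.priceSum) (hpos : ∀ S, 0 ≤ I.objective s S)
    (hmono : ∀ A B, A ⊆ B → I.objective s A ≤ I.objective s B)
    (hsub : ∀ A B e, A ⊆ B → I.objective s (insert e B) - I.objective s B ≤
      I.objective s (insert e A) - I.objective s A) :
    I.Hoare greedyProg s fun t => ∃ S, I.HasSet S t ∧
      GreedyInv (I.objective s) (min I.n I.k) S := by
  have hw := I.n_add_le_width
  refine Reaches.forLoop I.hB hs (fun L t => ∃ S, I.HasSet S t ∧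
      GreedyInv (I.objective s) (min L I.k) S) I.n
    ((by omega : I.n ≤ I.width).trans I.width_le)
    (I.len_n_le.trans (by simp [arrayBound])) rfl
    (fun t ht => (hin.frame ht (by decide)).eval_eN)
    (fun i t t' ht h => by simpa only [HasSet, ht 5 (by decide)] using h)
    ⟨∅, hS, by simpa using GreedyInv.empty hpos hmono⟩ ?_
  rintro L hL t ht hf hL40 ⟨S, h1, h2⟩
  have hin' : I.HasInput t := hin.frame hf (by decide)
  have hobj : I.objective t = I.objective s := objective_congr (hf 7 rfl) (hf 8 rfl)
  refine Reaches.ite I.hB ht (fun hlt => ?_) fun hge => ?_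
  · rw [eval_var, hL40, hin'.eval_eK, Nat.cast_lt] at hlt
    refine (roundProg_spec ht hin' h1 (by rw [hf 30 rfl, hP]) (by omega)
      (by rw [hobj]; exact hpos)).mono ?_
    rintro u - - ⟨b, hb, hbest⟩
    rw [hobj] at hbest
    rw [min_eq_left hlt.le] at h2
    exact ⟨_, hb, by rw [min_eq_left hlt]; exact h2.step hmono hsub hbest⟩
  · rw [eval_var, hL40, hin'.eval_eK, Nat.cast_lt, not_lt] at hge
    rw [min_eq_right hge] at h2
    exact Reaches.skip ht ⟨S, h1, by rw [min_eq_right (by omega)]; exact h2⟩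

end Instance
-- Choosing the best row for every type and writing the output
def rateProg : Prog :=
  setVar 50 (.const 0) ;; setVar 51 (.const 0) ;;
  forLoop 24 eN (setVar 50 (var 50 + .cell 5 (var 24) * .cell 10 (eCell 48)) ;;
    setVar 51 (var 51 + .cell 5 (var 24) * .cell 11 (eCell 48))) ;;
  setVar 54 (var 51 / (.cell 3 (var 20) + var 50))

def bestRowProg : Prog :=
  setVar 52 (.const (-1)) ;; setVar 53 (.const 0) ;;
  forLoop 48 eQ (rateProg ;;
    .ite (var 52) (var 54) (setVar 52 (var 54) ;; setVar 53 (var 48)) .skip)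

def writeProg : Prog :=
  forLoop 24 eN (.assign 6 (var 20 * eN + var 24) (.cell 5 (var 24) * .cell 9 (eCell 53)))

def outputProg : Prog := forLoop 20 eM (bestRowProg ;; writeProg)

/-- The approximation algorithm. -/
def approxProg : Prog := priceSumProg ;; tableProg ;; greedyProg ;; outputProg

namespace Instance

variable (I : Instance)

/-- The revenue from type `j` that row `q` of the tables yields inside `S`. -/
def rate (s : Mem) (S : Finset (Fin I.n)) (j : Fin I.m) (q : ℕ) : ℚ :=
  (∑ i ∈ S, s 11 ((j * I.rowCount + q) * I.n + i)) /
    (I.v₀ j + ∑ i ∈ S, s 10 ((j * I.rowCount + q) * I.n + i))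

variable {I} {s : Mem} {S : Finset (Fin I.n)}

theorem rateProg_spec (hs : I.Fits s) (hin : I.HasInput s) (hS : I.HasSet S s) (j : Fin I.m)
    {q : ℕ} (hj : s 20 0 = (j : ℕ)) (hq : s 48 0 = q) :
    I.Hoare rateProg s fun t => t 54 0 = I.rate s S j q := by
  have hw := I.n_add_le_width
  set y := (j : ℕ) * I.rowCount + q with hy
  have hbig : ∀ L ≤ I.n, 2 + L * (2 * I.width) ≤ 10 * I.width ^ 2 ∧
      2 + L * (I.width + 20 * I.width ^ 2) ≤ 20 * I.width ^ 3 := by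
    intro L hL
    obtain ⟨k, hk⟩ : ∃ k, I.width = k + 5 := ⟨I.width - 5, by omega⟩
    have h1 : L * (I.width + 20 * I.width ^ 2) ≤ k * (I.width + 20 * I.width ^ 2) :=
      Nat.mul_le_mul_right _ (by omega)
    have h2 : 2 + k * (I.width + 20 * I.width ^ 2) ≤ 20 * I.width ^ 3 := by
      rw [hk]
      nlinarith
    have h3 : L * (2 * I.width) ≤ k * (2 * I.width) := Nat.mul_le_mul_right _ (by omega)
    have h4 : 2 + k * (2 * I.width) ≤ 10 * I.width ^ 2 := by
      rw [hk]
      nlinarith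
    omega
  have hbig0 := hbig 0 (Nat.zero_le _)
  rw [zero_mul, zero_mul] at hbig0
  refine Reaches.setVar_seq I.hB hs (eval_const _ _) (by simp [arrayBound]; omega) fun hs1 => ?_
  refine Reaches.setVar_seq I.hB hs1 (eval_const _ _) (by simp [arrayBound]; omega) fun hs2 => ?_
  have hin2 := (hin.write (a := 50) (by norm_num) 0 0).write (a := 51) (by norm_num) 0 0
  refine (Reaches.forLoop I.hB hs2 (fun L t =>
      (t 50 0 = ∑ i ∈ range L, s 5 i * s 10 (y * I.n + i) ∧
        len (t 50 0) ≤ 2 + L * (2 * I.width)) ∧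
      (t 51 0 = ∑ i ∈ range L, s 5 i * s 11 (y * I.n + i) ∧
        len (t 51 0) ≤ 2 + L * (I.width + 20 * I.width ^ 2))) I.n
    ((by omega : I.n ≤ I.width).trans I.width_le)
    (I.len_n_le.trans (by simp [arrayBound])) rfl
    (fun t ht => (hin2.frame ht (by decide)).eval_eN)
    (fun i t t' ht h => by simpa only [ht 50 (by decide), ht 51 (by decide)] using h)
    (by simp [Mem.write]) ?_).seq ?_
  · rintro L hL t ht hf hi ⟨⟨h1, h2⟩, h3, h4⟩
    have e : ∀ a, a ≠ 24 → a ≠ 50 → a ≠ 51 → t a = s a := by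
      intro a h1 h2 h3
      rw [hf a (by simp [forLoop, Prog.writes, setVar, h1, h2, h3]), write_ne _ _ _ h3,
        write_ne _ _ _ h2]
    have h20 : t 20 0 = (j : ℕ) := by rw [e 20 (by decide) (by decide) (by decide), hj]
    have h48 : t 48 0 = q := by rw [e 48 (by decide) (by decide) (by decide), hq]
    have hint : I.HasInput t := hin2.frame hf (by decide)
    have hc := hint.eval_eCell (a := 48) h20 h48 hi
    have e5 := e 5 (by decide) (by decide) (by decide)
    have e10 := e 10 (by decide) (by decide) (by decide)
    have e11 := e 11 (by decide) (by decide) (by decide)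
    have l5 := hs 5 L
    have l10 := hs 10 (y * I.n + L)
    have l11 := hs 11 (y * I.n + L)
    simp [arrayBound] at l5 l10 l11
    have m10 := len_mul (s 5 L) (s 10 (y * I.n + L))
    have m11 := len_mul (s 5 L) (s 11 (y * I.n + L))
    have a10 := len_add (t 50 0) (s 5 L * s 10 (y * I.n + L))
    have a11 := len_add (t 51 0) (s 5 L * s 11 (y * I.n + L))
    have f10 : len (t 50 0 + s 5 L * s 10 (y * I.n + L)) ≤ 2 + (L + 1) * (2 * I.width) := by
      linarith
    have f11 : len (t 51 0 + s 5 L * s 11 (y * I.n + L)) ≤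
        2 + (L + 1) * (I.width + 20 * I.width ^ 2) := by linarith
    refine Reaches.setVar_seq I.hB ht (q := t 50 0 + s 5 L * s 10 (y * I.n + L)) ?_
      (f10.trans ((hbig (L + 1) hL).1.trans (by simp [arrayBound]))) fun ht1 => ?_
    · rw [eval_add, eval_mul, eval_cell, eval_cell, hc, Nat.floor_natCast, eval_var, eval_var, hi,
        Nat.floor_natCast, e5, e10]
    have hc1 := (hint.write (a := 50) (by norm_num) 0
      (t 50 0 + s 5 L * s 10 (y * I.n + L))).eval_eCell (a := 48) (j := j) (q := q) (i := L)
      (by rw [write_ne _ _ _ (by decide), h20]) (by rw [write_ne _ _ _ (by decide), h48])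
      (by rw [write_ne _ _ _ (by decide), hi])
    refine Reaches.setVar I.hB ht1 (q := t 51 0 + s 5 L * s 11 (y * I.n + L)) ?_
      (f11.trans ((hbig (L + 1) hL).2.trans (by simp [arrayBound]))) ?_
    · rw [eval_add, eval_mul, eval_cell, eval_cell, hc1, Nat.floor_natCast, eval_var, eval_var,
        write_ne _ _ _ (by decide), write_ne _ _ _ (by decide), write_ne _ _ _ (by decide),
        write_ne _ _ _ (by decide), hi, Nat.floor_natCast, e5, e11]
    · rw [write_same, write_ne _ _ _ (by decide), write_same, sum_range_succ, sum_range_succ,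
        h1, h3]
      rw [h1] at f10
      rw [h3] at f11
      exact ⟨⟨rfl, by exact_mod_cast f10⟩, rfl, by exact_mod_cast f11⟩
  · rintro t ht hf ⟨⟨h1, -⟩, h3, -⟩
    rw [hS.sum_mul fun i => s 10 (y * I.n + i)] at h1
    rw [hS.sum_mul fun i => s 11 (y * I.n + i)] at h3
    have h0 : (Expr.cell 3 (var 20)).eval t = I.v₀ j := by
      have h20 : t 20 0 = (j : ℕ) := by
        rw [hf 20 rfl, write_ne _ _ _ (by decide), write_ne _ _ _ (by decide), hj]
      rw [eval_cell, eval_var, h20, Nat.floor_natCast, (hin2.frame hf (by decide)).v₀]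
    refine Reaches.setVar I.hB ht (q := I.rate s S j q) ?_ ?_ (write_same _ _ _ _)
    · rw [eval_div, eval_add, h0, eval_var, eval_var, h1, h3, rate]
    · have l := ht.len_eval (var 51 / (.cell 3 (var 20) + var 50))
      rw [eval_div, eval_add, h0, eval_var, eval_var, h1, h3] at l
      refine l.trans ?_
      have p1 : I.width ≤ I.width ^ 3 := Nat.le_self_pow (by norm_num) _
      have p2 : I.width ^ 3 * 5 ≤ I.width ^ 3 * I.width := Nat.mul_le_mul_left _ (by omega)
      have p3 : I.width ^ 2 ≤ I.width ^ 3 := Nat.pow_le_pow_right (by omega) (by norm_num)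
      have p4 : I.width ^ 3 * I.width = I.width ^ 4 := by ring
      simp [weight_div, weight_add, weight_var, weight_cell, arrayBound]
      omega

theorem rate_congr {t : Mem} (h10 : t 10 = s 10) (h11 : t 11 = s 11) (j : Fin I.m) :
    I.rate t S j = I.rate s S j := by
  funext q
  unfold rate
  rw [h10, h11]

theorem bestRowProg_spec (hs : I.Fits s) (hin : I.HasInput s) (hS : I.HasSet S s) (j : Fin I.m)
    (hj : s 20 0 = (j : ℕ)) (hpos : ∀ q < I.rowCount, 0 ≤ I.rate s S j q) :
    I.Hoare bestRowProg s fun t => ∃ b : ℕ, t 53 0 = b ∧ (0 < I.rowCount → b < I.rowCount) ∧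
      ∀ q < I.rowCount, I.rate s S j q ≤ I.rate s S j b := by
  have hw := I.five_le_width
  have h4 : I.width ≤ I.width ^ 4 := Nat.le_self_pow (by norm_num) _
  refine Reaches.setVar_seq I.hB hs (eval_const _ _) (by simp [arrayBound]; omega) fun hs1 => ?_
  refine Reaches.setVar_seq I.hB hs1 (eval_const _ _) (by simp [arrayBound]; omega) fun hs2 => ?_
  have hin2 := (hin.write (a := 52) (by norm_num) 0 (-1)).write (a := 53) (by norm_num) 0 0
  refine (Reaches.forLoop I.hB hs2 (fun L t =>
      (∀ q < L, I.rate s S j q ≤ t 52 0) ∧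
      ((L = 0 ∧ t 52 0 = -1 ∧ t 53 0 = 0) ∨
        ∃ b < L, t 53 0 = (b : ℕ) ∧ t 52 0 = I.rate s S j b)) I.rowCount
    I.rowCount_le (I.len_rowCount_le.trans (by simp [arrayBound])) rfl
    (fun t ht => (hin2.frame ht (by decide)).eval_eQ)
    (fun i t t' ht h => by simpa only [ht 52 (by decide), ht 53 (by decide)] using h)
    ⟨fun e he => absurd he (Nat.not_lt_zero _), .inl ⟨rfl, by simp [Mem.write], by simp⟩⟩
    ?_).mono ?_
  · rintro L hL t ht hf h48 ⟨h2, h3⟩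
    have e : ∀ a, a ≠ 52 → a ≠ 53 → (forLoop 48 eQ (rateProg ;;
        .ite (var 52) (var 54) (setVar 52 (var 54) ;; setVar 53 (var 48)) .skip)).writes a = false →
        t a = s a := by
      intro a ha hb hc
      rw [hf a hc, write_ne _ _ _ hb, write_ne _ _ _ ha]
    have hS' : I.HasSet S t := by
      intro i; rw [e 5 (by decide) (by decide) rfl]; exact hS i
    refine (rateProg_spec ht (hin2.frame hf (by decide)) hS' j
      (by rw [e 20 (by decide) (by decide) rfl, hj]) h48).seq fun u hu hfu h54 => ?_
    rw [rate_congr (s := s) (e 10 (by decide) (by decide) rfl)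
      (e 11 (by decide) (by decide) rfl)] at h54
    have h52 : u 52 0 = t 52 0 := by rw [hfu 52 rfl]
    have h53 : u 53 0 = t 53 0 := by rw [hfu 53 rfl]
    have h48' : u 48 0 = L := by rw [hfu 48 rfl, h48]
    refine Reaches.ite I.hB hu (fun hlt => ?_) fun hge => ?_
    · rw [eval_var, eval_var, h52, h54] at hlt
      refine Reaches.setVar_seq I.hB hu (q := I.rate s S j L) (by rw [eval_var, h54]) ?_
        fun hu1 => ?_
      · have := hu 54 0
        rw [h54] at this
        simpa [arrayBound] using this
      refine Reaches.setVar I.hB hu1 (q := (L : ℕ)) (by simp [Mem.write, h48']) ?_ ⟨?_, ?_⟩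
      · exact (len_natCast_mono hL.le).trans (I.len_rowCount_le.trans (by simp [arrayBound]))
      · intro q hq
        rw [write_ne _ _ _ (by decide), write_same]
        rcases Nat.lt_succ_iff_lt_or_eq.1 hq with hq | rfl
        · exact (h2 q hq).trans hlt.le
        · exact le_rfl
      · exact .inr ⟨L, by omega, write_same _ _ _ _,
          by rw [write_ne _ _ _ (by decide), write_same]⟩
    · rw [eval_var, eval_var, h52, h54, not_lt] at hge
      refine Reaches.skip hu ⟨?_, ?_⟩
      · intro q hq
        rw [h52]
        rcases Nat.lt_succ_iff_lt_or_eq.1 hq with hq | rfl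
        · exact h2 q hq
        · exact hge
      · rw [h52, h53]
        rcases h3 with ⟨-, h3, -⟩ | ⟨b, hb, h3⟩
        · linarith [hpos L hL]
        · exact .inr ⟨b, by omega, h3⟩
  · rintro t - - ⟨h2, h3⟩
    rcases h3 with ⟨h0, -, h3⟩ | ⟨b, hb, h3, h3'⟩
    -- Without rows (`n = 0`) the index `0` is a dummy.
    · exact ⟨0, by simpa using h3, fun h => by omega, fun q hq => by omega⟩
    · exact ⟨b, h3, fun _ => hb, fun q hq => h3' ▸ h2 q hq⟩

theorem writeProg_spec (hs : I.Fits s) (hin : I.HasInput s) {j b : ℕ} (hj : s 20 0 = j)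
    (hb : s 53 0 = b) :
    I.Hoare writeProg s fun t => (∀ i < I.n, t 6 (j * I.n + i) =
      s 5 i * s 9 ((j * I.rowCount + b) * I.n + i)) ∧ ∀ y < j * I.n, t 6 y = s 6 y := by
  have hw := I.n_add_le_width
  refine Reaches.forLoop I.hB hs (fun L t => (∀ i < L, t 6 (j * I.n + i) =
      s 5 i * s 9 ((j * I.rowCount + b) * I.n + i)) ∧ ∀ y < j * I.n, t 6 y = s 6 y) I.n
    ((by omega : I.n ≤ I.width).trans I.width_le)
    (I.len_n_le.trans (by simp [arrayBound])) rfl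
    (fun t ht => (hin.frame ht (by decide)).eval_eN)
    (fun i t t' ht h => by simpa only [ht 6 (by decide)] using h)
    ⟨fun e he => absurd he (Nat.not_lt_zero _), fun _ _ => rfl⟩ ?_
  rintro L hL t ht hf hi ⟨h1, h2⟩
  have hint : I.HasInput t := hin.frame hf (by decide)
  have h20 : t 20 0 = j := by rw [hf 20 rfl, hj]
  have hc := hint.eval_eCell (a := 53) h20 (by rw [hf 53 rfl, hb]) hi
  have l5 := hs 5 L
  have l9 := hs 9 ((j * I.rowCount + b) * I.n + L)
  have hl := len_mul (s 5 L) (s 9 ((j * I.rowCount + b) * I.n + L))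
  refine Reaches.set I.hB ht (x := j * I.n + L)
    (q := s 5 L * s 9 ((j * I.rowCount + b) * I.n + L)) (by simp [h20, hint.eval_eN, hi]) ?_ ?_
    ⟨fun i hi => ?_, fun y hy => ?_⟩
  · rw [eval_mul, eval_cell, eval_cell, hc, Nat.floor_natCast, eval_var, hi, Nat.floor_natCast,
      hf 5 rfl, hf 9 rfl]
  · simp [arrayBound] at l5 l9 ⊢
    omega
  · rcases Nat.lt_succ_iff_lt_or_eq.1 hi with hi | rfl
    · rw [write_ne_cell _ _ _ (by omega), h1 i hi]
    · rw [write_same]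
  · rw [write_ne_cell _ _ _ (by omega), h2 y hy]

theorem outputProg_spec (hs : I.Fits s) (hin : I.HasInput s) (hS : I.HasSet S s)
    (hpos : ∀ j, ∀ q < I.rowCount, 0 ≤ I.rate s S j q) :
    I.Hoare outputProg s fun t => I.HasSet S t ∧ ∀ j : Fin I.m, ∃ b : ℕ,
      (0 < I.rowCount → b < I.rowCount) ∧
      (∀ q < I.rowCount, I.rate s S j q ≤ I.rate s S j b) ∧
      ∀ i < I.n, t 6 (j * I.n + i) = s 5 i * s 9 ((j * I.rowCount + b) * I.n + i) := by
  have hw := I.m_add_le_width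
  refine (Reaches.forLoop I.hB hs (fun J t => ∀ j : Fin I.m, (j : ℕ) < J → ∃ b : ℕ,
      (0 < I.rowCount → b < I.rowCount) ∧
      (∀ q < I.rowCount, I.rate s S j q ≤ I.rate s S j b) ∧
      ∀ i < I.n, t 6 (j * I.n + i) = s 5 i * s 9 ((j * I.rowCount + b) * I.n + i)) I.m
    ((by omega : I.m ≤ I.width).trans I.width_le)
    (I.len_m_le.trans (by simp [arrayBound])) rfl
    (fun t ht => (hin.frame ht (by decide)).eval_eM)
    (fun i t t' ht h => by simpa only [ht 6 (by decide)] using h)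
    (fun e he => absurd he (Nat.not_lt_zero _)) ?_).mono
    fun t _ hf h => ⟨fun i => by rw [hf 5 rfl]; exact hS i, fun j => h j j.2⟩
  intro J hJ t ht hf hJ20 h
  have hint : I.HasInput t := hin.frame hf (by decide)
  have hrate := rate_congr (S := S) (hf 10 rfl) (hf 11 rfl) ⟨J, hJ⟩
  refine (bestRowProg_spec ht hint (S := S) (fun i => by rw [hf 5 rfl]; exact hS i) ⟨J, hJ⟩ hJ20
    (by rw [hrate]; exact hpos _)).seq ?_
  rintro u hu hfu ⟨b, hb, hbQ, hbmax⟩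
  rw [hrate] at hbmax
  refine (writeProg_spec hu (hint.frame hfu (by decide)) (by rw [hfu 20 rfl, hJ20]) hb).mono ?_
  rintro w - - ⟨h1, h2⟩ j hj
  rw [hfu 5 rfl, hfu 9 rfl, hf 5 rfl, hf 9 rfl] at h1
  rcases Nat.lt_succ_iff_lt_or_eq.1 hj with hj | hj
  · obtain ⟨b', hb', hmax', hout⟩ := h j hj
    refine ⟨b', hb', hmax', fun i hi => ?_⟩
    have : ((j : ℕ) + 1) * I.n ≤ J * I.n := Nat.mul_le_mul_right _ hj
    rw [Nat.succ_mul] at this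
    rw [h2 _ (by omega), hfu 6 rfl]
    exact hout i hi
  · obtain rfl : j = ⟨J, hJ⟩ := Fin.ext hj
    exact ⟨b, hbQ, hbmax, h1⟩

/-! ### From the tables in memory to the surrogate -/

variable (I) in
/-- The price index that an entry of array `9` stands for. -/
noncomputable def decode (x : ℚ) : Option (Fin I.r) :=
  open Classical in if h : ∃ k : Fin I.r, x = ((k : ℕ) : ℚ) + 1 then some h.choose else none

theorem decode_zero : I.decode 0 = none := by
  refine dif_neg fun ⟨k, hk⟩ => ?_
  have : (0 : ℚ) < ((k : ℕ) : ℚ) + 1 := by positivity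
  linarith

theorem decode_succ (k : Fin I.r) : I.decode (((k : ℕ) : ℚ) + 1) = some k := by
  have h : ∃ k' : Fin I.r, (((k : ℕ) : ℚ) + 1) = ((k' : ℕ) : ℚ) + 1 := ⟨k, rfl⟩
  rw [decode, dif_pos h]
  have := h.choose_spec
  rw [add_left_inj, Nat.cast_inj] at this
  rw [← Fin.ext this]

variable (I) in
/-- The best lines that the tables describe. -/
noncomputable def lines (s : Mem) (j : Fin I.m) (q : ℕ) (i : Fin I.n) : Option (Fin I.r) :=
  I.decode (s 9 ((j * I.rowCount + q) * I.n + i))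

/-- The rows of one type form a contiguous block of `rowCount` rows, which allows them to be
addressed by a single index `q`. -/
theorem rowIndex_eq (j i l l' : ℕ) :
    I.rowIndex j i l l' = j * I.rowCount + ((i * I.r + l) * (I.r + 1) + l') := by
  simp only [rowIndex, rowCount]
  ring

theorem mul_add_lt {a b n i : ℕ} (ha : a < b) (hi : i < n) : a * n + i < b * n := by
  have := Nat.mul_le_mul_right n (Nat.succ_le_of_lt ha)
  rw [Nat.succ_mul] at this
  omega

theorem RowsBelow.rowAt (h : I.RowsBelow (I.rowIndex I.m 0 0 0) s) (j : Fin I.m) (i : Fin I.n)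
    (l : Fin I.r) {l' : ℕ} (hl' : l' < I.r + 1) : I.RowAt j i l l' s :=
  h j i l l' hl' (mul_add_lt (mul_add_lt (mul_add_lt j.2 i.2) l.2) hl')

theorem exists_rowIndex {q : ℕ} (hq : q < I.rowCount) (j : ℕ) :
    ∃ (i : Fin I.n) (l : Fin I.r), ∃ l' < I.r + 1, j * I.rowCount + q = I.rowIndex j i l l' := by
  have h1 : q / (I.r + 1) < I.n * I.r := by
    rw [Nat.div_lt_iff_lt_mul (Nat.succ_pos _)]
    exact hq
  have h2 : q / (I.r + 1) / I.r < I.n := by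
    rwa [Nat.div_lt_iff_lt_mul I.r_pos]
  refine ⟨⟨_, h2⟩, ⟨q / (I.r + 1) % I.r, Nat.mod_lt _ I.r_pos⟩, q % (I.r + 1),
    Nat.mod_lt _ (Nat.succ_pos _), ?_⟩
  rw [rowIndex_eq]
  simp only [Nat.div_add_mod']

theorem RowsBelow.entryAt (h : I.RowsBelow (I.rowIndex I.m 0 0 0) s) (j : Fin I.m) {q : ℕ}
    (hq : q < I.rowCount) (e : Fin I.n) : I.EntryAt j e (s 7 (j * I.rowCount + q)) s
      ((j * I.rowCount + q) * I.n + e) := by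
  obtain ⟨i, l, l', hl', hx⟩ := exists_rowIndex hq j
  rw [hx]
  exact (h.rowAt j i l hl').2.2.2 e

/-- The bridge from the machine to the analysis: the memory contents satisfy the hypotheses under
which the surrogate was studied. -/
theorem RowsBelow.table (h : I.RowsBelow (I.rowIndex I.m 0 0 0) s) (j : Fin I.m) :
    I.Table j I.rowCount (fun q => s 7 (j * I.rowCount + q))
      (fun q i => s 8 ((j * I.rowCount + q) * I.n + i)) (I.lines s j) where
  z_nonneg q hq := by
    obtain ⟨i, l, l', hl', hx⟩ := exists_rowIndex hq j
    simp only [hx]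
    exact (h.rowAt j i l hl').1
  crossing i l l' := by
    refine ⟨(i * I.r + l) * (I.r + 1) + l',
      mul_add_lt (mul_add_lt i.2 l.2) (l'.2.trans (Nat.lt_succ_self _)), ?_⟩
    rw [← rowIndex_eq]
    exact (h.rowAt j i l (l'.2.trans (Nat.lt_succ_self _))).2.1 l'.2
  root i l := by
    refine ⟨(i * I.r + l) * (I.r + 1) + I.r,
      mul_add_lt (mul_add_lt i.2 l.2) (Nat.lt_succ_self _), ?_⟩
    rw [← rowIndex_eq]
    exact (h.rowAt j i l (Nat.lt_succ_self _)).2.2.1 rfl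
  none q hq i hi := by
    rcases h.entryAt j hq i with ⟨-, -, -, h2, h3⟩ | ⟨k, h1, -⟩
    · exact ⟨h2, h3⟩
    · rw [lines, h1, decode_succ] at hi
      cases hi
  some q hq i k hi := by
    rcases h.entryAt j hq i with ⟨h1, -⟩ | ⟨k', h1, -, -, h2⟩
    · rw [lines, h1, decode_zero] at hi
      cases hi
    · rw [lines, h1, decode_succ] at hi
      cases hi
      exact h2

theorem RowsBelow.rate_eq (h : I.RowsBelow (I.rowIndex I.m 0 0 0) s) (j : Fin I.m) {q : ℕ}
    (hq : q < I.rowCount) (S : Finset (Fin I.n)) : I.rate s S j q =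
      I.revenue j (I.lineAssortment S (I.lines s j q)) (I.linePrices (I.lines s j q)) := by
  rw [revenue_eq, rate, lineAssortment, sum_filter, sum_filter]
  have h10 : ∀ i : Fin I.n, s 10 ((j * I.rowCount + q) * I.n + i) =
      if (I.lines s j q i).isSome then I.v j i (I.linePrices (I.lines s j q) i) else 0 := by
    intro i
    rcases h.entryAt j hq i with ⟨h1, h2, -⟩ | ⟨k, h1, h2, -⟩
    · rw [h2, lines, h1, decode_zero]
      rfl
    · rw [h2, linePrices, lines, h1, decode_succ]
      rfl
  have h11 : ∀ i : Fin I.n, s 11 ((j * I.rowCount + q) * I.n + i) =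
      if (I.lines s j q i).isSome then I.v j i (I.linePrices (I.lines s j q) i) *
        I.price (I.linePrices (I.lines s j q) i) else 0 := by
    intro i
    rcases h.entryAt j hq i with ⟨h1, -, h2, -⟩ | ⟨k, h1, -, h2, -⟩
    · rw [h2, lines, h1, decode_zero]
      rfl
    · rw [h2, linePrices, lines, h1, decode_succ]
      rfl
  simp only [h10, h11]

section Objective

variable (h : I.RowsBelow (I.rowIndex I.m 0 0 0) s)
include h

theorem RowsBelow.objective_nonneg (S : Finset (Fin I.n)) : 0 ≤ I.objective s S :=
  sum_nonneg fun j _ => mul_nonneg (I.weight_nonneg j) ((h.table j).surrogate_nonneg S)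

theorem RowsBelow.objective_mono (A B : Finset (Fin I.n)) (hAB : A ⊆ B) :
    I.objective s A ≤ I.objective s B :=
  sum_le_sum fun j _ =>
    mul_le_mul_of_nonneg_left ((h.table j).surrogate_mono hAB) (I.weight_nonneg j)

theorem RowsBelow.objective_submodular (A B : Finset (Fin I.n)) (e : Fin I.n) (hAB : A ⊆ B) :
    I.objective s (insert e B) - I.objective s B ≤
      I.objective s (insert e A) - I.objective s A := by
  unfold objective
  rw [← sum_sub_distrib, ← sum_sub_distrib]
  refine sum_le_sum fun j _ => ?_
  rw [← mul_sub, ← mul_sub]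
  exact mul_le_mul_of_nonneg_left ((h.table j).surrogate_submodular hAB e) (I.weight_nonneg j)

theorem RowsBelow.weighted_bestRevenue_le (O : Finset (Fin I.n)) :
    ∑ j, (I.weight j : ℝ) * I.bestRevenue j O ≤ (I.objective s O : ℝ) := by
  unfold objective
  push_cast
  refine sum_le_sum fun j _ => mul_le_mul_of_nonneg_left ?_ (by exact_mod_cast I.weight_nonneg j)
  have : Nonempty ({X : Finset (Fin I.n) // X ⊆ O} × (Fin I.n → Fin I.r)) :=
    ⟨⟨⟨∅, empty_subset _⟩, fun _ => ⟨0, I.r_pos⟩⟩⟩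
  refine ciSup_le fun c => ?_
  exact_mod_cast (h.table j).revenue_le_surrogate c.1.2 c.2

end Objective

/-! ### The approximation guarantee -/

theorem opt_le {c : ℝ}
    (h : ∀ O : Finset (Fin I.n), O.card ≤ I.k → ∑ j, (I.weight j : ℝ) * I.bestRevenue j O ≤ c) :
    I.opt ≤ c := by
  have : Nonempty {S : Finset (Fin I.n) // S.card ≤ I.k} := ⟨⟨∅, by simp⟩⟩
  exact ciSup_le fun O => h O.1 O.2

theorem approxProg_spec (I : Instance) : I.Hoare approxProg I.input fun t =>
    ∃ P : Solution I, P.IsOutput t ∧ P.Feasible ∧ (1 / 4 : ℝ) * I.opt ≤ (P.value : ℝ) := by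
  have hin : I.HasInput I.input := fun _ _ => rfl
  refine (priceSumProg_spec I.bounded_arrayBound_input hin).seq fun s1 hs1 hf1 hP => ?_
  have hin1 : I.HasInput s1 := hin.frame hf1 (by decide)
  refine (tableProg_spec hs1 hin1 hP).seq fun s2 hs2 hf2 hrows => ?_
  have hin2 : I.HasInput s2 := hin1.frame hf2 (by decide)
  refine (greedyProg_spec hs2 hin2 (fun i => ?_) (by rw [hf2 30 rfl, hP]) hrows.objective_nonneg
    hrows.objective_mono hrows.objective_submodular).seq ?_
  · rw [hf2 5 rfl, hf1 5 rfl]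
    simp [input]
  rintro s3 hs3 hf3 ⟨S, hS, hgreedy⟩
  have hin3 : I.HasInput s3 := hin2.frame hf3 (by decide)
  have hrows3 : I.RowsBelow (I.rowIndex I.m 0 0 0) s3 :=
    hrows.congr fun a ha => hf3 a (by
      simp only [List.mem_cons, List.not_mem_nil, or_false] at ha
      rcases ha with rfl | rfl | rfl | rfl | rfl <;> rfl)
  rw [← objective_congr (hf3 7 rfl) (hf3 8 rfl)] at hgreedy
  refine (outputProg_spec hs3 hin3 hS fun j q hq => ?_).mono ?_
  · rw [hrows3.rate_eq j hq]
    exact I.revenue_nonneg _ _ _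
  rintro t - - ⟨hSt, hout⟩
  choose b hbQ hbmax hb using hout
  let P : Solution I :=
    { selection := S
      offered := fun j => I.lineAssortment S (I.lines s3 j (b j))
      prices := fun j => I.linePrices (I.lines s3 j (b j)) }
  have hvalue : 0 ≤ P.value :=
    sum_nonneg fun j _ => mul_nonneg (I.weight_nonneg j) (I.revenue_nonneg _ _ _)
  refine ⟨P, ⟨hSt, fun j i => ?_⟩, ⟨hgreedy.1.trans (min_le_right _ _), fun j =>
    filter_subset _ _⟩, ?_⟩
  · have hQ : 0 < I.rowCount :=
      Nat.mul_pos (Nat.mul_pos (lt_of_le_of_lt (Nat.zero_le _) i.2) I.r_pos) (Nat.succ_pos _)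
    rw [hb j i i.2, hS i]
    by_cases hi : i ∈ S
    · rcases hrows3.entryAt j (hbQ j hQ) i with ⟨h1, -⟩ | ⟨k, h1, -⟩
      · have hl : I.lines s3 j (b j) i = none := by rw [lines, h1, decode_zero]
        simp [P, lineAssortment, hi, hl, h1]
      · have hl : I.lines s3 j (b j) i = some k := by rw [lines, h1, decode_succ]
        simp [P, lineAssortment, linePrices, hi, hl, h1]
    · simp [P, lineAssortment, hi]
  suffices hopt : I.opt ≤ ((4 * P.value : ℚ) : ℝ) by
    push_cast at hopt
    linarith
  refine opt_le fun O hO => ?_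
  -- With no products there are no thresholds, so the surrogate says nothing; all revenues are zero.
  rcases Nat.eq_zero_or_pos I.n with hn | hn
  · have : IsEmpty (Fin I.n) := by rw [hn]; infer_instance
    refine le_trans (sum_nonpos fun j _ => mul_nonpos_of_nonneg_of_nonpos
      (by exact_mod_cast I.weight_nonneg j) ?_) (by exact_mod_cast (by linarith : 0 ≤ 4 * P.value))
    have : Nonempty ({X : Finset (Fin I.n) // X ⊆ O} × (Fin I.n → Fin I.r)) :=
      ⟨⟨⟨∅, empty_subset _⟩, fun _ => ⟨0, I.r_pos⟩⟩⟩
    refine ciSup_le fun c => ?_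
    simp [revenue, eq_empty_of_isEmpty]
  · refine (hrows3.weighted_bestRevenue_le O).trans ?_
    have hQ : 0 < I.rowCount := Nat.mul_pos (Nat.mul_pos hn I.r_pos) (Nat.succ_pos _)
    -- Greedy makes `min n k` additions, and a competitor has no more elements than that.
    have h1 := hgreedy.le_two_mul hrows3.objective_mono hrows3.objective_submodular
      (O := O) (le_min (by simpa using card_le_univ O) hO)
    -- For each type some row earns at least half the surrogate, and the row chosen for output earns
    -- at least as much as any row.
    have h2 : I.objective s3 S ≤ 2 * P.value := by
      rw [objective, Solution.value, mul_sum]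
      refine sum_le_sum fun j _ => ?_
      obtain ⟨q, hq, h3⟩ := (hrows3.table j).exists_surrogate_le_two_mul hn S
      rw [← hrows3.rate_eq j hq] at h3
      have h4 := hbmax j q hq
      rw [hrows3.rate_eq j (hbQ j hQ)] at h4
      have h5 : I.surrogate I.rowCount (fun q => s3 7 (j * I.rowCount + q))
          (fun q i => s3 8 ((j * I.rowCount + q) * I.n + i)) S ≤
          2 * I.revenue j (P.offered j) (P.prices j) := h3.trans (by linarith)
      have := mul_le_mul_of_nonneg_left h5 (I.weight_nonneg j)
      linarith
    exact_mod_cast (by linarith : I.objective s3 O ≤ 4 * P.value)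

end Instance
end JointPricing

/-- The joint customization, pricing and assortment optimization problem under a mixture of
multinomial logit models has a polynomial-time `1/4`-approximation algorithm. -/
theorem corollary8 :
    ∃ (prog : LogRAM.Prog) (bound : Polynomial ℕ), ∀ I : JointPricing.Instance,
      ∃ (s : LogRAM.Mem) (cost : ℕ) (P : JointPricing.Solution I),
        LogRAM.Run prog I.input s cost ∧ cost ≤ bound.eval I.size ∧
          P.IsOutput s ∧ P.Feasible ∧ (1 / 4 : ℝ) * I.opt ≤ (P.value : ℝ) := by
  obtain ⟨C, hC⟩ := JointPricing.approxProg.exists_polynomial_costBound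
  -- The cost polynomial is evaluated at the common bound `30 * (size + 5) ^ 4` for cell lengths and
  -- loop rounds.
  refine ⟨JointPricing.approxProg, C.comp (30 * (.X + 5) ^ 4), fun I => ?_⟩
  obtain ⟨t, c, hr, hc, -, P, h1, h2, h3⟩ := I.approxProg_spec
  refine ⟨t, c, P, hr, ?_, h1, h2, h3⟩
  rw [hC] at hc
  simpa [Polynomial.eval_comp, JointPricing.Instance.width] using hc
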